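/- **Graphs.** A *graph* (Joyal–Kock) is a diagram of finite sets $i\curvearrowright A\xleftarrow{\,s\,}H\xrightarrow{\,p\,}V$ with $i$ a fixpoint-free involution on the set $A$ of arcs and $s$ injective; $H$ is the set of half-edges (flags), $V$ the set of vertices. Its *ports* are the arcs in $A\setminus s(H)$; an edge is an $i$-orbit, and an *isolated edge* is one disjoint from $s(H)$. An *etale map* consists of maps on $A,H,V$ commuting with $i,s,p$ whose square over $p$ is a pullback; $\mathbf{Gr}$ is the category of graphs and etale maps. A graph is *effective* if it is non-empty and has no isolated edges. An etale map is a *cover* if it is surjective on arcs and vertices, and a *reduced cover* if moreover no proper open subgraph of its domain still covers (between graphs without isolated edges: if it is bijective on vertices). The corolla $[n]$ on a finite set $n$ has one vertex, with flags $n$ and ports $n$. **Restricted Kleisli category.** A *graphical species* $F$ is a presheaf on the category of elementary graphs (the unit graph $I$, i.e. a single edge without vertices, and the corollas), i.e. a set $F[I]$ of colours with an involution, and for each finite set $n$ a set $F[n]$ of operations, functorial in bijections of $n$, with compatible projections $F[n]\to F[I]$ for the ports of $[n]$. Graphs embed fully faithfully in species. Let $\overline F[I]=F[I]$, and let $\overline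 F[n]$ be the set of isomorphism classes of effective graphs $G$ with a bijection of their set of ports with $n$ and a morphism of species $G\to F$. Then $F\mapsto\overline F$ is a monad, with unit given by corollas and multiplication by substitution of graphs into vertices. Let $\widetilde{\mathbf{Gr}}$ be the full subcategory of its Kleisli category on the graphs without isolated edges. Reduced covers are regarded as (free) morphisms in it. A Kleisli morphism $R\to Y$, i.e. a morphism of species $R\to\overline Y$, assigns to each vertex $x$ of $R$ an effective graph $S_x\to Y$ whose ports are the flags at $x$; gluing the $S_x$ as prescribed by $R$ gives a graph $S$ (a colimit) with an etale map $S\to Y$, and the morphism is *generic* if this map is invertible. **Borisov–Manin category.** A (finite) BM graph is $\tau=(V_\tau,F_\tau,\partial_\tau,j_\tau)$ with finite sets of vertices and flags, a map $\partial_\tau:F_\tau\to V_\tau$ and an involution $j_\tau$ on $F_\tau$; the fixpoints of $j_\tau$ are the *tails*, its two-element orbits the *edges*. A morphism $h:\tau\to\sigma$ is a triple $(h^F,h_V,j_h)$ with $h^F:F_\sigma\to F_\tau$ injective, $h_V:V_\tau\to V_\sigma$ surjective, $h^F(F_\sigma)$ stable under $j_\tau$, and $j_h$ a fixpoint-free involution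 on $F_\tau\setminus h^F(F_\sigma)$ that agrees with $j_\tau$ on edges, such that $h_V\partial_\tau h^F=\partial_\sigma$, such that $h_V\partial_\tau f=h_V\partial_\tau j_h f$ for $f\notin h^F(F_\sigma)$, and such that $(h^F)^{-1}$ maps edges of $\tau$ to edges of $\sigma$. The composite of $g:\tau\to\sigma$ and $c:\sigma\to\rho$ has $(c\circ g)_V=c_V g_V$, $(c\circ g)^F=g^Fc^F$, and its involution is $j_g$ off $g^F(F_\sigma)$ and $j_c$, transported along $g^F$, on the rest. Let $\mathbf{BM}$ be the resulting category. A *grafting* is a morphism with $h_V$ and $h^F$ bijective; a *compression* is a morphism with $h^F$ bijective on tails. They form wide subcategories $\mathbf{BM}_{\rm gr}$ and $\mathbf{BM}_{\rm comp}$. **The functors.** A BM graph $\tau$ gives a graph without isolated edges with $V=V_\tau$, $H=F_\tau$, $A=F_\tau\sqcup\{\text{tails}\}$, $s$ the inclusion, $p=\partial_\tau$, where $i$ is $j_\tau$ on flags in edges and exchanges each tail in $F_\tau$ with its copy. On morphisms, $\Phi_1:\mathbf{BM}_{\rm gr}\to\widetilde{\mathbf{Gr}}_{\rm rc}$ (the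 wide subcategory of reduced covers) sends a grafting $h$ to the etale map that is $h_V$ on vertices and $(h^F)^{-1}$ on half-edges. The functor $\Phi_2:\mathbf{BM}_{\rm comp}\to\widetilde{\mathbf{Gr}}_{\rm gen}^{\rm op}$ (generic morphisms, reversed) sends a compression $h:\sigma\to\rho$ to the Kleisli morphism $\Phi(\rho)\to\Phi(\sigma)$ given by $h^F$ on arcs and sending a vertex $x$ of $\rho$ to the graph $S_x$ that $h$ contracts to $x$: its vertices are $h_V^{-1}(x)$, its half-edges the flags of $\sigma$ at these vertices, its inner edges the edges among them contracted by $h$, and its ports are in bijection, via $h^F$, with the flags of $\rho$ at $x$. **Statement.** $\Phi_1$ and $\Phi_2$ are equivalences of categories, and the commutation laws correspond under them. That is, let $h:\tau\to\omega$ be a compression and $k:\omega\to\rho$ a grafting. Then there are a BM graph $\sigma$, a grafting $g:\tau\to\sigma$ and a compression $c:\sigma\to\rho$ with $c\circ g=k\circ h$; and for all such $\sigma,g,c$ the square $$\begin{array}{ccc}\Phi(\omega)&\xrightarrow{\ \Phi_1(k)\ }&\Phi(\rho)\\ {\scriptstyle\Phi_2(h)}\big\downarrow&&\big\downarrow{\scriptstyle\Phi_2(c)}\\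 \Phi(\tau)&\xrightarrow{\ \Phi_1(g)\ }&\Phi(\sigma)\end{array}$$ is a pushout square in $\widetilde{\mathbf{Gr}}$. -/

import Mathlib

open CategoryTheory

noncomputable section

namespace JK

/-! ### Graphs and etale morphisms -/

/-- A graph: a diagram of finite sets `A ← H → V` with a fixpoint-free involution `i` on the set
`A` of arcs and an injective `s : H → A`; `H` is the set of half-edges (flags), `V` the set of
vertices. -/
structure JKGraph where
  A : Type
  H : Type
  V : Type
  finA : Finite A
  finH : Finite H
  finV : Finite V
  i : A → A
  s : H → A
  p : H → V
  i_i : ∀ a, i (i a) = a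
  i_ne : ∀ a, i a ≠ a
  s_inj : Function.Injective s

namespace JKGraph

attribute [instance] finA finH finV

/-- Etale morphisms: the right-hand square `H' → V'` over `H → V` is a pullback. -/
@[ext]
structure Hom (X Y : JKGraph) where
  a : X.A → Y.A
  h : X.H → Y.H
  v : X.V → Y.V
  a_i : ∀ x, a (X.i x) = Y.i (a x)
  a_s : ∀ x, a (X.s x) = Y.s (h x)
  v_p : ∀ x, v (X.p x) = Y.p (h x)
  pull : ∀ (w : X.V) (y : Y.H), Y.p y = v w → ∃! x, X.p x = w ∧ h x = y

/-- The category of graphs and etale morphisms. -/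
instance : Category JKGraph where
  Hom := Hom
  id X := ⟨id, id, id, fun _ => rfl, fun _ => rfl, fun _ => rfl,
    fun w y hy => ⟨y, ⟨hy, rfl⟩, fun _ hz => hz.2⟩⟩
  comp {X Y Z} f g :=
    { a := g.a ∘ f.a
      h := g.h ∘ f.h
      v := g.v ∘ f.v
      a_i := fun x => by simp [f.a_i, g.a_i]
      a_s := fun x => by simp [f.a_s, g.a_s]
      v_p := fun x => by simp [f.v_p, g.v_p]
      pull := fun w z hz => by
        obtain ⟨y, ⟨hy1, hy2⟩, hy3⟩ := g.pull (f.v w) z hz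
        obtain ⟨x, ⟨hx1, hx2⟩, hx3⟩ := f.pull w y hy1
        refine ⟨x, ⟨hx1, by simp [hx2, hy2]⟩, ?_⟩
        rintro x' ⟨h1, h2⟩
        refine hx3 x' ⟨h1, hy3 _ ⟨?_, h2⟩⟩
        rw [← f.v_p, h1] }

@[ext]
theorem hom_ext {X Y : JKGraph} {f g : X ⟶ Y} (ha : ∀ x, Hom.a f x = Hom.a g x)
    (hh : ∀ x, Hom.h f x = Hom.h g x) (hv : ∀ x, Hom.v f x = Hom.v g x) : f = g :=
  Hom.ext (funext ha) (funext hh) (funext hv)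

@[simp] theorem id_a (X : JKGraph) (x : X.A) : Hom.a (𝟙 X) x = x := rfl
@[simp] theorem id_h (X : JKGraph) (x : X.H) : Hom.h (𝟙 X) x = x := rfl
@[simp] theorem id_v (X : JKGraph) (x : X.V) : Hom.v (𝟙 X) x = x := rfl
@[simp] theorem comp_a {X Y Z : JKGraph} (f : X ⟶ Y) (g : Y ⟶ Z) (x : X.A) :
    Hom.a (f ≫ g) x = Hom.a g (Hom.a f x) := rfl
@[simp] theorem comp_h {X Y Z : JKGraph} (f : X ⟶ Y) (g : Y ⟶ Z) (x : X.H) :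
    Hom.h (f ≫ g) x = Hom.h g (Hom.h f x) := rfl
@[simp] theorem comp_v {X Y Z : JKGraph} (f : X ⟶ Y) (g : Y ⟶ Z) (x : X.V) :
    Hom.v (f ≫ g) x = Hom.v g (Hom.v f x) := rfl

/-- The ports of a graph (its interface): the arcs not in the image of `s`. -/
abbrev Port (X : JKGraph) : Type := {a : X.A // a ∉ Set.range X.s}

/-- The flags at a vertex. -/
abbrev Fl (X : JKGraph) (x : X.V) : Type := {h : X.H // X.p h = x}

instance (X : JKGraph) (x : X.V) : Finite (X.Fl x) :=
  inferInstanceAs (Finite {h : X.H // X.p h = x})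

/-- No isolated edges: each edge has at least one of its two arcs in the image of `s`. -/
def NoIsolatedEdges (X : JKGraph) : Prop := ∀ a, a ∈ Set.range X.s ∨ X.i a ∈ Set.range X.s

/-- Effective graphs: nonempty and without isolated edges. (A graph without isolated edges is
nonempty precisely when it has a vertex.) -/
def Effective (X : JKGraph) : Prop := Nonempty X.V ∧ X.NoIsolatedEdges

/-- The corolla on a finite set `n`: one vertex, with set of flags `n` and set of ports `n`
(the ports being the arcs `Sum.inl k`). -/
abbrev corolla (n : Type) [Finite n] : JKGraph where
  A := n ⊕ n
  H := n
  V := Unit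
  finA := inferInstance
  finH := inferInstance
  finV := inferInstance
  i := Sum.swap
  s := Sum.inr
  p := fun _ => ()
  i_i := by simp
  i_ne := by rintro (a | a) <;> simp
  s_inj := Sum.inr_injective

variable {X Y : JKGraph} {n m : Type} [Finite n] [Finite m]

/-- The etale map out of a corolla that hits the vertex `x` and identifies the flags of the
corolla with those at `x`; port `k` goes to the arc pointing towards `x` along flag `e k`. -/
def mkCor (x : X.V) (e : n ≃ X.Fl x) : Hom (corolla n) X where
  a := Sum.elim (fun k => X.i (X.s (e k).1)) (fun k => X.s (e k).1)
  h := fun k => (e k).1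
  v := fun _ => x
  a_i := by rintro (a | a) <;> simp [X.i_i]
  a_s := by simp
  v_p := fun k => (e k).2.symm
  pull := by
    rintro ⟨⟩ y hy
    refine ⟨e.symm ⟨y, hy⟩, ⟨rfl, by simp⟩, ?_⟩
    rintro k ⟨_, rfl⟩
    exact (e.symm_apply_apply k).symm

theorem hom_a_inl (q : corolla n ⟶ X) (k : n) :
    Hom.a q (Sum.inl k) = X.i (X.s (Hom.h q k)) := by
  have := Hom.a_i q (Sum.inr k)
  have h2 := Hom.a_s q k
  exact this.trans (congrArg X.i h2)

theorem hom_a_inr (q : corolla n ⟶ X) (k : n) :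
    Hom.a q (Sum.inr k) = X.s (Hom.h q k) := Hom.a_s q k

theorem cor_ext {q q' : corolla n ⟶ X} (hh : ∀ k : n, Hom.h q k = Hom.h q' k)
    (hv : Hom.v q () = Hom.v q' ()) : q = q' := by
  ext x
  · rcases x with k | k
    · rw [hom_a_inl, hom_a_inl, hh]
    · rw [hom_a_inr, hom_a_inr, hh]
  · exact hh x
  · exact hv

/-- An etale map is bijective on the flags at each vertex. -/
def flMap (f : X ⟶ Y) (w : X.V) : X.Fl w ≃ Y.Fl (Hom.v f w) :=
  Equiv.ofBijective (fun k => ⟨Hom.h f k.1, by rw [← Hom.v_p f, k.2]⟩) (by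
    constructor
    · rintro ⟨k, hk⟩ ⟨l, hl⟩ hkl
      obtain ⟨z, -, hz⟩ := Hom.pull f w (Hom.h f l) (by rw [← Hom.v_p f, hl])
      exact Subtype.ext ((hz k ⟨hk, congrArg Subtype.val hkl⟩).trans (hz l ⟨hl, rfl⟩).symm)
    · rintro ⟨y, hy⟩
      obtain ⟨z, ⟨hz1, hz2⟩, -⟩ := Hom.pull f w y hy
      exact ⟨⟨z, hz1⟩, Subtype.ext hz2⟩)

@[simp] theorem flMap_val (f : X ⟶ Y) (w : X.V) (k : X.Fl w) :
    (flMap f w k).1 = Hom.h f k.1 := rfl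

/-- The flags of a corolla mapping to `X`, as flags at a vertex of `X`. -/
def flEquiv (q : corolla n ⟶ X) : n ≃ X.Fl (Hom.v q ()) :=
  (⟨fun k => ⟨k, rfl⟩, fun k => k.1, fun _ => rfl, fun _ => rfl⟩ :
    n ≃ (corolla n).Fl ()).trans (flMap q ())

@[simp] theorem flEquiv_val (q : corolla n ⟶ X) (k : n) : (flEquiv q k).1 = Hom.h q k := rfl

/-- The corolla at a vertex `x`. -/
def star (X : JKGraph) (x : X.V) : corolla (X.Fl x) ⟶ X := mkCor x (Equiv.refl _)

@[simp] theorem star_h (x : X.V) (k : X.Fl x) : Hom.h (X.star x) k = k.1 := rfl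
@[simp] theorem star_v (x : X.V) (u : Unit) : Hom.v (X.star x) u = x := rfl

/-- The map of corollas induced by a bijection. -/
def corMap (σ : m ≃ n) : corolla m ⟶ corolla n :=
  mkCor (X := corolla n) () (σ.trans ⟨fun k => ⟨k, rfl⟩, fun k => k.1, fun _ => rfl, fun _ => rfl⟩)

@[simp] theorem corMap_h (σ : m ≃ n) (k : m) : Hom.h (corMap σ) k = σ k := rfl
@[simp] theorem corMap_v (σ : m ≃ n) (k : Unit) : Hom.v (corMap σ) k = () := rfl
@[simp] theorem corMap_a_inl (σ : m ≃ n) (k : m) :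
  Hom.a (corMap σ) (Sum.inl k) = Sum.inl (σ k) := rfl

theorem eq_corMap_star (q : corolla n ⟶ X) :
    q = corMap (flEquiv q) ≫ X.star (Hom.v q ()) :=
  cor_ext (fun _ => rfl) rfl

end JKGraph

open JKGraph

/-! ### Graphical species -/

/-- A graphical species, i.e. a presheaf on the category of elementary graphs (the unit graph and
the corollas), given explicitly: its value `Col` on the unit graph, an involutive set (of colours);
its value `Op n` on the corolla on each finite set `n` (operations), functorial in bijections, with
the equivariant projections to `Col` corresponding to the ports of the corolla. (The projections
for the opposite arcs are got by applying the involution. Operations are allowed to form a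
`Type 1`, since isomorphism classes of finite graphs do.) -/
structure Species where
  Col : Type
  inv : Col → Col
  inv_inv : ∀ c, inv (inv c) = c
  Op : (n : Type) → [Finite n] → Type 1
  act : ∀ {n m : Type} [Finite n] [Finite m], (m ≃ n) → Op n → Op m
  act_refl : ∀ {n : Type} [Finite n] (x : Op n), act (Equiv.refl n) x = x
  act_trans : ∀ {n m k : Type} [Finite n] [Finite m] [Finite k] (σ : m ≃ n) (τ : k ≃ m) (x : Op n),
    act τ (act σ x) = act (τ.trans σ) x
  col : ∀ {n : Type} [Finite n], Op n → n → Col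
  col_act : ∀ {n m : Type} [Finite n] [Finite m] (σ : m ≃ n) (x : Op n) (k : m),
    col (act σ x) k = col x (σ k)

namespace Species

/-- Morphisms of graphical species: natural transformations. -/
@[ext]
structure Hom (F G : Species) where
  c : F.Col → G.Col
  o : ∀ {n : Type} [Finite n], F.Op n → G.Op n
  c_inv : ∀ x, c (F.inv x) = G.inv (c x)
  o_act : ∀ {n m : Type} [Finite n] [Finite m] (σ : m ≃ n) (x : F.Op n),
    o (F.act σ x) = G.act σ (o x)
  col_o : ∀ {n : Type} [Finite n] (x : F.Op n) (k : n), G.col (o x) k = c (F.col x k)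

instance : Category Species where
  Hom := Hom
  id F := ⟨id, id, fun _ => rfl, fun _ _ => rfl, fun _ _ => rfl⟩
  comp f g := ⟨g.c ∘ f.c, g.o ∘ f.o, fun x => by simp [f.c_inv, g.c_inv],
    fun σ x => by simp [f.o_act, g.o_act], fun x k => by simp [f.col_o, g.col_o]⟩

@[ext]
theorem hom_ext {F G : Species} {f g : F ⟶ G} (hc : ∀ x, Hom.c f x = Hom.c g x)
    (ho : ∀ (n : Type) [Finite n] (x : F.Op n), Hom.o f x = Hom.o g x) : f = g :=
  Hom.ext (funext hc) (by funext n _ x; exact ho n x)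

@[simp] theorem id_c (F : Species) (x : F.Col) : Hom.c (𝟙 F) x = x := rfl
@[simp] theorem id_o (F : Species) {n : Type} [Finite n] (x : F.Op n) : Hom.o (𝟙 F) x = x := rfl
@[simp] theorem comp_c {F G K : Species} (f : F ⟶ G) (g : G ⟶ K) (x : F.Col) :
    Hom.c (f ≫ g) x = Hom.c g (Hom.c f x) := rfl
@[simp] theorem comp_o {F G K : Species} (f : F ⟶ G) (g : G ⟶ K) {n : Type} [Finite n]
    (x : F.Op n) : Hom.o (f ≫ g) x = Hom.o g (Hom.o f x) := rfl

end Species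

/-- The species represented by a graph: colours are arcs (maps from the unit graph), operations are
etale maps from corollas. This is the fully faithful embedding of graphs in species. -/
def y : JKGraph ⥤ Species where
  obj X :=
    { Col := X.A
      inv := X.i
      inv_inv := X.i_i
      Op := fun n _ => ULift.{1} (corolla n ⟶ X)
      act := fun σ q => ⟨corMap σ ≫ q.down⟩
      act_refl := fun q => by
        apply ULift.ext
        exact cor_ext (fun _ => rfl) rfl
      act_trans := fun σ τ q => by
        apply ULift.ext
        exact cor_ext (fun _ => rfl) rfl
      col := fun q k => JKGraph.Hom.a q.down (Sum.inl k)
      col_act := fun _ _ _ => rfl }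
  map f :=
    { c := JKGraph.Hom.a f
      o := fun q => ⟨q.down ≫ f⟩
      c_inv := JKGraph.Hom.a_i f
      o_act := fun _ _ => rfl
      col_o := fun _ _ => rfl }

@[simp] theorem y_inv (X : JKGraph) (a : X.A) : (y.obj X).inv a = X.i a := rfl
@[simp] theorem y_map_c {X Y : JKGraph} (f : X ⟶ Y) (a : X.A) :
    Species.Hom.c (y.map f) a = JKGraph.Hom.a f a := rfl
@[simp] theorem y_map_o {X Y : JKGraph} (f : X ⟶ Y) {n : Type} [Finite n] (q : corolla n ⟶ X) :
    Species.Hom.o (y.map f) ⟨q⟩ = (⟨q ≫ f⟩ : ULift.{1} (corolla n ⟶ Y)) := rfl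

section Dec

variable {X Y : JKGraph} {F G : Species}

/-- The value of a decoration at a vertex. -/
def at' (d : y.obj X ⟶ F) (x : X.V) : F.Op (X.Fl x) := Species.Hom.o d ⟨X.star x⟩

theorem dec_o (d : y.obj X ⟶ F) {n : Type} [Finite n] (q : corolla n ⟶ X) :
    Species.Hom.o d ⟨q⟩ = F.act (flEquiv q) (at' d (JKGraph.Hom.v q ())) := by
  have := Species.Hom.o_act d (flEquiv q) ⟨X.star (JKGraph.Hom.v q ())⟩
  rw [at', ← this]
  congr 1
  exact ULift.ext _ _ (eq_corMap_star q)

theorem col_at (d : y.obj X ⟶ F) (x : X.V) (k : X.Fl x) :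
    F.col (at' d x) k = Species.Hom.c d (X.i (X.s k.1)) :=
  Species.Hom.col_o d _ k

theorem dec_ext {d d' : y.obj X ⟶ F} (hc : ∀ a, Species.Hom.c d a = Species.Hom.c d' a)
    (ho : ∀ x, at' d x = at' d' x) : d = d' := by
  apply Species.hom_ext hc
  rintro n _ ⟨q⟩
  rw [dec_o, dec_o, ho]

theorem at_comp (d : y.obj X ⟶ F) (f : F ⟶ G) (x : X.V) :
    at' (d ≫ f) x = Species.Hom.o f (at' d x) := rfl

theorem flEquiv_star_comp (f : X ⟶ Y) (x : X.V) : flEquiv (X.star x ≫ f) = flMap f x :=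
  Equiv.ext fun _ => rfl

theorem at_map (f : X ⟶ Y) (d : y.obj Y ⟶ F) (x : X.V) :
    at' (y.map f ≫ d) x = F.act (flMap f x) (at' d (JKGraph.Hom.v f x)) := by
  have := dec_o d (X.star x ≫ f)
  rw [flEquiv_star_comp] at this
  exact this

/-- A decoration of a graph amounts to colours on the arcs and operations on the vertices. -/
def mkDec (c : X.A → F.Col) (c_i : ∀ a, c (X.i a) = F.inv (c a)) (o : ∀ x, F.Op (X.Fl x))
    (hco : ∀ x k, F.col (o x) k = c (X.i (X.s k.1))) : y.obj X ⟶ F where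
  c := c
  o := fun q => F.act (flEquiv q.down) (o (JKGraph.Hom.v q.down ()))
  c_inv := c_i
  o_act := by
    rintro n m _ _ σ ⟨q⟩
    rw [F.act_trans]
    exact congrArg (fun e => F.act e (o (JKGraph.Hom.v q ()))) (Equiv.ext fun _ => rfl)
  col_o := by
    rintro n _ ⟨q⟩ k
    rw [F.col_act, hco]
    exact congrArg c (hom_a_inl q k).symm

@[simp] theorem mkDec_c (c : X.A → F.Col) (c_i) (o : ∀ x, F.Op (X.Fl x)) (hco) (a : X.A) :
    Species.Hom.c (mkDec c c_i o hco) a = c a := rfl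

@[simp] theorem mkDec_at (c : X.A → F.Col) (c_i) (o : ∀ x, F.Op (X.Fl x)) (hco) (x : X.V) :
    at' (mkDec c c_i o hco) x = o x := by
  have : flEquiv (X.star x) = Equiv.refl _ := Equiv.ext fun _ => rfl
  change F.act (flEquiv (X.star x)) (o x) = o x
  rw [this]
  exact F.act_refl (o x)

end Dec

section Full

variable {X Y : JKGraph}

/-- Fullness of the embedding of graphs in species. -/
def yPre (f : y.obj X ⟶ y.obj Y) : X ⟶ Y :=
  have key : ∀ (w : X.V) (k : X.Fl w), JKGraph.Hom.h (at' f w).down k =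
      JKGraph.Hom.h (at' f (X.p k.1)).down ⟨k.1, rfl⟩ := by
    rintro w ⟨k, rfl⟩
    rfl
  { a := Species.Hom.c f
    h := fun h => JKGraph.Hom.h (at' f (X.p h)).down ⟨h, rfl⟩
    v := fun x => JKGraph.Hom.v (at' f x).down ()
    a_i := Species.Hom.c_inv f
    a_s := fun h => by
      have h1 := col_at f (X.p h) ⟨h, rfl⟩
      have h2 := hom_a_inl (at' f (X.p h)).down ⟨h, rfl⟩
      have h3 : Species.Hom.c f (X.i (X.s h)) = Y.i (Species.Hom.c f (X.s h)) :=
        Species.Hom.c_inv f _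
      have h4 := congrArg Y.i ((h3.symm.trans h1.symm).trans h2)
      exact (Y.i_i _).symm.trans (h4.trans (Y.i_i _))
    v_p := fun h => JKGraph.Hom.v_p (at' f (X.p h)).down ⟨h, rfl⟩
    pull := fun w z hz => by
      obtain ⟨k, ⟨-, hk⟩, hu⟩ := JKGraph.Hom.pull (at' f w).down () z hz
      refine ⟨k.1, ⟨k.2, by rw [← key w k]; exact hk⟩, ?_⟩
      rintro x ⟨hx, hx2⟩
      have := hu ⟨x, hx⟩ ⟨rfl, by rw [key w ⟨x, hx⟩]; exact hx2⟩
      exact congrArg Subtype.val this }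

theorem y_yPre (f : y.obj X ⟶ y.obj Y) : y.map (yPre f) = f := by
  refine dec_ext (fun _ => rfl) fun x => ?_
  have : X.star x ≫ yPre f = (at' f x).down := cor_ext (by rintro ⟨k, rfl⟩; rfl) rfl
  exact ULift.ext _ _ this

theorem y_inj {f g : X ⟶ Y} (h : y.map f = y.map g) : f = g := by
  have hs : ∀ x, X.star x ≫ f = X.star x ≫ g := fun x =>
    congrArg ULift.down (congrArg (fun t => at' t x) h)
  ext x
  · exact congrArg (fun t => Species.Hom.c t x) h
  · exact congrArg (fun t : corolla (X.Fl (X.p x)) ⟶ Y =>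
      JKGraph.Hom.h t (⟨x, rfl⟩ : X.Fl (X.p x))) (hs (X.p x))
  · exact congrArg (fun t => JKGraph.Hom.v t ()) (hs x)

/-- The embedding of graphs in species is fully faithful. -/
def yFF : y.FullyFaithful where
  preimage := yPre
  map_preimage := y_yPre
  preimage_map _ := y_inj (y_yPre _)

end Full

/-! ### The monad -/

/-- An effective `n`-graph: an effective graph together with a bijection of its set of ports with
`n` (the set of ports of the corolla on `n`). -/
structure Shell (n : Type) [Finite n] : Type 1 where
  G : JKGraph
  eff : G.Effective
  port : n ≃ G.Port

/-- An effective `n`-graph decorated by a graphical species `F`, i.e. an effective `n`-graph `G`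
with a morphism `G ⟶ F` of species. -/
structure Piece (F : Species) (n : Type) [Finite n] : Type 1 extends Shell n where
  dec : y.obj G ⟶ F

namespace Shell

variable {n m : Type} [Finite n] [Finite m]

/-- Relabelling of ports. -/
@[simps]
def relabel (σ : m ≃ n) (S : Shell n) : Shell m where
  G := S.G
  eff := S.eff
  port := σ.trans S.port

theorem arc_cases (S : Shell n) (a : S.G.A) :
    (a ∈ Set.range S.G.s ∧ S.G.i a ∈ Set.range S.G.s) ∨
      (∃ k, a = (S.port k).1) ∨ ∃ k, a = S.G.i (S.port k).1 := by
  by_cases h1 : a ∈ Set.range S.G.s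
  · by_cases h2 : S.G.i a ∈ Set.range S.G.s
    · exact Or.inl ⟨h1, h2⟩
    · exact Or.inr (Or.inr ⟨S.port.symm ⟨_, h2⟩, by simp [S.G.i_i]⟩)
  · exact Or.inr (Or.inl ⟨S.port.symm ⟨_, h1⟩, by simp⟩)

theorem iport_mem (S : Shell n) (k : n) : S.G.i (S.port k).1 ∈ Set.range S.G.s :=
  (S.eff.2 (S.port k).1).resolve_left (S.port k).2

end Shell

namespace Piece

variable {F F' : Species} {n m : Type} [Finite n] [Finite m]

/-- Isomorphism of decorated `n`-graphs: an isomorphism of graphs compatible with the specified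
bijections on ports and with the decorations. -/
def Rel (P Q : Piece F n) : Prop :=
  ∃ θ : P.G ≅ Q.G, (∀ k, JKGraph.Hom.a θ.hom (P.port k).1 = (Q.port k).1) ∧
    y.map θ.hom ≫ Q.dec = P.dec

theorem rel_of {P Q : Piece F n} (f : y.obj P.G ⟶ y.obj Q.G) (g : y.obj Q.G ⟶ y.obj P.G)
    (hfg : f ≫ g = 𝟙 _) (hgf : g ≫ f = 𝟙 _)
    (hp : ∀ k, Species.Hom.c f (P.port k).1 = (Q.port k).1) (hd : f ≫ Q.dec = P.dec) :
    Rel P Q := by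
  refine ⟨yFF.preimageIso ⟨f, g, hfg, hgf⟩, hp, ?_⟩
  have : y.map (yFF.preimage f) = f := yFF.map_preimage f
  rw [← hd]
  exact congrArg (· ≫ Q.dec) this

theorem rel_refl (P : Piece F n) : Rel P P := ⟨Iso.refl _, fun _ => rfl, by simp⟩

/-- The groupoid of decorated `n`-graphs gives a set of isomorphism classes. -/
def setoid (F : Species) (n : Type) [Finite n] : Setoid (Piece F n) where
  r := Rel
  iseqv :=
    { refl := rel_refl
      symm := by
        rintro P Q ⟨θ, h1, h2⟩
        refine ⟨θ.symm, fun k => ?_, ?_⟩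
        · rw [← h1 k, ← JKGraph.comp_a]
          simp
        · rw [← h2, ← Category.assoc, ← y.map_comp]
          simp
      trans := by
        rintro P Q R ⟨θ, h1, h2⟩ ⟨ψ, h3, h4⟩
        refine ⟨θ ≪≫ ψ, fun k => ?_, ?_⟩
        · simp [h1, h3]
        · simp [h2, h4] }

/-- Relabelling of ports. -/
def relabel (σ : m ≃ n) (P : Piece F n) : Piece F m where
  toShell := P.toShell.relabel σ
  dec := P.dec

/-- Change of decorations. -/
def map (f : F ⟶ F') (P : Piece F n) : Piece F' n where
  toShell := P.toShell
  dec := P.dec ≫ f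

/-- The isomorphism class of a decorated `n`-graph. -/
def cls (P : Piece F n) : Quotient (setoid F n) := Quotient.mk _ P

theorem cls_eq {P Q : Piece F n} : cls P = cls Q ↔ Rel P Q :=
  ⟨fun h => Quotient.exact h, fun h => Quotient.sound (s := setoid F n) h⟩

theorem relabel_rel (σ : m ≃ n) {P Q : Piece F n} (h : Rel P Q) :
    Rel (relabel σ P) (relabel σ Q) := by
  obtain ⟨θ, h1, h2⟩ := h
  exact ⟨θ, fun k => h1 (σ k), h2⟩

theorem map_rel (f : F ⟶ F') {P Q : Piece F n} (h : Rel P Q) : Rel (map f P) (map f Q) := by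
  obtain ⟨θ, h1, h2⟩ := h
  refine ⟨θ, h1, ?_⟩
  change y.map θ.hom ≫ Q.dec ≫ f = P.dec ≫ f
  rw [← h2, Category.assoc]

end Piece

open Piece

/-- The species `F̄` of `F`-decorated effective graphs: same colours as `F`, and the operations on
`n` are the isomorphism classes of effective `n`-graphs decorated by `F`. -/
def bar (F : Species) : Species where
  Col := F.Col
  inv := F.inv
  inv_inv := F.inv_inv
  Op := fun n _ => Quotient (setoid F n)
  act := fun σ => Quotient.lift (fun P => cls (relabel σ P))
    fun _ _ h => cls_eq.2 (relabel_rel σ h)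
  act_refl := by
    rintro n _ ⟨P⟩
    rfl
  act_trans := by
    rintro n m k _ _ _ σ τ ⟨P⟩
    rfl
  col := fun {n} _ => Quotient.lift (fun P k => Species.Hom.c P.dec (P.port k).1) (by
    rintro P Q ⟨θ, h1, h2⟩
    funext k
    rw [← h1, ← h2]
    rfl)
  col_act := by
    rintro n m _ _ σ ⟨P⟩ k
    rfl

@[simp] theorem bar_act {F : Species} {n m : Type} [Finite n] [Finite m] (σ : m ≃ n)
    (P : Piece F n) : (bar F).act σ (cls P) = cls (relabel σ P) := rfl

theorem bar_col {F : Species} {n : Type} [Finite n] (P : Piece F n) (k : n) :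
    (bar F).col (cls P) k = Species.Hom.c P.dec (P.port k).1 := rfl

/-- The action of `F ↦ F̄` on morphisms: change of decorations. -/
def barMap {F F' : Species} (f : F ⟶ F') : bar F ⟶ bar F' where
  c := @Species.Hom.c F F' f
  o := Quotient.lift (fun P => cls (map f P)) fun _ _ h => cls_eq.2 (map_rel f h)
  c_inv := @Species.Hom.c_inv F F' f
  o_act := by
    rintro n m _ _ σ ⟨P⟩
    rfl
  col_o := by
    rintro n _ ⟨P⟩ k
    rfl

theorem barMap_cls {F F' : Species} (f : F ⟶ F') {n : Type} [Finite n]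
    (P : Piece F n) : Species.Hom.o (barMap f) (cls P) = cls (map f P) := rfl

/-- The endofunctor `F ↦ F̄`. -/
def barFunctor : Species ⥤ Species where
  obj := bar
  map := barMap
  map_id F := by
    refine Species.hom_ext (fun _ => rfl) ?_
    rintro n _ ⟨P⟩
    exact cls_eq.2 ⟨Iso.refl _, fun _ => rfl, by simp [Piece.map]⟩
  map_comp f g := by
    refine Species.hom_ext (fun _ => rfl) ?_
    rintro n _ ⟨P⟩
    exact cls_eq.2 ⟨Iso.refl _, fun _ => rfl, by simp [Piece.map]⟩

/-- The corolla on `n`, as an `n`-graph. -/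
def corShell (n : Type) [Finite n] : Shell n where
  G := corolla n
  eff := ⟨⟨()⟩, by rintro (a | a) <;> simp⟩
  port := Equiv.ofBijective (fun k => ⟨Sum.inl k, by simp⟩) ⟨fun a b h => by simpa using h, by
    rintro ⟨a | a, ha⟩
    · exact ⟨a, rfl⟩
    · exact absurd ⟨a, rfl⟩ ha⟩

@[simp] theorem corShell_port {n : Type} [Finite n] (k : n) :
    ((corShell n).port k).1 = Sum.inl k := rfl

/-- The canonical identification of `n` with the flags of the corolla on `n`. -/
def corFl (n : Type) [Finite n] : n ≃ (corolla n).Fl () :=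
  ⟨fun k => ⟨k, rfl⟩, fun k => k.1, fun _ => rfl, fun _ => rfl⟩

/-- The corolla decorated by a single operation. -/
def corDec {F : Species} {n : Type} [Finite n] (x : F.Op n) : y.obj (corolla n) ⟶ F :=
  mkDec (X := corolla n) (Sum.elim (F.col x) (fun k => F.inv (F.col x k)))
    (by rintro (a | a) <;> simp [F.inv_inv])
    (fun _ => F.act (corFl n).symm x)
    (by
      rintro ⟨⟩ k
      rw [F.col_act]
      rfl)

theorem cor_dec_ext {F : Species} {n : Type} [Finite n] {d d' : y.obj (corolla n) ⟶ F}
    (h : Species.Hom.o d ⟨𝟙 (corolla n)⟩ = Species.Hom.o d' ⟨𝟙 (corolla n)⟩) : d = d' := by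
  have hc : ∀ k : n, Species.Hom.c d (Sum.inl k : n ⊕ n) = Species.Hom.c d' (Sum.inl k : n ⊕ n) :=
    fun k => (Species.Hom.col_o d ⟨𝟙 (corolla n)⟩ k).symm.trans
      ((congrArg (fun t => F.col t k) h).trans (Species.Hom.col_o d' ⟨𝟙 (corolla n)⟩ k))
  refine Species.hom_ext ?_ ?_
  · rintro (k | k)
    · exact hc k
    · exact (Species.Hom.c_inv d (Sum.inl k : n ⊕ n)).trans
        ((congrArg F.inv (hc k)).trans (Species.Hom.c_inv d' (Sum.inl k : n ⊕ n)).symm)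
  · rintro m _ ⟨q⟩
    have hq : (⟨q⟩ : (y.obj (corolla n)).Op m) =
        (y.obj (corolla n)).act ((flEquiv q).trans (corFl n).symm) ⟨𝟙 (corolla n)⟩ :=
      ULift.ext _ _ (cor_ext (fun k => rfl) rfl)
    rw [hq]
    exact (Species.Hom.o_act d _ _).trans
      ((congrArg (F.act _) h).trans (Species.Hom.o_act d' _ _).symm)

theorem corDec_at {F : Species} {n : Type} [Finite n] (x : F.Op n) :
    at' (corDec x) () = F.act (corFl n).symm x :=
  mkDec_at (X := corolla n) _ _ _ _ _

theorem corDec_id {F : Species} {n : Type} [Finite n] (x : F.Op n) :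
    Species.Hom.o (corDec x) ⟨𝟙 (corolla n)⟩ = x := by
  have : F.act (flEquiv (𝟙 (corolla n))) (F.act (corFl n).symm x) = x := by
    rw [F.act_trans]
    have : (flEquiv (𝟙 (corolla n))).trans (corFl n).symm = Equiv.refl n := Equiv.ext fun _ => rfl
    exact (congrArg (fun e => F.act e x) this).trans (F.act_refl x)
  exact this

/-- The unit of the monad: an operation is regarded as a decorated corolla. -/
def etaApp (F : Species) : F ⟶ bar F where
  c := id
  o {n} _ x := cls ⟨corShell n, corDec x⟩
  c_inv := fun _ => rfl
  o_act := by
    rintro n m _ _ σ x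
    refine cls_eq.2 ⟨⟨corMap σ, corMap σ.symm, cor_ext (fun k => σ.symm_apply_apply k) rfl,
      cor_ext (fun k => σ.apply_symm_apply k) rfl⟩,
      fun k => rfl, ?_⟩
    refine cor_dec_ext ?_
    refine Eq.trans ?_ (corDec_id _).symm
    have := Species.Hom.o_act (corDec x) σ ⟨𝟙 (corolla n)⟩
    rw [corDec_id] at this
    refine Eq.trans ?_ this
    exact congrArg (Species.Hom.o (corDec x)) (ULift.ext _ _ (cor_ext (fun _ => rfl) rfl))
  col_o := fun _ _ => rfl

theorem eta_nat {F F' : Species} (f : F ⟶ F') :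
    f ≫ etaApp F' = etaApp F ≫ barMap f := by
  refine Species.hom_ext (fun _ => rfl) ?_
  intro n _ x
  refine cls_eq.2 ⟨Iso.refl _, fun _ => rfl, ?_⟩
  refine cor_dec_ext ?_
  refine Eq.trans ?_ (corDec_id _).symm
  change Species.Hom.o f (Species.Hom.o (corDec x) ⟨𝟙 (corolla n)⟩) = _
  rw [corDec_id]

theorem chase {C : Type*} [Category C] {W X Y Z : C} {i : W ⟶ X} {f : X ⟶ Y} {g : Y ⟶ Z}
    {j : W ⟶ Y} {r : W ⟶ Z} (h : i ≫ f = j) (h2 : j ≫ g = r) : i ≫ f ≫ g = r := by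
  rw [← Category.assoc, h, h2]

theorem chase2 {C : Type*} [Category C] {W X Y Z : C} {i : W ⟶ X} {f : X ⟶ Y} {g : Y ⟶ Z}
    {j : X ⟶ Z} {r : W ⟶ Z} (h : f ≫ g = j) (h2 : i ≫ j = r) : (i ≫ f) ≫ g = r := by
  rw [Category.assoc, h, h2]

theorem y_cancel {X Y : JKGraph} (θ : X ≅ Y) {K : Species} (f : y.obj X ⟶ K) :
    y.map θ.hom ≫ y.map θ.inv ≫ f = f := by
  rw [← Category.assoc, ← y.map_comp, Iso.hom_inv_id, y.map_id, Category.id_comp]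

section Glue

variable (R : JKGraph) (P : ∀ x : R.V, Shell (R.Fl x))

/-- The inner arcs of a graph: those belonging to inner edges. -/
abbrev JKGraph.Inner (X : JKGraph) : Type :=
  {a : X.A // a ∈ Set.range X.s ∧ X.i a ∈ Set.range X.s}

open Classical in
/-- Where the arcs of the graph substituted into the vertex `x` of `R` go: inner arcs are kept,
port `k` is identified with the arc of `R` pointing towards `x` along the flag `k`. -/
def glueArc (x : R.V) (a : (P x).G.A) : R.A ⊕ Σ x, (P x).G.Inner :=
  if h1 : a ∈ Set.range (P x).G.s then
    if h2 : (P x).G.i a ∈ Set.range (P x).G.s then Sum.inr ⟨x, a, h1, h2⟩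
    else Sum.inl (R.s ((P x).port.symm ⟨_, h2⟩).1)
  else Sum.inl (R.i (R.s ((P x).port.symm ⟨a, h1⟩).1))

variable {R}

theorem glueArc_inner (x : R.V) (a : (P x).G.Inner) : glueArc R P x a.1 = Sum.inr ⟨x, a⟩ := by
  rw [glueArc, dif_pos a.2.1, dif_pos a.2.2]

theorem glueArc_port (x : R.V) (k : R.Fl x) :
    glueArc R P x ((P x).port k).1 = Sum.inl (R.i (R.s k.1)) := by
  rw [glueArc, dif_neg ((P x).port k).2]
  simp

theorem glueArc_iport (x : R.V) (k : R.Fl x) :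
    glueArc R P x ((P x).G.i ((P x).port k).1) = Sum.inl (R.s k.1) := by
  have h : ((P x).G.i ((P x).G.i ((P x).port k).1)) ∉ Set.range (P x).G.s := by
    rw [(P x).G.i_i]
    exact ((P x).port k).2
  rw [glueArc, dif_pos ((P x).iport_mem k), dif_neg h]
  simp [(P x).G.i_i]

theorem glueArc_i (x : R.V) (a : (P x).G.A) :
    glueArc R P x ((P x).G.i a) =
      Sum.map R.i (fun t => ⟨t.1, (P t.1).G.i t.2.1, t.2.2.2, by
        rw [(P t.1).G.i_i]; exact t.2.2.1⟩) (glueArc R P x a) := by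
  rcases (P x).arc_cases a with h | ⟨k, rfl⟩ | ⟨k, rfl⟩
  · rw [glueArc_inner P x ⟨a, h⟩]
    exact glueArc_inner P x ⟨(P x).G.i a, h.2, by rw [(P x).G.i_i]; exact h.1⟩
  · rw [glueArc_iport, glueArc_port]
    simp [R.i_i]
  · rw [glueArc_iport, (P x).G.i_i, glueArc_port]
    simp

variable (R)

/-- Substitution of graphs `P x` into the vertices `x` of `R`, i.e. the graph obtained by gluing
together the graphs `P x` according to the same recipe that assembles `R` from its corollas. -/
@[reducible]
def glue : JKGraph where
  A := R.A ⊕ Σ x, (P x).G.Inner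
  H := Σ x, (P x).G.H
  V := Σ x, (P x).G.V
  finA := inferInstance
  finH := inferInstance
  finV := inferInstance
  i := Sum.map R.i (fun t => ⟨t.1, (P t.1).G.i t.2.1, t.2.2.2, by
        rw [(P t.1).G.i_i]; exact t.2.2.1⟩)
  s := fun t => glueArc R P t.1 ((P t.1).G.s t.2)
  p := fun t => ⟨t.1, (P t.1).G.p t.2⟩
  i_i := by
    rintro (a | ⟨x, a, ha⟩)
    · simp [R.i_i]
    · simp [(P x).G.i_i]
  i_ne := by
    rintro (a | ⟨x, a, ha⟩)
    · simp [R.i_ne]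
    · simp [(P x).G.i_ne]
  s_inj := by
    rintro ⟨x, h⟩ ⟨x', h'⟩ e
    dsimp only at e
    have key : ∀ (x : R.V) (h : (P x).G.H),
        (∃ ha, glueArc R P x ((P x).G.s h) = Sum.inr ⟨x, (P x).G.s h, ha⟩) ∨
        ∃ k, (P x).G.s h = (P x).G.i ((P x).port k).1 ∧
          glueArc R P x ((P x).G.s h) = Sum.inl (R.s k.1) := by
      intro x h
      rcases (P x).arc_cases ((P x).G.s h) with ha | ⟨k, hk⟩ | ⟨k, hk⟩
      · exact Or.inl ⟨ha, glueArc_inner P x ⟨_, ha⟩⟩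
      · exact absurd ⟨h, hk⟩ ((P x).port k).2
      · exact Or.inr ⟨k, hk, by rw [hk, glueArc_iport]⟩
    rcases key x h with ⟨ha, e1⟩ | ⟨k, hk, e1⟩ <;>
      rcases key x' h' with ⟨ha', e2⟩ | ⟨k', hk', e2⟩ <;> rw [e1, e2] at e
    · have e3 := Sum.inr_injective e
      obtain ⟨rfl, e4⟩ := Sigma.mk.inj e3
      have e5 := congrArg Subtype.val (eq_of_heq e4)
      rw [(P x).G.s_inj e5]
    · cases e
    · cases e
    · have e3 := R.s_inj (Sum.inl_injective e)
      obtain ⟨k, rfl⟩ := k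
      obtain ⟨k', rfl⟩ := k'
      dsimp only at e3
      subst e3
      have e5 := hk.trans hk'.symm
      rw [(P _).G.s_inj e5]

/-- The canonical etale map from the graph substituted into `x`. -/
def glueι (x : R.V) : (P x).G ⟶ glue R P where
  a := glueArc R P x
  h := fun h => ⟨x, h⟩
  v := fun v => ⟨x, v⟩
  a_i := glueArc_i P x
  a_s := fun _ => rfl
  v_p := fun _ => rfl
  pull := by
    rintro w ⟨x', h⟩ e
    obtain ⟨rfl, e4⟩ := Sigma.mk.inj e
    refine ⟨h, ⟨eq_of_heq e4, rfl⟩, ?_⟩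
    rintro h' ⟨-, e5⟩
    exact eq_of_heq (Sigma.mk.inj e5).2

theorem glue_arc_cases (a : (glue R P).A) :
    (∃ b : R.A, a = Sum.inl b) ∨ ∃ x, ∃ b : (P x).G.A, a = JKGraph.Hom.a (glueι R P x) b := by
  rcases a with b | ⟨x, b⟩
  · exact Or.inl ⟨b, rfl⟩
  · exact Or.inr ⟨x, b.1, (glueArc_inner P x b).symm⟩

theorem glueι_port (x : R.V) (k : R.Fl x) :
    JKGraph.Hom.a (glueι R P x) ((P x).port k).1 = Sum.inl (R.i (R.s k.1)) :=
  glueArc_port P x k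

theorem glue_range_s (b : R.A) :
    (Sum.inl b : (glue R P).A) ∈ Set.range (glue R P).s ↔ b ∈ Set.range R.s := by
  constructor
  · rintro ⟨⟨x, h⟩, e⟩
    change glueArc R P x ((P x).G.s h) = _ at e
    rcases (P x).arc_cases ((P x).G.s h) with ha | ⟨k, hk⟩ | ⟨k, hk⟩
    · have := e.symm.trans (glueArc_inner P x ⟨_, ha⟩)
      cases this
    · exact absurd ⟨h, hk⟩ ((P x).port k).2
    · rw [hk, glueArc_iport] at e
      exact ⟨k.1, Sum.inl_injective e⟩
  · rintro ⟨k, rfl⟩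
    obtain ⟨h, hh⟩ := (P (R.p k)).iport_mem ⟨k, rfl⟩
    refine ⟨⟨R.p k, h⟩, ?_⟩
    change glueArc R P (R.p k) ((P (R.p k)).G.s h) = _
    rw [hh, glueArc_iport]

theorem glue_inner_mem (x : R.V) (b : (P x).G.Inner) :
    (Sum.inr ⟨x, b⟩ : (glue R P).A) ∈ Set.range (glue R P).s := by
  obtain ⟨b, ⟨h, rfl⟩, hb⟩ := b
  exact ⟨⟨x, h⟩, glueArc_inner P x ⟨_, ⟨h, rfl⟩, hb⟩⟩

theorem glue_noIsolatedEdges (hR : R.NoIsolatedEdges) : (glue R P).NoIsolatedEdges := by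
  rintro (b | ⟨x, b⟩)
  · exact (hR b).imp (glue_range_s R P b).2 (glue_range_s R P (R.i b)).2
  · exact Or.inl (glue_inner_mem R P x b)

theorem glue_effective (hR : R.Effective) : (glue R P).Effective := by
  refine ⟨?_, glue_noIsolatedEdges R P hR.2⟩
  obtain ⟨x⟩ := hR.1
  obtain ⟨v⟩ := (P x).eff.1
  exact ⟨⟨x, v⟩⟩

/-- The ports of `R` are the ports of the graph obtained by substitution. -/
def gluePort : R.Port ≃ (glue R P).Port :=
  Equiv.ofBijective (fun b => ⟨Sum.inl b.1, fun h => b.2 ((glue_range_s R P b.1).1 h)⟩) (by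
    constructor
    · intro b b' h
      exact Subtype.ext (Sum.inl_injective (congrArg Subtype.val h))
    · rintro ⟨b | ⟨x, b⟩, hb⟩
      · exact ⟨⟨b, fun h => hb ((glue_range_s R P b).2 h)⟩, rfl⟩
      · exact absurd (glue_inner_mem R P x b) hb)

@[simp] theorem gluePort_val (b : R.Port) : (gluePort R P b).1 = Sum.inl b.1 := rfl

variable {K : Species}

theorem glue_ext {f g : y.obj (glue R P) ⟶ K}
    (h : ∀ b : R.A, Species.Hom.c f (Sum.inl b : R.A ⊕ _) = Species.Hom.c g (Sum.inl b : R.A ⊕ _))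
    (hι : ∀ x, y.map (glueι R P x) ≫ f = y.map (glueι R P x) ≫ g) : f = g := by
  refine dec_ext ?_ ?_
  · intro a
    obtain ⟨b, rfl⟩ | ⟨x, b, rfl⟩ := glue_arc_cases R P a
    · exact h b
    · exact congrArg (fun t => Species.Hom.c t b) (hι x)
  · rintro ⟨x, v⟩
    have h1 := congrArg (fun t => at' t v) (hι x)
    simp only [at_map] at h1
    have h2 := congrArg (K.act (flMap (glueι R P x) v).symm) h1
    rw [K.act_trans, K.act_trans, Equiv.symm_trans_self, K.act_refl, K.act_refl] at h2
    exact h2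

theorem glue_c_aux (c : R.A → K.Col) (c_i : ∀ a, c (R.i a) = K.inv (c a))
    (d : ∀ x, y.obj (P x).G ⟶ K)
    (hd : ∀ x k, Species.Hom.c (d x) ((P x).port k).1 = c (R.i (R.s k.1)))
    (x : R.V) (a : (P x).G.A) :
    Sum.elim c (fun t : Σ x, (P x).G.Inner => Species.Hom.c (d t.1) t.2.1) (glueArc R P x a) =
      Species.Hom.c (d x) a := by
  rcases (P x).arc_cases a with h | ⟨k, rfl⟩ | ⟨k, rfl⟩
  · rw [glueArc_inner P x ⟨a, h⟩]
    rfl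
  · rw [glueArc_port, hd]
    rfl
  · rw [glueArc_iport]
    have h1 : Species.Hom.c (d x) ((P x).G.i ((P x).port k).1) =
      K.inv (Species.Hom.c (d x) ((P x).port k).1) := Species.Hom.c_inv (d x) _
    rw [h1, hd, ← c_i, R.i_i]
    rfl

/-- The universal property of substitution: a decoration of the graph obtained by substitution
is given by decorations of the graphs `P x` that agree along the edges of `R`. -/
def glueDesc (c : R.A → K.Col) (c_i : ∀ a, c (R.i a) = K.inv (c a))
    (d : ∀ x, y.obj (P x).G ⟶ K)
    (hd : ∀ x k, Species.Hom.c (d x) ((P x).port k).1 = c (R.i (R.s k.1))) : y.obj (glue R P) ⟶ K :=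
  mkDec (X := glue R P)
    (Sum.elim c (fun t : Σ x, (P x).G.Inner => Species.Hom.c (d t.1) t.2.1))
    (by
      rintro (a | ⟨x, a⟩)
      · exact c_i a
      · exact Species.Hom.c_inv (d x) a.1)
    (fun t => K.act (flMap (glueι R P t.1) t.2).symm (at' (d t.1) t.2))
    (by
      rintro ⟨x, v⟩ k
      obtain ⟨k, rfl⟩ := (flMap (glueι R P x) v).surjective k
      refine (K.col_act (flMap (glueι R P x) v).symm (at' (d x) v) _).trans ?_
      rw [Equiv.symm_apply_apply, col_at]
      refine (glue_c_aux R P c c_i d hd x _).symm.trans ?_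
      congr 1
      exact JKGraph.Hom.a_i (glueι R P x) ((P x).G.s k.1))

@[simp] theorem glueDesc_inl (c : R.A → K.Col) (c_i : ∀ a, c (R.i a) = K.inv (c a))
    (d : ∀ x, y.obj (P x).G ⟶ K)
    (hd : ∀ x k, Species.Hom.c (d x) ((P x).port k).1 = c (R.i (R.s k.1))) (b : R.A) :
    Species.Hom.c (glueDesc R P c c_i d hd) (Sum.inl b : R.A ⊕ _) = c b := rfl

theorem glueDesc_at (c : R.A → K.Col) (c_i : ∀ a, c (R.i a) = K.inv (c a))
    (d : ∀ x, y.obj (P x).G ⟶ K)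
    (hd : ∀ x k, Species.Hom.c (d x) ((P x).port k).1 = c (R.i (R.s k.1))) (x : R.V) (v : (P x).G.V) :
    at' (glueDesc R P c c_i d hd) ⟨x, v⟩ =
      K.act (flMap (glueι R P x) v).symm (at' (d x) v) :=
  mkDec_at (X := glue R P) _ _ _ _ _

@[simp] theorem glueι_desc (c : R.A → K.Col) (c_i : ∀ a, c (R.i a) = K.inv (c a))
    (d : ∀ x, y.obj (P x).G ⟶ K)
    (hd : ∀ x k, Species.Hom.c (d x) ((P x).port k).1 = c (R.i (R.s k.1))) (x : R.V) :
    y.map (glueι R P x) ≫ glueDesc R P c c_i d hd = d x := by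
  refine dec_ext (glue_c_aux R P c c_i d hd x) ?_
  intro v
  rw [at_map]
  refine (congrArg (K.act (flMap (glueι R P x) v)) (glueDesc_at R P c c_i d hd x v)).trans ?_
  rw [K.act_trans, Equiv.self_trans_symm, K.act_refl]

end Glue

section Sub

variable {F F' : Species} {n m : Type} [Finite n] [Finite m]

/-- Erasing the circles: from an effective `n`-graph `R` whose vertices are decorated by effective
`F`-graphs `P x` with matching interfaces, get a single `F`-decorated effective `n`-graph. -/
def substPiece (R : Shell n) (c : R.G.A → F.Col) (c_i : ∀ a, c (R.G.i a) = F.inv (c a))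
    (P : ∀ x : R.G.V, Piece F (R.G.Fl x))
    (hP : ∀ x k, Species.Hom.c (P x).dec ((P x).port k).1 = c (R.G.i (R.G.s k.1))) :
    Piece F n where
  G := glue R.G (fun x => (P x).toShell)
  eff := glue_effective R.G (fun x => (P x).toShell) R.eff
  port := R.port.trans (gluePort R.G fun x => (P x).toShell)
  dec := glueDesc R.G (fun x => (P x).toShell) c c_i (fun x => (P x).dec) hP

theorem substPiece_ι (R : Shell n) (c : R.G.A → F.Col) (c_i : ∀ a, c (R.G.i a) = F.inv (c a))
    (P : ∀ x : R.G.V, Piece F (R.G.Fl x))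
    (hP : ∀ x k, Species.Hom.c (P x).dec ((P x).port k).1 = c (R.G.i (R.G.s k.1))) (x : R.G.V) :
    y.map (glueι R.G (fun x => (P x).toShell) x) ≫ (substPiece R c c_i P hP).dec = (P x).dec :=
  glueι_desc R.G (fun x => (P x).toShell) c c_i (fun x => (P x).dec) hP x

theorem substPiece_at (R : Shell n) (c : R.G.A → F.Col) (c_i : ∀ a, c (R.G.i a) = F.inv (c a))
    (P : ∀ x : R.G.V, Piece F (R.G.Fl x))
    (hP : ∀ x k, Species.Hom.c (P x).dec ((P x).port k).1 = c (R.G.i (R.G.s k.1))) (x : R.G.V)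
    (v : (P x).G.V) :
    at' (X := glue R.G fun x => (P x).toShell) (substPiece R c c_i P hP).dec ⟨x, v⟩ =
      F.act (flMap (glueι R.G (fun x => (P x).toShell) x) v).symm (at' (P x).dec v) :=
  glueDesc_at R.G (fun x => (P x).toShell) c c_i (fun x => (P x).dec) hP x v

theorem substPiece_rel {R R' : Shell n} {c : R.G.A → F.Col}
    {c_i : ∀ a, c (R.G.i a) = F.inv (c a)}
    {c' : R'.G.A → F.Col} {c_i' : ∀ a, c' (R'.G.i a) = F.inv (c' a)}
    {P : ∀ x : R.G.V, Piece F (R.G.Fl x)} {P' : ∀ x : R'.G.V, Piece F (R'.G.Fl x)}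
    {hP : ∀ x k, Species.Hom.c (P x).dec ((P x).port k).1 = c (R.G.i (R.G.s k.1))}
    {hP' : ∀ x k, Species.Hom.c (P' x).dec ((P' x).port k).1 = c' (R'.G.i (R'.G.s k.1))}
    (θ : R.G ≅ R'.G) (hport : ∀ k, JKGraph.Hom.a θ.hom (R.port k).1 = (R'.port k).1)
    (hc : ∀ a, c' (JKGraph.Hom.a θ.hom a) = c a)
    (h : ∀ x, Rel (P x) (relabel (flMap θ.hom x) (P' (JKGraph.Hom.v θ.hom x)))) :
    Rel (substPiece R c c_i P hP) (substPiece R' c' c_i' P' hP') := by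
  choose ψ h1 h2 using h
  have hinv : ∀ a, JKGraph.Hom.a θ.inv (JKGraph.Hom.a θ.hom a) = a := fun a =>
    congrArg (fun t => JKGraph.Hom.a t a) θ.hom_inv_id
  have hinv' : ∀ a, JKGraph.Hom.a θ.hom (JKGraph.Hom.a θ.inv a) = a := fun a =>
    congrArg (fun t => JKGraph.Hom.a t a) θ.inv_hom_id
  let e : R.G.V ≃ R'.G.V := ⟨JKGraph.Hom.v θ.hom, JKGraph.Hom.v θ.inv,
    fun v => congrArg (fun t => JKGraph.Hom.v t v) θ.hom_inv_id,
    fun v => congrArg (fun t => JKGraph.Hom.v t v) θ.inv_hom_id⟩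
  let S := glue R.G (fun x => (P x).toShell)
  let S' := glue R'.G (fun x => (P' x).toShell)
  let ι := glueι R.G (fun x => (P x).toShell)
  let ι' := glueι R'.G (fun x => (P' x).toShell)
  let f : y.obj S ⟶ y.obj S' := glueDesc (K := y.obj S') R.G (fun x => (P x).toShell)
    (fun a => (Sum.inl (JKGraph.Hom.a θ.hom a) : R'.G.A ⊕ _))
    (fun a => congrArg Sum.inl (JKGraph.Hom.a_i θ.hom a))
    (fun x => y.map (ψ x).hom ≫ y.map (ι' (e x)))
    (by
      intro x k
      change JKGraph.Hom.a (ι' (e x)) (JKGraph.Hom.a (ψ x).hom ((P x).port k).1) = _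
      rw [h1]
      refine (glueι_port R'.G (fun x => (P' x).toShell) (e x) (flMap θ.hom x k)).trans ?_
      congr 1
      rw [JKGraph.Hom.a_i, JKGraph.Hom.a_s]
      rfl)
  let d' : ∀ x', y.obj (P' x').G ⟶ y.obj S := e.piCongrLeft (fun x' => y.obj (P' x').G ⟶ y.obj S)
    (fun x => y.map (ψ x).inv ≫ y.map (ι x))
  have hd' : ∀ x, d' (e x) = y.map (ψ x).inv ≫ y.map (ι x) := fun x =>
    e.piCongrLeft_apply_apply _ _ x
  let g : y.obj S' ⟶ y.obj S := glueDesc (K := y.obj S) R'.G (fun x => (P' x).toShell)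
    (fun a => (Sum.inl (JKGraph.Hom.a θ.inv a) : R.G.A ⊕ _))
    (fun a => congrArg Sum.inl (JKGraph.Hom.a_i θ.inv a))
    d'
    (by
      intro x' k
      obtain ⟨x, rfl⟩ := e.surjective x'
      obtain ⟨k, rfl⟩ := (flMap θ.hom x).surjective k
      rw [hd']
      change JKGraph.Hom.a (ι x) (JKGraph.Hom.a (ψ x).inv
        ((P' (e x)).port (flMap θ.hom x k)).1) = _
      have h3 : JKGraph.Hom.a (ψ x).inv ((P' (e x)).port (flMap θ.hom x k)).1 =
          ((P x).port k).1 := by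
        refine (congrArg (JKGraph.Hom.a (ψ x).inv) (h1 x k).symm).trans ?_
        exact congrArg (fun t => JKGraph.Hom.a t ((P x).port k).1) (ψ x).hom_inv_id
      rw [h3]
      refine (glueι_port R.G (fun x => (P x).toShell) x k).trans ?_
      congr 1
      rw [flMap_val, ← JKGraph.Hom.a_s, ← JKGraph.Hom.a_i, hinv])
  have hf : ∀ x, y.map (ι x) ≫ f = y.map (ψ x).hom ≫ y.map (ι' (e x)) := fun x =>
    glueι_desc R.G (fun x => (P x).toShell) _ _ _ _ x
  have hg : ∀ x, y.map (ι' (e x)) ≫ g = y.map (ψ x).inv ≫ y.map (ι x) := fun x =>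
    (glueι_desc R'.G (fun x => (P' x).toShell) _ _ _ _ (e x)).trans (hd' x)
  refine rel_of f g ?_ ?_ ?_ ?_
  · refine glue_ext R.G (fun x => (P x).toShell) (fun b => congrArg Sum.inl (hinv b)) fun x => ?_
    refine Eq.trans (b := y.map (ι x)) ?_ (Category.comp_id _).symm
    refine chase (hf x) (chase2 (hg x) ?_)
    exact y_cancel (ψ x) (y.map (ι x))
  · refine glue_ext R'.G (fun x => (P' x).toShell) (fun b => congrArg Sum.inl (hinv' b))
      fun x' => ?_
    obtain ⟨x, rfl⟩ := e.surjective x'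
    refine Eq.trans (b := y.map (ι' (e x))) ?_ (Category.comp_id _).symm
    refine chase (hg x) (chase2 (hf x) ?_)
    exact y_cancel (ψ x).symm (y.map (ι' (e x)))
  · intro k
    exact congrArg Sum.inl (hport k)
  · refine glue_ext R.G (fun x => (P x).toShell) hc fun x => ?_
    refine chase (hf x) (chase2 (glueι_desc R'.G (fun x => (P' x).toShell) _ _ _ _ (e x)) ?_)
    refine Eq.trans (h2 x) ?_
    exact (substPiece_ι R c c_i P hP x).symm

end Sub

section Mu

variable {F F' : Species} {n m : Type} [Finite n] [Finite m]

theorem rep_col {X : JKGraph} (d : y.obj X ⟶ bar F) (x : X.V) (P : Piece F (X.Fl x))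
    (h : cls P = at' d x) (k : X.Fl x) :
    Species.Hom.c P.dec (P.port k).1 = Species.Hom.c d (X.i (X.s k.1)) := by
  rw [← bar_col, h]
  exact col_at d x k

/-- Substitution into a graph decorated by isomorphism classes of decorated graphs, with respect
to representatives `P` of the classes. -/
def muOf (Q : Piece (bar F) n) (P : ∀ x : Q.G.V, Piece F (Q.G.Fl x))
    (hP : ∀ x, cls (P x) = at' Q.dec x) : Piece F n :=
  substPiece Q.toShell (Species.Hom.c Q.dec) (Species.Hom.c_inv Q.dec) P
    (fun x => rep_col Q.dec x (P x) (hP x))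

theorem muOf_rel {Q Q' : Piece (bar F) n} (h : Rel Q Q') {P : ∀ x : Q.G.V, Piece F (Q.G.Fl x)}
    {hP : ∀ x, cls (P x) = at' Q.dec x} {P' : ∀ x : Q'.G.V, Piece F (Q'.G.Fl x)}
    {hP' : ∀ x, cls (P' x) = at' Q'.dec x} : Rel (muOf Q P hP) (muOf Q' P' hP') := by
  obtain ⟨θ, h1, h2⟩ := h
  refine substPiece_rel θ h1 (fun a => congrArg (fun t : y.obj Q.G ⟶ bar F => Species.Hom.c t a) h2) fun x => ?_
  rw [← cls_eq, hP, ← bar_act, hP', ← h2, at_map]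

/-- Chosen representatives. -/
def rep {X : JKGraph} (d : y.obj X ⟶ bar F) (x : X.V) : Piece F (X.Fl x) :=
  Quotient.out (s := setoid F (X.Fl x)) (at' d x)

theorem rep_spec {X : JKGraph} (d : y.obj X ⟶ bar F) (x : X.V) : cls (rep d x) = at' d x :=
  Quotient.out_eq (s := setoid F (X.Fl x)) (at' d x)

/-- The multiplication of the monad: a graph whose vertices are decorated by `F`-graphs is turned
into a single `F`-graph by substitution. -/
def muApp (F : Species) : bar (bar F) ⟶ bar F where
  c := id
  o := Quotient.lift (fun Q => cls (muOf Q (rep Q.dec) (rep_spec Q.dec)))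
    fun _ _ h => cls_eq.2 (muOf_rel h)
  c_inv := fun _ => rfl
  o_act := by
    rintro n m _ _ σ ⟨Q⟩
    rfl
  col_o := by
    rintro n _ ⟨Q⟩ k
    rfl

theorem muApp_cls (Q : Piece (bar F) n) (P : ∀ x : Q.G.V, Piece F (Q.G.Fl x))
    (hP : ∀ x, cls (P x) = at' Q.dec x) :
    Species.Hom.o (muApp F) (cls Q) = cls (muOf Q P hP) :=
  cls_eq.2 (muOf_rel (rel_refl Q))

theorem mu_nat (f : F ⟶ F') : barMap (barMap f) ≫ muApp F' = muApp F ≫ barMap f := by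
  refine Species.hom_ext (fun _ => rfl) ?_
  rintro n _ ⟨Q⟩
  refine (muApp_cls (Piece.map (barMap f) Q) (fun x => Piece.map f (rep Q.dec x)) ?_).trans ?_
  · intro x
    exact congrArg (Species.Hom.o (barMap f)) (rep_spec Q.dec x)
  · refine cls_eq.2 ⟨Iso.refl _, fun _ => rfl, ?_⟩
    refine Eq.trans ?_ (Category.id_comp _)
    refine congrArg₂ (· ≫ ·) (y.map_id _) ?_
    refine glue_ext Q.G (fun x => (rep Q.dec x).toShell) (fun _ => rfl) fun x => ?_
    refine Eq.trans ?_ (glueι_desc Q.G (fun x => (rep Q.dec x).toShell) _ _ _ _ x).symm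
    exact chase (glueι_desc Q.G (fun x => (rep Q.dec x).toShell) _ _ _ _ x) rfl

theorem star_ext {X : JKGraph} {d d' : y.obj X ⟶ F}
    (hc : ∀ a, Species.Hom.c d a = Species.Hom.c d' a)
    (ho : ∀ x, y.map (X.star x) ≫ d = y.map (X.star x) ≫ d') : d = d' :=
  dec_ext hc fun x => congrArg
    (fun t : y.obj (corolla (X.Fl x)) ⟶ F => Species.Hom.o t ⟨𝟙 (corolla (X.Fl x))⟩) (ho x)

theorem star_dec {X : JKGraph} (d : y.obj X ⟶ F) (x : X.V) :
    y.map (X.star x) ≫ d = corDec (at' d x) :=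
  cor_dec_ext (corDec_id (at' d x)).symm

theorem mu_left_unit (F : Species) : etaApp (bar F) ≫ muApp F = 𝟙 (bar F) := by
  refine Species.hom_ext (fun _ => rfl) ?_
  rintro n _ ⟨P⟩
  let Q : Piece (bar F) n := ⟨corShell n, corDec (cls P)⟩
  let P' : ∀ x : Q.G.V, Piece F (Q.G.Fl x) := fun _ => relabel (corFl n).symm P
  have hP' : ∀ x, cls (P' x) = at' Q.dec x := fun _ => (corDec_at (F := bar F) (cls P)).symm
  refine (muApp_cls Q P' hP').trans (cls_eq.2 ?_)
  let sh := fun x => (P' x).toShell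
  let f : y.obj (glue Q.G sh) ⟶ y.obj P.G := glueDesc (K := y.obj P.G) Q.G sh
    (Sum.elim (fun k => (P.port k).1) (fun k => P.G.i (P.port k).1))
    (by
      rintro (k | k)
      · rfl
      · exact (P.G.i_i _).symm)
    (fun _ => 𝟙 _) (fun _ _ => rfl)
  let g : y.obj P.G ⟶ y.obj (glue Q.G sh) := y.map (glueι Q.G sh ())
  have hf : g ≫ f = 𝟙 _ := glueι_desc Q.G sh _ _ _ _ ()
  refine rel_of f g ?_ hf ?_ ?_
  · refine glue_ext Q.G sh ?_ ?_
    · rintro (k | k)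
      · exact glueArc_port sh () ((corFl n) k)
      · exact glueArc_iport sh () ((corFl n) k)
    · rintro ⟨⟩
      refine Eq.trans (b := g) ?_ (Category.comp_id _).symm
      exact chase hf (Category.id_comp _)
  · intro k
    rfl
  · refine glue_ext Q.G sh ?_ ?_
    · rintro (k | k)
      · rfl
      · exact Species.Hom.c_inv P.dec (P.port k).1
    · rintro ⟨⟩
      refine Eq.trans ?_ (glueι_desc Q.G sh _ _ _ _ ()).symm
      exact chase hf (Category.id_comp _)

theorem mu_right_unit (F : Species) : barMap (etaApp F) ≫ muApp F = 𝟙 (bar F) := by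
  refine Species.hom_ext (fun _ => rfl) ?_
  rintro n _ ⟨P⟩
  let Q : Piece (bar F) n := Piece.map (etaApp F) P
  let P' : ∀ x : P.G.V, Piece F (P.G.Fl x) := fun x =>
    ⟨corShell (P.G.Fl x), corDec (at' P.dec x)⟩
  refine (muApp_cls Q P' (fun _ => rfl)).trans (cls_eq.2 ?_)
  let sh := fun x => (P' x).toShell
  let f : y.obj (glue P.G sh) ⟶ y.obj P.G := glueDesc (K := y.obj P.G) P.G sh
    id (fun _ => rfl) (fun x => y.map (P.G.star x)) (fun _ _ => rfl)
  let g : P.G ⟶ glue P.G sh :=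
    { a := Sum.inl
      h := fun h => ⟨P.G.p h, (⟨h, rfl⟩ : P.G.Fl (P.G.p h))⟩
      v := fun v => ⟨v, ()⟩
      a_i := fun _ => rfl
      a_s := fun h => (glueArc_iport sh (P.G.p h) ⟨h, rfl⟩).symm
      v_p := fun _ => rfl
      pull := by
        rintro w ⟨x, k, rfl⟩ e
        obtain ⟨rfl, -⟩ := Sigma.mk.inj e
        refine ⟨k, ⟨rfl, rfl⟩, ?_⟩
        rintro k' ⟨-, e2⟩
        exact congrArg (fun t : Σ x, P.G.Fl x => t.2.1) e2 }
  have hs : ∀ x, P.G.star x ≫ g = glueι P.G sh x := fun x =>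
    cor_ext (by rintro ⟨k, rfl⟩; rfl) rfl
  have hf : ∀ x, y.map (glueι P.G sh x) ≫ f = y.map (P.G.star x) :=
    fun x => glueι_desc P.G sh _ _ _ _ x
  refine rel_of f (y.map g) ?_ ?_ ?_ ?_
  · refine glue_ext P.G sh (fun _ => rfl) fun x => ?_
    refine Eq.trans (b := y.map (glueι P.G sh x)) ?_ (Category.comp_id _).symm
    refine chase (hf x) ?_
    rw [← hs x]
    exact (y.map_comp _ _).symm
  · refine star_ext (fun _ => rfl) fun x => ?_
    refine Eq.trans (b := y.map (P.G.star x)) ?_ (Category.comp_id _).symm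
    refine chase (j := y.map (glueι P.G sh x)) ?_ (hf x)
    rw [← hs x]
    exact (y.map_comp _ _).symm
  · intro k
    rfl
  · refine glue_ext P.G sh (fun _ => rfl) fun x => ?_
    refine Eq.trans ?_ (glueι_desc P.G sh _ _ _ _ x).symm
    exact chase (hf x) (star_dec P.dec x)

theorem mu_assoc (F : Species) : barMap (muApp F) ≫ muApp F = muApp (bar F) ≫ muApp F := by
  refine Species.hom_ext (fun _ => rfl) ?_
  rintro n _ ⟨Q⟩
  let B : ∀ v : Q.G.V, Piece (bar F) (Q.G.Fl v) := rep Q.dec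
  let C : ∀ v (w : (B v).G.V), Piece F ((B v).G.Fl w) := fun v => rep (B v).dec
  let D : ∀ v : Q.G.V, Piece F (Q.G.Fl v) := fun v => muOf (B v) (C v) (rep_spec (B v).dec)
  have hD : ∀ v, cls (D v) = at' (Q.dec ≫ muApp F) v := fun v =>
    congrArg (Species.Hom.o (muApp F)) (rep_spec Q.dec v)
  let N : Piece (bar F) n := muOf Q B (rep_spec Q.dec)
  let shB := fun v => (B v).toShell
  let C' : ∀ k : N.G.V, Piece F (N.G.Fl k) := fun k =>
    relabel (flMap (glueι Q.G shB k.1) k.2).symm (C k.1 k.2)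
  have hC' : ∀ k, cls (C' k) = at' N.dec k := by
    rintro ⟨v, w⟩
    refine Eq.trans ?_ (substPiece_at (F := bar F) Q.toShell (Species.Hom.c Q.dec) (Species.Hom.c_inv Q.dec) B
      (fun x => rep_col Q.dec x (B x) (rep_spec Q.dec x)) v w).symm
    exact congrArg ((bar F).act (flMap (glueι Q.G shB v) w).symm) (rep_spec (B v).dec w)
  refine (muApp_cls (Piece.map (muApp F) Q) D hD).trans
    (Eq.trans (cls_eq.2 ?_) (muApp_cls N C' hC').symm)
  let shC := fun v w => (C v w).toShell
  let shD := fun v => (D v).toShell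
  let shC' := fun k => (C' k).toShell
  let L := glue Q.G shD
  let M := glue N.G shC'
  let ιC : ∀ v w, (C v w).G ⟶ (D v).G := fun v => glueι (B v).G (shC v)
  let ιD : ∀ v, (D v).G ⟶ L := glueι Q.G shD
  let ιB : ∀ v, (B v).G ⟶ N.G := glueι Q.G shB
  let ιM : ∀ v w, (C v w).G ⟶ M := fun v w => glueι N.G shC' ⟨v, w⟩
  let fv : ∀ v, y.obj (D v).G ⟶ y.obj M := fun v =>
    glueDesc (K := y.obj M) (B v).G (shC v)
      (fun a => (Sum.inl (JKGraph.Hom.a (ιB v) a) : N.G.A ⊕ _))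
      (fun a => congrArg Sum.inl (JKGraph.Hom.a_i (ιB v) a))
      (fun w => y.map (ιM v w))
      (by
        intro w k
        have := glueι_port N.G shC' ⟨v, w⟩ (flMap (ιB v) w k)
        have e2 : ((shC' ⟨v, w⟩).port (flMap (ιB v) w k)) = (C v w).port k :=
          congrArg (C v w).port ((flMap (ιB v) w).symm_apply_apply k)
        rw [e2] at this
        refine this.trans (congrArg Sum.inl ?_)
        rw [flMap_val, ← JKGraph.Hom.a_s, ← JKGraph.Hom.a_i])
  let f : y.obj L ⟶ y.obj M := glueDesc (K := y.obj M) Q.G shD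
    (fun a => (Sum.inl (Sum.inl a : Q.G.A ⊕ _) : N.G.A ⊕ _))
    (fun a => rfl) fv
    (by
      intro v k
      exact congrArg Sum.inl (glueArc_port shB v k))
  let gA : N.G.A → L.A := Sum.elim (fun a => Sum.inl a)
    (fun t => JKGraph.Hom.a (ιD t.1) (Sum.inl t.2.1 : (B t.1).G.A ⊕ _))
  have gA_ι : ∀ v a, gA (JKGraph.Hom.a (ιB v) a) =
      JKGraph.Hom.a (ιD v) (Sum.inl a : (B v).G.A ⊕ _) := by
    intro v a
    rcases (B v).arc_cases a with h | ⟨k, rfl⟩ | ⟨k, rfl⟩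
    · exact congrArg gA (glueArc_inner shB v ⟨a, h⟩)
    · refine (congrArg gA (glueArc_port shB v k)).trans ?_
      exact (glueι_port Q.G shD v k).symm
    · refine (congrArg gA (glueArc_iport shB v k)).trans ?_
      exact (glueArc_iport shD v k).symm
  let g : y.obj M ⟶ y.obj L := glueDesc (K := y.obj L) N.G shC' gA
    (by
      rintro (a | ⟨v, a⟩)
      · rfl
      · exact JKGraph.Hom.a_i (ιD v) (Sum.inl a.1 : (B v).G.A ⊕ _))
    (fun k => y.map (ιC k.1 k.2) ≫ y.map (ιD k.1))
    (by
      rintro ⟨v, w⟩ k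
      obtain ⟨k, rfl⟩ := (flMap (ιB v) w).surjective k
      have e2 : ((shC' ⟨v, w⟩).port (flMap (ιB v) w k)) = (C v w).port k :=
        congrArg (C v w).port ((flMap (ιB v) w).symm_apply_apply k)
      rw [e2]
      have e3 : N.G.i (N.G.s (flMap (ιB v) w k).1) =
          JKGraph.Hom.a (ιB v) ((B v).G.i ((B v).G.s k.1)) := by
        rw [flMap_val, ← JKGraph.Hom.a_s, ← JKGraph.Hom.a_i]
      refine Eq.trans ?_ (congrArg gA e3).symm
      refine Eq.trans ?_ (gA_ι v _).symm
      exact congrArg (JKGraph.Hom.a (ιD v)) (glueι_port (B v).G (shC v) w k))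
  have hfv : ∀ v w, y.map (ιC v w) ≫ fv v = y.map (ιM v w) := fun v w =>
    glueι_desc (B v).G (shC v) _ _ _ _ w
  have hf : ∀ v, y.map (ιD v) ≫ f = fv v := fun v => glueι_desc Q.G shD _ _ _ _ v
  have hg : ∀ v w, y.map (ιM v w) ≫ g = y.map (ιC v w) ≫ y.map (ιD v) := fun v w =>
    glueι_desc N.G shC' _ _ _ _ (⟨v, w⟩ : Σ v, (B v).G.V)
  have hM : ∀ v w, y.map (ιM v w) ≫ (muOf N C' hC').dec = (C v w).dec := fun v w =>
    substPiece_ι N.toShell _ _ _ _ (⟨v, w⟩ : Σ v, (B v).G.V)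
  have hN : ∀ v, y.map (ιB v) ≫ N.dec = (B v).dec := fun v => substPiece_ι Q.toShell _ _ _ _ v
  have hDC : ∀ v w, y.map (ιC v w) ≫ (D v).dec = (C v w).dec := fun v w =>
    substPiece_ι (B v).toShell _ _ _ _ w
  refine rel_of f g ?_ ?_ (fun _ => rfl) ?_
  · refine glue_ext Q.G shD (fun _ => rfl) fun v => ?_
    refine Eq.trans (b := y.map (ιD v)) ?_ (Category.comp_id _).symm
    refine chase (hf v) ?_
    refine glue_ext (B v).G (shC v) (fun a => gA_ι v a) fun w => ?_
    exact chase (hfv v w) (hg v w)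
  · refine glue_ext N.G shC' ?_ ?_
    · intro b
      obtain ⟨a, rfl⟩ | ⟨v, a, rfl⟩ := glue_arc_cases Q.G shB b
      · rfl
      · refine (congrArg (Species.Hom.c f) (gA_ι v a)).trans ?_
        exact congrArg (fun t : y.obj (D v).G ⟶ y.obj M =>
          Species.Hom.c t (Sum.inl a : (B v).G.A ⊕ _)) (hf v)
    · rintro ⟨v, w⟩
      refine Eq.trans (b := y.map (ιM v w)) ?_ (Category.comp_id _).symm
      exact chase (hg v w) (chase2 (hf v) (hfv v w))
  · refine glue_ext Q.G shD (fun _ => rfl) fun v => ?_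
    refine Eq.trans ?_ (substPiece_ι Q.toShell _ _ D _ v).symm
    refine chase (hf v) ?_
    refine glue_ext (B v).G (shC v) ?_ fun w => ?_
    · intro a
      exact congrArg (fun t : y.obj (B v).G ⟶ bar F => Species.Hom.c t a) (hN v)
    · exact (chase (hfv v w) (hM v w)).trans (hDC v w).symm

end Mu

/-- The monad `F ↦ F̄` on graphical species, whose algebras are the compact coloured props. -/
def ccp : Monad Species where
  obj := bar
  map := barMap
  map_id := barFunctor.map_id
  map_comp := barFunctor.map_comp
  η := { app := etaApp, naturality := fun _ _ f => eta_nat f }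
  μ := { app := muApp, naturality := fun _ _ f => mu_nat f }
  assoc := mu_assoc
  left_unit := mu_left_unit
  right_unit := mu_right_unit

/-! ### The restricted Kleisli category -/

/-- The restricted Kleisli category: the full subcategory of the Kleisli category of the monad
`F ↦ F̄` spanned by the graphs without isolated edges. -/
abbrev KGr : Type 1 :=
  InducedCategory (Kleisli ccp)
    (fun G : {G : JKGraph // G.NoIsolatedEdges} => Kleisli.mk ccp (y.obj G.1))

/-- A Kleisli morphism from the graph `X` to the graph `Y` is a morphism of species from `X` to
`Ȳ`. -/
def KGr.ofMap {X Y : KGr} (d : y.obj X.1 ⟶ bar (y.obj Y.1)) : X ⟶ Y :=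
  InducedCategory.homMk ⟨d⟩

/-- The underlying morphism of species. -/
def KGr.toMap {X Y : KGr} (f : X ⟶ Y) : y.obj X.1 ⟶ bar (y.obj Y.1) := f.hom.of

theorem KGr.ext {X Y : KGr} {f g : X ⟶ Y} (h : KGr.toMap f = KGr.toMap g) : f = g :=
  InducedCategory.hom_ext (Kleisli.hom_ext h)

theorem KGr.toMap_comp {X Y Z : KGr} (f : X ⟶ Y) (g : Y ⟶ Z) :
    KGr.toMap (f ≫ g) = KGr.toMap f ≫ barMap (KGr.toMap g) ≫ muApp (y.obj Z.1) := rfl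

/-- The free morphism given by an etale map. -/
def KGr.free {X Y : KGr} (k : X.1 ⟶ Y.1) : X ⟶ Y :=
  InducedCategory.homMk ((Kleisli.Adjunction.toKleisli ccp).map (y.map k))

theorem KGr.free_id (X : KGr) : KGr.free (𝟙 X.1) = 𝟙 X := by
  refine InducedCategory.hom_ext ?_
  exact (congrArg (Kleisli.Adjunction.toKleisli ccp).map (y.map_id X.1)).trans
    ((Kleisli.Adjunction.toKleisli ccp).map_id _)

theorem KGr.free_comp {X Y Z : KGr} (k : X.1 ⟶ Y.1) (l : Y.1 ⟶ Z.1) :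
    KGr.free (k ≫ l) = (KGr.free k : X ⟶ Y) ≫ (KGr.free l : Y ⟶ Z) := by
  refine InducedCategory.hom_ext ?_
  exact (congrArg (Kleisli.Adjunction.toKleisli ccp).map (y.map_comp k l)).trans
    ((Kleisli.Adjunction.toKleisli ccp).map_comp _ _)

/-! ### Reduced covers -/

section Covers

variable {X Y Z : JKGraph}

/-- An etale map is a cover if it is surjective on edges and vertices. -/
def IsCover (f : X ⟶ Y) : Prop :=
  Function.Surjective (JKGraph.Hom.a f) ∧ Function.Surjective (JKGraph.Hom.v f)

/-- Open subgraph inclusions. -/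
def IsOpenInclusion (f : X ⟶ Y) : Prop :=
  Function.Injective (JKGraph.Hom.a f) ∧ Function.Injective (JKGraph.Hom.h f) ∧
    Function.Injective (JKGraph.Hom.v f)

/-- A cover is reduced when no part of its domain can be omitted: no proper open subgraph of the
domain still covers. (A covering family is regarded as a single etale map out of the sum of its
members.) -/
def IsReducedCover (f : X ⟶ Y) : Prop :=
  IsCover f ∧ ∀ (Z : JKGraph) (j : Z ⟶ X), IsOpenInclusion j → IsCover (j ≫ f) → IsIso j

theorem isIso_of_bijective (f : X ⟶ Y) (ha : Function.Bijective (JKGraph.Hom.a f))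
    (hh : Function.Bijective (JKGraph.Hom.h f)) (hv : Function.Bijective (JKGraph.Hom.v f)) :
    IsIso f := by
  let ea := Equiv.ofBijective _ ha
  let eh := Equiv.ofBijective _ hh
  let ev := Equiv.ofBijective _ hv
  have hp : ∀ t, ev.symm (Y.p t) = X.p (eh.symm t) := fun t => by
    obtain ⟨t, rfl⟩ := eh.surjective t
    rw [eh.symm_apply_apply, ev.symm_apply_eq]
    exact (JKGraph.Hom.v_p f t).symm
  let g : Y ⟶ X :=
    { a := ea.symm
      h := eh.symm
      v := ev.symm
      a_i := fun t => by
        obtain ⟨t, rfl⟩ := ea.surjective t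
        rw [ea.symm_apply_apply, ea.symm_apply_eq]
        exact (JKGraph.Hom.a_i f t).symm
      a_s := fun t => by
        obtain ⟨t, rfl⟩ := eh.surjective t
        rw [eh.symm_apply_apply, ea.symm_apply_eq]
        exact (JKGraph.Hom.a_s f t).symm
      v_p := hp
      pull := fun w z hz => by
        refine ⟨eh z, ⟨?_, eh.symm_apply_apply z⟩, ?_⟩
        · have := hp (eh z)
          rw [eh.symm_apply_apply, hz] at this
          exact ev.symm.injective this
        · rintro t ⟨-, rfl⟩
          exact (eh.apply_symm_apply t).symm }
  refine ⟨g, ?_, ?_⟩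
  · ext t
    · exact ea.symm_apply_apply t
    · exact eh.symm_apply_apply t
    · exact ev.symm_apply_apply t
  · ext t
    · exact ea.apply_symm_apply t
    · exact eh.apply_symm_apply t
    · exact ev.apply_symm_apply t

theorem bijective_of_isIso (f : X ⟶ Y) [IsIso f] : Function.Bijective (JKGraph.Hom.a f) ∧
    Function.Bijective (JKGraph.Hom.h f) ∧ Function.Bijective (JKGraph.Hom.v f) := by
  have h1 := IsIso.hom_inv_id f
  have h2 := IsIso.inv_hom_id f
  refine ⟨Function.bijective_iff_has_inverse.2 ⟨JKGraph.Hom.a (inv f), fun t => ?_, fun t => ?_⟩,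
    Function.bijective_iff_has_inverse.2 ⟨JKGraph.Hom.h (inv f), fun t => ?_, fun t => ?_⟩,
    Function.bijective_iff_has_inverse.2 ⟨JKGraph.Hom.v (inv f), fun t => ?_, fun t => ?_⟩⟩
  · exact congrArg (fun q => JKGraph.Hom.a q t) h1
  · exact congrArg (fun q => JKGraph.Hom.a q t) h2
  · exact congrArg (fun q => JKGraph.Hom.h q t) h1
  · exact congrArg (fun q => JKGraph.Hom.h q t) h2
  · exact congrArg (fun q => JKGraph.Hom.v q t) h1
  · exact congrArg (fun q => JKGraph.Hom.v q t) h2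

theorem h_surjective (f : X ⟶ Y) (hv : Function.Surjective (JKGraph.Hom.v f)) :
    Function.Surjective (JKGraph.Hom.h f) := fun z => by
  obtain ⟨w, hw⟩ := hv (Y.p z)
  obtain ⟨x, ⟨-, hx⟩, -⟩ := JKGraph.Hom.pull f w z hw.symm
  exact ⟨x, hx⟩

theorem h_injective (f : X ⟶ Y) (hv : Function.Injective (JKGraph.Hom.v f)) :
    Function.Injective (JKGraph.Hom.h f) := fun x x' e => by
  have hp : X.p x = X.p x' := hv (by rw [JKGraph.Hom.v_p, JKGraph.Hom.v_p, e])
  obtain ⟨t, -, ht⟩ := JKGraph.Hom.pull f (X.p x') (JKGraph.Hom.h f x')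
    (JKGraph.Hom.v_p f x').symm
  exact (ht x ⟨hp, e⟩).trans (ht x' ⟨rfl, rfl⟩).symm

theorem a_surjective (f : X ⟶ Y) (hY : Y.NoIsolatedEdges)
    (hv : Function.Surjective (JKGraph.Hom.v f)) : Function.Surjective (JKGraph.Hom.a f) := by
  intro z
  rcases hY z with ⟨t, rfl⟩ | ⟨t, ht⟩
  · obtain ⟨x, rfl⟩ := h_surjective f hv t
    exact ⟨X.s x, JKGraph.Hom.a_s f x⟩
  · obtain ⟨x, rfl⟩ := h_surjective f hv t
    exact ⟨X.i (X.s x), by rw [JKGraph.Hom.a_i, JKGraph.Hom.a_s, ht, Y.i_i]⟩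

/-- The open subgraph obtained by removing a vertex (but no edge). -/
@[reducible]
def removeVertex (X : JKGraph) (w : X.V) : JKGraph where
  A := X.A
  H := {h : X.H // X.p h ≠ w}
  V := {v : X.V // v ≠ w}
  finA := inferInstance
  finH := inferInstance
  finV := inferInstance
  i := X.i
  s := fun h => X.s h.1
  p := fun h => ⟨X.p h.1, h.2⟩
  i_i := X.i_i
  i_ne := X.i_ne
  s_inj := fun _ _ e => Subtype.ext (X.s_inj e)

/-- In the absence of isolated edges, a reduced cover is an etale map bijective on vertices. -/
theorem isReducedCover_iff (f : X ⟶ Y) (hX : X.NoIsolatedEdges) (hY : Y.NoIsolatedEdges) :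
    IsReducedCover f ↔ Function.Bijective (JKGraph.Hom.v f) := by
  constructor
  · rintro ⟨hf, hmin⟩
    refine ⟨fun w w' e => ?_, hf.2⟩
    by_contra hne
    let j : removeVertex X w ⟶ X :=
      { a := id
        h := Subtype.val
        v := Subtype.val
        a_i := fun _ => rfl
        a_s := fun _ => rfl
        v_p := fun _ => rfl
        pull := fun u z hz => ⟨⟨z, by rw [hz]; exact u.2⟩, ⟨Subtype.ext hz, rfl⟩,
          fun z' hz' => Subtype.ext hz'.2⟩ }
    have hj : IsIso j := by
      refine hmin _ j ⟨Function.injective_id, Subtype.val_injective, Subtype.val_injective⟩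
        ⟨hf.1, fun b => ?_⟩
      obtain ⟨u, rfl⟩ := hf.2 b
      by_cases hu : u = w
      · exact ⟨⟨w', Ne.symm hne⟩, by rw [hu, e]; rfl⟩
      · exact ⟨⟨u, hu⟩, rfl⟩
    obtain ⟨u, hu⟩ := (bijective_of_isIso j).2.2.2 w
    exact u.2 hu
  · intro hv
    refine ⟨⟨a_surjective f hY hv.2, hv.2⟩, fun Z j hj hc => ?_⟩
    have hjv : Function.Surjective (JKGraph.Hom.v j) := fun x => by
      obtain ⟨z, hz⟩ := hc.2 (JKGraph.Hom.v f x)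
      exact ⟨z, hv.1 hz⟩
    exact isIso_of_bijective j ⟨hj.1, a_surjective j hX hjv⟩ ⟨hj.2.1, h_surjective j hjv⟩
      ⟨hj.2.2, hjv⟩

end Covers

/-- Reduced covers in the restricted Kleisli category: the free morphisms on reduced covers. -/
def KGr.reducedCovers : MorphismProperty KGr := fun X Y f =>
  ∃ k : X.1 ⟶ Y.1, IsReducedCover k ∧ f = KGr.free k

instance : KGr.reducedCovers.IsMultiplicative where
  id_mem X := ⟨𝟙 X.1, (isReducedCover_iff _ X.2 X.2).2 Function.bijective_id, (KGr.free_id X).symm⟩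
  comp_mem {X Y Z} f g := by
    rintro ⟨k, hk, rfl⟩ ⟨l, hl, rfl⟩
    exact ⟨k ≫ l, (isReducedCover_iff _ X.2 Z.2).2
      (((isReducedCover_iff _ Y.2 Z.2).1 hl).comp ((isReducedCover_iff _ X.2 Y.2).1 hk)),
      (KGr.free_comp k l).symm⟩

/-! ### Generic morphisms -/

section Generic

variable {X Y Z : JKGraph} {F : Species}

/-- The colimit in `Gr ↓ F` of the diagram given by `d : X ⟶ F̄` (which sends each arc to a colour
of `F`, and each vertex to a decorated effective graph): the underlying graph. -/
def colimGraph (d : y.obj X ⟶ bar F) : JKGraph := glue X (fun x => (rep d x).toShell)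

/-- The structure map of the colimit. -/
def colimDec (d : y.obj X ⟶ bar F) : y.obj (colimGraph d) ⟶ F :=
  glueDesc X (fun x => (rep d x).toShell) (Species.Hom.c d) (Species.Hom.c_inv d)
    (fun x => (rep d x).dec) (fun x => rep_col d x (rep d x) (rep_spec d x))

/-- A Kleisli morphism from `X` to `Y` is generic if the etale map to `Y` from the colimit graph is
invertible. -/
def IsGenericMap (d : y.obj X ⟶ bar (y.obj Y)) : Prop := IsIso (yPre (colimDec d))

/-- The etale map determined by representatives `P`. -/
def colimMapOf (d : y.obj X ⟶ bar (y.obj Y)) (P : ∀ x, Piece (y.obj Y) (X.Fl x))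
    (hP : ∀ x, cls (P x) = at' d x) : glue X (fun x => (P x).toShell) ⟶ Y :=
  yPre (glueDesc X (fun x => (P x).toShell) (Species.Hom.c d) (Species.Hom.c_inv d)
    (fun x => (P x).dec) (fun x => rep_col d x (P x) (hP x)))

theorem isIso_of_empty (f : X ⟶ Y) [IsEmpty X.V] [IsEmpty Y.V] (hX : X.NoIsolatedEdges)
    (hY : Y.NoIsolatedEdges) : IsIso f := by
  have key : ∀ G : JKGraph, IsEmpty G.V → G.NoIsolatedEdges → IsEmpty G.A ∧ IsEmpty G.H := by
    intro G h hG
    have hH : IsEmpty G.H := ⟨fun t => h.false (G.p t)⟩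
    exact ⟨⟨fun a => (hG a).elim (fun ⟨t, _⟩ => hH.false t) (fun ⟨t, _⟩ => hH.false t)⟩, hH⟩
  obtain ⟨h1, h2⟩ := key X ‹_› hX
  obtain ⟨h3, h4⟩ := key Y ‹_› hY
  exact isIso_of_bijective f ⟨fun a => isEmptyElim a, fun a => isEmptyElim a⟩
    ⟨fun a => isEmptyElim a, fun a => isEmptyElim a⟩
    ⟨fun a => isEmptyElim a, fun a => isEmptyElim a⟩

theorem isGenericMap_of_empty (d : y.obj X ⟶ bar (y.obj Y)) [IsEmpty X.V] [IsEmpty Y.V]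
    (hX : X.NoIsolatedEdges) (hY : Y.NoIsolatedEdges) : IsGenericMap d := by
  have : IsEmpty (colimGraph d).V := ⟨fun t : Σ x, (rep d x).G.V => isEmptyElim t.1⟩
  exact isIso_of_empty _ (glue_noIsolatedEdges X (fun x => (rep d x).toShell) hX) hY

theorem empty_of_isGenericMap (d : y.obj X ⟶ bar (y.obj Y)) [IsEmpty X.V]
    (h : IsGenericMap d) : IsEmpty Y.V := by
  have : IsIso (yPre (colimDec d)) := h
  constructor
  intro v
  obtain ⟨t, -⟩ := (bijective_of_isIso (yPre (colimDec d))).2.2.2 v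
  exact isEmptyElim ((show Σ x, (rep d x).G.V from t).1)

/-- A graph with a decoration, regarded as a decorated graph with its own ports. -/
def selfPiece (hX : X.Effective) {n : Type} [Finite n] (e : n ≃ X.Port) (d : y.obj X ⟶ F) :
    Piece F n := ⟨⟨X, hX, e⟩, d⟩

instance (X : JKGraph) : Finite X.Port := inferInstanceAs (Finite {a : X.A // a ∉ Set.range X.s})

theorem isIso_yPre_iff {f : y.obj X ⟶ y.obj Y} : IsIso (yPre f) ↔ IsIso f := by
  constructor
  · intro h
    rw [← y_yPre f]
    infer_instance
  · intro h
    have : IsIso (y.map (yPre f)) := by rwa [y_yPre]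
    have : y.Full := yFF.full
    have : y.Faithful := yFF.faithful
    exact isIso_of_reflects_iso (yPre f) y

theorem isIso_dec_of_rel {n : Type} [Finite n] {P Q : Piece (y.obj Y) n} (h : Rel P Q)
    (hQ : IsIso Q.dec) : IsIso P.dec := by
  obtain ⟨θ, -, h2⟩ := h
  rw [← h2]
  infer_instance

theorem isGenericMap_of_rep (hX : X.Effective) (d : y.obj X ⟶ bar (y.obj Y))
    (P : ∀ x, Piece (y.obj Y) (X.Fl x)) (hP : ∀ x, cls (P x) = at' d x)
    (h : IsIso (colimMapOf d P hP)) : IsGenericMap d := by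
  have h1 := isIso_yPre_iff.1 h
  have h2 : Rel (muOf (selfPiece hX (Equiv.refl _) d) (rep d) (rep_spec d))
    (muOf (selfPiece hX (Equiv.refl _) d) P hP) := muOf_rel (rel_refl _)
  exact isIso_yPre_iff.2 (isIso_dec_of_rel h2 h1)

theorem isGenericMap_iff (hX : X.Effective) (hY : Y.Effective) (d : y.obj X ⟶ bar (y.obj Y)) :
    IsGenericMap d ↔ ∃ e : X.Port ≃ Y.Port,
      Species.Hom.o (muApp (y.obj Y)) (cls (selfPiece hX (Equiv.refl _) d)) =
        cls (selfPiece hY e (𝟙 (y.obj Y))) := by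
  have h0 := muApp_cls (selfPiece hX (Equiv.refl _) d) (rep d) (rep_spec d)
  constructor
  · intro h
    have : IsIso (yPre (colimDec d)) := h
    let θ := asIso (yPre (colimDec d))
    let M := muOf (selfPiece hX (Equiv.refl _) d) (rep d) (rep_spec d)
    have hport : ∀ a, a ∈ Set.range (colimGraph d).s ↔ JKGraph.Hom.a θ.hom a ∈ Set.range Y.s := by
      intro a
      constructor
      · rintro ⟨t, rfl⟩
        exact ⟨_, (JKGraph.Hom.a_s θ.hom t).symm⟩
      · rintro ⟨t, ht⟩
        have := congrArg (JKGraph.Hom.a θ.inv) ht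
        rw [← JKGraph.comp_a, θ.hom_inv_id, JKGraph.Hom.a_s] at this
        exact ⟨_, this⟩
    let e' : (colimGraph d).Port ≃ Y.Port :=
      (Equiv.ofBijective _ (bijective_of_isIso θ.hom).1).subtypeEquiv fun a => (hport a).not
    refine ⟨M.port.trans e', h0.trans (cls_eq.2 ⟨θ, fun k => rfl, ?_⟩)⟩
    exact (Category.comp_id _).trans (y_yPre (colimDec d))
  · rintro ⟨e, he⟩
    have := cls_eq.1 (h0.symm.trans he)
    have h2 := isIso_dec_of_rel this (inferInstanceAs (IsIso (𝟙 (y.obj Y))))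
    exact isIso_yPre_iff.2 h2

theorem effective_of_isGenericMap (hX : X.Effective) (hY : Y.NoIsolatedEdges)
    (d : y.obj X ⟶ bar (y.obj Y)) (_ : IsGenericMap d) : Y.Effective := by
  obtain ⟨v⟩ := (glue_effective X (fun x => (rep d x).toShell) hX).1
  exact ⟨⟨JKGraph.Hom.v (yPre (colimDec d)) v⟩, hY⟩

theorem isGenericMap_id (hX : X.NoIsolatedEdges) : IsGenericMap (etaApp (y.obj X)) := by
  by_cases hV : Nonempty X.V
  · refine (isGenericMap_iff ⟨hV, hX⟩ ⟨hV, hX⟩ _).2 ⟨Equiv.refl _, ?_⟩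
    have h1 : Species.Hom.o (barMap (etaApp (y.obj X)))
        (cls (selfPiece ⟨hV, hX⟩ (Equiv.refl _) (𝟙 (y.obj X)))) =
        cls (selfPiece ⟨hV, hX⟩ (Equiv.refl _) (etaApp (y.obj X))) := by
      rw [barMap_cls]
      exact congrArg (fun t => cls (selfPiece ⟨hV, hX⟩ (Equiv.refl _) t)) (Category.id_comp _)
    rw [← h1]
    exact congrArg (fun t : bar (y.obj X) ⟶ bar (y.obj X) => Species.Hom.o t
      (cls (selfPiece ⟨hV, hX⟩ (Equiv.refl _) (𝟙 (y.obj X))))) (mu_right_unit (y.obj X))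
  · have : IsEmpty X.V := not_nonempty_iff.1 hV
    exact isGenericMap_of_empty _ hX hX

theorem isGenericMap_comp (hX : X.NoIsolatedEdges) (hY : Y.NoIsolatedEdges)
    (hZ : Z.NoIsolatedEdges) (d : y.obj X ⟶ bar (y.obj Y)) (d' : y.obj Y ⟶ bar (y.obj Z))
    (h : IsGenericMap d) (h' : IsGenericMap d') :
    IsGenericMap (d ≫ barMap d' ≫ muApp (y.obj Z)) := by
  by_cases hV : Nonempty X.V
  · have eX : X.Effective := ⟨hV, hX⟩
    have eY := effective_of_isGenericMap eX hY d h
    have eZ := effective_of_isGenericMap eY hZ d' h'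
    obtain ⟨e, he⟩ := (isGenericMap_iff eX eY d).1 h
    obtain ⟨e', he'⟩ := (isGenericMap_iff eY eZ d').1 h'
    refine (isGenericMap_iff eX eZ _).2 ⟨e.trans e', ?_⟩
    let Q := selfPiece eX (Equiv.refl X.Port) d
    have a1 : cls (selfPiece eX (Equiv.refl _) (d ≫ barMap d' ≫ muApp (y.obj Z))) =
        Species.Hom.o (barMap (muApp (y.obj Z)))
          (Species.Hom.o (barMap (barMap d')) (cls Q)) := by
      rw [barMap_cls, barMap_cls]
      exact congrArg (fun t => cls (selfPiece eX (Equiv.refl _) t)) (Category.assoc _ _ _).symm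
    have a2 : Species.Hom.o (muApp (y.obj Z)) (Species.Hom.o (barMap (muApp (y.obj Z)))
        (Species.Hom.o (barMap (barMap d')) (cls Q))) =
        Species.Hom.o (muApp (y.obj Z)) (Species.Hom.o (muApp (bar (y.obj Z)))
          (Species.Hom.o (barMap (barMap d')) (cls Q))) :=
      congrArg (fun t : bar (bar (bar (y.obj Z))) ⟶ bar (y.obj Z) =>
        Species.Hom.o t (Species.Hom.o (barMap (barMap d')) (cls Q))) (mu_assoc (y.obj Z))
    have a3 : Species.Hom.o (muApp (bar (y.obj Z))) (Species.Hom.o (barMap (barMap d')) (cls Q)) =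
        Species.Hom.o (barMap d') (Species.Hom.o (muApp (y.obj Y)) (cls Q)) :=
      congrArg (fun t : bar (bar (y.obj Y)) ⟶ bar (bar (y.obj Z)) => Species.Hom.o t (cls Q))
        (mu_nat d')
    have a4 : Species.Hom.o (barMap d') (cls (selfPiece eY e (𝟙 (y.obj Y)))) =
        (bar (bar (y.obj Z))).act e (cls (selfPiece eY (Equiv.refl _) d')) := by
      rw [barMap_cls]
      exact congrArg (fun t => cls (selfPiece eY e t)) (Category.id_comp _)
    rw [a1, a2, a3, he, a4]
    exact (Species.Hom.o_act (muApp (y.obj Z)) e _).trans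
      (congrArg ((bar (y.obj Z)).act e) he')
  · have : IsEmpty X.V := not_nonempty_iff.1 hV
    have := empty_of_isGenericMap d h
    have := empty_of_isGenericMap d' h'
    exact isGenericMap_of_empty _ hX hZ

end Generic

/-- Generic morphisms in the restricted Kleisli category. -/
def KGr.generics : MorphismProperty KGr := fun _ _ f => IsGenericMap (KGr.toMap f)

instance : KGr.generics.IsMultiplicative where
  id_mem X := isGenericMap_id X.2
  comp_mem {X Y Z} f g hf hg := isGenericMap_comp X.2 Y.2 Z.2 (KGr.toMap f) (KGr.toMap g) hf hg

end JK

/-! ### The Borisov-Manin category -/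

namespace BM

open JK JK.Piece

/-- A (finite) graph in the sense of Borisov and Manin: vertices, flags, the map `bd` assigning to
a flag the vertex it originates from, and an involution `j` on flags whose orbits of length two are
the edges and whose fixpoints are the tails. -/
structure BMGraph where
  V : Type
  F : Type
  finV : Finite V
  finF : Finite F
  bd : F → V
  j : F → F
  j_j : ∀ f, j (j f) = f

namespace BMGraph

attribute [instance] finV finF

/-- The tails of a graph. -/
def tails (τ : BMGraph) : Set τ.F := {f | τ.j f = f}

/-- Morphisms of graphs: a triple `(hF, hV, jc)`. A fixpoint-free involution on the complement of
the image of `hF` is the same thing as an involution `jc` on all flags whose fixpoints are precisely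
the flags in the image of `hF`; this is how it is encoded. -/
@[ext]
structure Hom (τ σ : BMGraph) where
  hF : σ.F → τ.F
  hV : τ.V → σ.V
  jc : τ.F → τ.F
  jc_jc : ∀ f, jc (jc f) = f
  jc_fix : ∀ f, jc f = f ↔ f ∈ Set.range hF
  /-- (i) `hF` is injective, `hV` is surjective -/
  inj : Function.Injective hF
  surj : Function.Surjective hV
  /-- (ii) the image of `hF` and its complement are `j`-invariant -/
  j_range : ∀ f, τ.j f ∈ Set.range hF ↔ f ∈ Set.range hF
  /-- (ii') `jc` agrees with `j` on (contracted) edges -/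
  jc_edge : ∀ f, f ∉ Set.range hF → τ.j f ≠ f → jc f = τ.j f
  /-- (iii) incidences of non-contracted flags are preserved, and the two vertices of a contracted
  edge (actual or virtual) have the same image -/
  bd_hF : ∀ f, hV (τ.bd (hF f)) = σ.bd f
  bd_jc : ∀ f, f ∉ Set.range hF → hV (τ.bd (jc f)) = hV (τ.bd f)
  /-- (iv) the inverse of `hF` maps edges of `τ` to edges of `σ` -/
  edge : ∀ f, τ.j (hF f) ≠ hF f → hF (σ.j f) = τ.j (hF f)

namespace Hom

variable {τ σ ρ : BMGraph}

theorem jc_hF (h : Hom τ σ) (f : σ.F) : h.jc (h.hF f) = h.hF f := (h.jc_fix _).2 ⟨f, rfl⟩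

theorem jc_range (h : Hom τ σ) (f : τ.F) : h.jc f ∈ Set.range h.hF ↔ f ∈ Set.range h.hF := by
  rw [← h.jc_fix, ← h.jc_fix, h.jc_jc, eq_comm]

theorem bd_jc' (h : Hom τ σ) (f : τ.F) : h.hV (τ.bd (h.jc f)) = h.hV (τ.bd f) := by
  by_cases hf : f ∈ Set.range h.hF
  · rw [(h.jc_fix f).2 hf]
  · exact h.bd_jc f hf

open Classical in
/-- The involution of a composite: `j_g` on the complement of the image of `g`, and `j_c` on the
complement of the image of `c` (transported along `g`). -/
def compJc (g : Hom τ σ) (c : Hom σ ρ) (f : τ.F) : τ.F :=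
  if hf : ∃ r, g.hF r = f then g.hF (c.jc hf.choose) else g.jc f

theorem compJc_hF (g : Hom τ σ) (c : Hom σ ρ) (f : σ.F) :
    compJc g c (g.hF f) = g.hF (c.jc f) := by
  have hf : ∃ r, g.hF r = g.hF f := ⟨f, rfl⟩
  rw [compJc, dif_pos hf, g.inj hf.choose_spec]

theorem compJc_not (g : Hom τ σ) (c : Hom σ ρ) (f : τ.F) (hf : f ∉ Set.range g.hF) :
    compJc g c f = g.jc f := by
  exact dif_neg hf

/-- Composition. -/
def comp (g : Hom τ σ) (c : Hom σ ρ) : Hom τ ρ where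
  hF := g.hF ∘ c.hF
  hV := c.hV ∘ g.hV
  jc := compJc g c
  jc_jc f := by
    by_cases hf : f ∈ Set.range g.hF
    · obtain ⟨r, rfl⟩ := hf
      rw [compJc_hF, compJc_hF, c.jc_jc]
    · rw [compJc_not g c f hf, compJc_not _ _ _ ((g.jc_range f).not.2 hf), g.jc_jc]
  jc_fix f := by
    by_cases hf : f ∈ Set.range g.hF
    · obtain ⟨r, rfl⟩ := hf
      rw [compJc_hF, g.inj.eq_iff, c.jc_fix]
      constructor
      · rintro ⟨t, rfl⟩
        exact ⟨t, rfl⟩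
      · rintro ⟨t, ht⟩
        exact ⟨t, g.inj ht⟩
    · rw [compJc_not g c f hf, g.jc_fix]
      refine ⟨fun h => absurd h hf, ?_⟩
      rintro ⟨t, rfl⟩
      exact ⟨_, rfl⟩
  inj := g.inj.comp c.inj
  surj := c.surj.comp g.surj
  j_range f := by
    have key : ∀ f, f ∈ Set.range (g.hF ∘ c.hF) → τ.j f ∈ Set.range (g.hF ∘ c.hF) := by
      rintro _ ⟨t, rfl⟩
      by_cases hj : τ.j (g.hF (c.hF t)) = g.hF (c.hF t)
      · exact ⟨t, hj.symm⟩
      · have h1 := g.edge _ hj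
        obtain ⟨u, hu⟩ := (c.j_range _).2 ⟨t, rfl⟩
        exact ⟨u, by simp only [Function.comp]; rw [hu, h1]⟩
    exact ⟨fun h => by simpa [τ.j_j] using key _ h, key f⟩
  jc_edge f hf hj := by
    by_cases hg : f ∈ Set.range g.hF
    · obtain ⟨r, rfl⟩ := hg
      have h1 := g.edge r hj
      have hr : r ∉ Set.range c.hF := by
        rintro ⟨t, rfl⟩
        exact hf ⟨t, rfl⟩
      have hjr : σ.j r ≠ r := fun e => hj (by rw [← h1, e])
      rw [compJc_hF, c.jc_edge r hr hjr, h1]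
    · rw [compJc_not g c f hg, g.jc_edge f hg hj]
  bd_hF f := by simp [g.bd_hF, c.bd_hF]
  bd_jc f _ := by
    by_cases hg : f ∈ Set.range g.hF
    · obtain ⟨r, rfl⟩ := hg
      simp only [Function.comp]
      rw [compJc_hF, g.bd_hF, g.bd_hF, c.bd_jc']
    · simp only [Function.comp]
      rw [compJc_not g c f hg, g.bd_jc']
  edge f hj := by
    have h1 := g.edge _ hj
    have h2 : σ.j (c.hF f) ≠ c.hF f := fun e => hj (by
      simp only [Function.comp]
      rw [← h1, e])
    simp only [Function.comp]
    rw [c.edge f h2, h1]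

end Hom

/-- The Borisov-Manin category of graphs. -/
instance : Category BMGraph where
  Hom := Hom
  id τ :=
    { hF := id
      hV := id
      jc := id
      jc_jc := fun _ => rfl
      jc_fix := by simp
      inj := Function.injective_id
      surj := Function.surjective_id
      j_range := by simp
      jc_edge := by simp
      bd_hF := fun _ => rfl
      bd_jc := by simp
      edge := fun _ _ => rfl }
  comp := Hom.comp
  id_comp h := Hom.ext rfl rfl (funext fun f => Hom.compJc_hF _ h f)
  comp_id h := Hom.ext rfl rfl (funext fun f => by
    by_cases hf : f ∈ Set.range h.hF
    · obtain ⟨r, rfl⟩ := hf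
      exact (Hom.compJc_hF h _ r).trans (h.jc_hF r).symm
    · exact Hom.compJc_not h _ f hf)
  assoc f g h := Hom.ext rfl rfl (funext fun t => by
    by_cases ht : t ∈ Set.range f.hF
    · obtain ⟨r, rfl⟩ := ht
      refine Eq.trans ?_ (Hom.compJc_hF f (Hom.comp g h) r).symm
      by_cases hr : r ∈ Set.range g.hF
      · obtain ⟨u, rfl⟩ := hr
        refine (Hom.compJc_hF (Hom.comp f g) h u).trans ?_
        exact congrArg f.hF (Hom.compJc_hF g h u).symm
      · refine (Hom.compJc_not (Hom.comp f g) h _ ?_).trans ?_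
        · rintro ⟨u, hu⟩
          exact hr ⟨u, f.inj hu⟩
        · refine (Hom.compJc_hF f g r).trans ?_
          exact congrArg f.hF (Hom.compJc_not g h r hr).symm
    · refine (Hom.compJc_not (Hom.comp f g) h _ ?_).trans ?_
      · rintro ⟨u, rfl⟩
        exact ht ⟨_, rfl⟩
      · exact (Hom.compJc_not f g t ht).trans (Hom.compJc_not f (Hom.comp g h) t ht).symm)

/-- Graftings: both `hV` and `hF` are bijective. -/
def graftings : MorphismProperty BMGraph := fun _ _ h =>
  Function.Bijective (Hom.hV h) ∧ Function.Bijective (Hom.hF h)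

/-- Compressions: `hF` is bijective on tails. -/
def compressions : MorphismProperty BMGraph := fun τ σ h =>
  Set.BijOn (Hom.hF h) σ.tails τ.tails

instance : graftings.IsMultiplicative where
  id_mem _ := ⟨Function.bijective_id, Function.bijective_id⟩
  comp_mem _ _ hf hg := ⟨hg.1.comp hf.1, hf.2.comp hg.2⟩

instance : compressions.IsMultiplicative where
  id_mem _ := Set.bijOn_id _
  comp_mem _ _ hf hg := hf.comp hg

theorem comp_hF {τ σ ρ : BMGraph} (g : τ ⟶ σ) (c : σ ⟶ ρ) (f : ρ.F) :
    Hom.hF (g ≫ c) f = Hom.hF g (Hom.hF c f) := rfl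

theorem comp_hV {τ σ ρ : BMGraph} (g : τ ⟶ σ) (c : σ ⟶ ρ) (v : τ.V) :
    Hom.hV (g ≫ c) v = Hom.hV c (Hom.hV g v) := rfl

/-! ### The equivalences -/

open Classical in
/-- The graph (with arcs) corresponding to a Borisov-Manin graph: arcs are flags and tails, the
copies of the tails playing the role of ports. -/
@[reducible]
def toJK (τ : BMGraph) : JKGraph where
  A := τ.F ⊕ τ.tails
  H := τ.F
  V := τ.V
  finA := inferInstance
  finH := inferInstance
  finV := inferInstance
  i := Sum.elim (fun f => if hf : τ.j f = f then Sum.inr ⟨f, hf⟩ else Sum.inl (τ.j f))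
    (fun t => Sum.inl t.1)
  s := Sum.inl
  p := τ.bd
  i_i := by
    rintro (f | ⟨t, ht⟩)
    · by_cases hf : τ.j f = f
      · simp [hf]
      · have : τ.j (τ.j f) ≠ τ.j f := by
          rw [τ.j_j]
          exact Ne.symm hf
        simp [hf, τ.j_j, Ne.symm hf]
    · have : τ.j t = t := ht
      simp [this]
  i_ne := by
    rintro (f | ⟨t, ht⟩)
    · by_cases hf : τ.j f = f
      · simp [hf]
      · simp [hf]
    · simp
  s_inj := Sum.inl_injective

theorem toJK_i_tail (τ : BMGraph) (f : τ.F) (hf : f ∈ τ.tails) :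
    τ.toJK.i (Sum.inl f : τ.F ⊕ τ.tails) = Sum.inr ⟨f, hf⟩ := dif_pos hf

theorem toJK_i_edge (τ : BMGraph) (f : τ.F) (hf : τ.j f ≠ f) :
    τ.toJK.i (Sum.inl f : τ.F ⊕ τ.tails) = Sum.inl (τ.j f) := dif_neg hf

theorem toJK_noIsolatedEdges (τ : BMGraph) : τ.toJK.NoIsolatedEdges := by
  rintro (f | t)
  · exact Or.inl ⟨f, rfl⟩
  · exact Or.inr ⟨t.1, rfl⟩

/-- The corresponding object of the restricted Kleisli category. -/
def toKGr (τ : BMGraph) : KGr := ⟨τ.toJK, τ.toJK_noIsolatedEdges⟩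

/-- Two equivariant maps on arcs that agree on (the arcs given by) flags are equal. -/
theorem toJK_arc_ext {τ : BMGraph} {C : Type} {inv : C → C} {u v : τ.toJK.A → C}
    (hu : ∀ a, u (τ.toJK.i a) = inv (u a)) (hv : ∀ a, v (τ.toJK.i a) = inv (v a))
    (h : ∀ f : τ.F, u (Sum.inl f : τ.F ⊕ τ.tails) = v (Sum.inl f : τ.F ⊕ τ.tails)) (a) :
    u a = v a := by
  rcases a with f | t
  · exact h f
  · have h1 := hu (Sum.inl t.1 : τ.F ⊕ τ.tails)
    have h2 := hv (Sum.inl t.1 : τ.F ⊕ τ.tails)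
    rw [toJK_i_tail τ t.1 t.2] at h1 h2
    exact h1.trans ((congrArg inv (h t.1)).trans h2.symm)

section Phi1

variable {τ σ ρ : BMGraph}

/-- The inverse of the bijection on flags of a grafting. -/
def graftEquiv (h : τ ⟶ σ) (hh : graftings h) : τ.F ≃ σ.F := (Equiv.ofBijective _ hh.2).symm

theorem hF_graftEquiv (h : τ ⟶ σ) (hh : graftings h) (f : τ.F) :
    Hom.hF h (graftEquiv h hh f) = f := (Equiv.ofBijective _ hh.2).apply_symm_apply f

theorem graftEquiv_hF (h : τ ⟶ σ) (hh : graftings h) (f : σ.F) :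
    graftEquiv h hh (Hom.hF h f) = f := (Equiv.ofBijective _ hh.2).symm_apply_apply f

/-- The etale map corresponding to a grafting: on half-edges it is the inverse of `hF`, and the
port belonging to a tail goes to the arc opposite to the image of that tail. -/
def graftMap (h : τ ⟶ σ) (hh : graftings h) : τ.toJK ⟶ σ.toJK where
  a := Sum.elim (fun f => Sum.inl (graftEquiv h hh f))
    (fun t => σ.toJK.i (Sum.inl (graftEquiv h hh t.1) : σ.F ⊕ σ.tails))
  h := graftEquiv h hh
  v := Hom.hV h
  a_i := by
    rintro (f | t)
    · by_cases hf : τ.j f = f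
      · rw [toJK_i_tail τ f hf]
        rfl
      · rw [toJK_i_edge τ f hf]
        have h1 := Hom.edge h (graftEquiv h hh f) (by rw [hF_graftEquiv]; exact hf)
        rw [hF_graftEquiv] at h1
        have h2 : σ.j (graftEquiv h hh f) = graftEquiv h hh (τ.j f) := by
          rw [← h1, graftEquiv_hF]
        have h3 : σ.j (graftEquiv h hh f) ≠ graftEquiv h hh f := fun e =>
          hf ((graftEquiv h hh).injective (h2.symm.trans e))
        refine Eq.trans ?_ (toJK_i_edge σ _ h3).symm
        rw [h2]
        rfl
    · exact (σ.toJK.i_i _).symm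
  a_s := fun _ => rfl
  v_p := fun f => (congrArg (fun t => Hom.hV h (τ.bd t)) (hF_graftEquiv h hh f)).symm.trans
    (Hom.bd_hF h _)
  pull := fun w f hf => by
    refine ⟨Hom.hF h f, ⟨?_, graftEquiv_hF h hh f⟩, ?_⟩
    · exact hh.1.1 ((Hom.bd_hF h f).trans hf)
    · rintro f' ⟨-, rfl⟩
      exact (hF_graftEquiv h hh f').symm

theorem graftMap_reduced (h : τ ⟶ σ) (hh : graftings h) : IsReducedCover (graftMap h hh) :=
  (isReducedCover_iff _ τ.toJK_noIsolatedEdges σ.toJK_noIsolatedEdges).2 hh.1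

theorem toJK_hom_ext {Y : JKGraph} {f g : τ.toJK ⟶ Y}
    (hh : ∀ x, JKGraph.Hom.h f x = JKGraph.Hom.h g x)
    (hv : ∀ x, JKGraph.Hom.v f x = JKGraph.Hom.v g x) : f = g := by
  refine JKGraph.hom_ext (toJK_arc_ext (JKGraph.Hom.a_i f) (JKGraph.Hom.a_i g) fun x => ?_) hh hv
  exact (JKGraph.Hom.a_s f x).trans ((congrArg Y.s (hh x)).trans (JKGraph.Hom.a_s g x).symm)

/-- Graftings to reduced covers. -/
def Φ₁ : WideSubcategory graftings ⥤ WideSubcategory KGr.reducedCovers where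
  obj τ := ⟨τ.obj.toKGr⟩
  map {τ σ} h := ⟨KGr.free (X := τ.obj.toKGr) (Y := σ.obj.toKGr) (graftMap h.hom h.property),
    _, graftMap_reduced h.hom h.property, rfl⟩
  map_id τ := by
    apply WideSubcategory.hom_ext
    refine Eq.trans ?_ (KGr.free_id τ.obj.toKGr)
    refine congrArg KGr.free (toJK_hom_ext (fun f => ?_) fun _ => rfl)
    exact hF_graftEquiv (𝟙 τ.obj) (graftings.id_mem τ.obj) f
  map_comp {τ σ ρ} h k := by
    apply WideSubcategory.hom_ext
    refine Eq.trans ?_ (KGr.free_comp (X := τ.obj.toKGr) (Y := σ.obj.toKGr) (Z := ρ.obj.toKGr)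
      (graftMap h.hom h.property) (graftMap k.hom k.property))
    refine congrArg KGr.free (toJK_hom_ext (fun f => ?_) fun _ => rfl)
    refine (h.hom ≫ k.hom).inj ?_
    refine (hF_graftEquiv _ (h ≫ k).property f).trans ?_
    rw [comp_hF]
    refine Eq.symm ((congrArg (Hom.hF h.hom) (hF_graftEquiv k.hom k.property _)).trans ?_)
    exact hF_graftEquiv h.hom h.property f

end Phi1

section Phi2

variable {τ σ ρ : BMGraph}

open Classical in
/-- For a morphism `h : σ ⟶ ρ` and a vertex `x` of `ρ`, the graph that is contracted to `x`: it is
spanned by the vertices of `σ` over `x`, its inner edges are the edges contracted by `h`, and it has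
one port for each flag of `ρ` at `x`. -/
@[reducible]
def fibre (h : σ ⟶ ρ) (x : ρ.V) : JKGraph where
  A := {f : σ.F // Hom.hV h (σ.bd f) = x} ⊕ {r : ρ.F // ρ.bd r = x}
  H := {f : σ.F // Hom.hV h (σ.bd f) = x}
  V := {v : σ.V // Hom.hV h v = x}
  finA := inferInstance
  finH := inferInstance
  finV := inferInstance
  i := Sum.elim
    (fun f => if hf : ∃ r, Hom.hF h r = f.1
      then Sum.inr ⟨hf.choose, by rw [← Hom.bd_hF h, hf.choose_spec, f.2]⟩
      else Sum.inl ⟨Hom.jc h f.1, by rw [Hom.bd_jc', f.2]⟩)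
    (fun r => Sum.inl ⟨Hom.hF h r.1, by rw [Hom.bd_hF, r.2]⟩)
  s := Sum.inl
  p := fun f => ⟨σ.bd f.1, f.2⟩
  i_i := by
    rintro (⟨f, hfx⟩ | ⟨r, hr⟩)
    · by_cases hf : ∃ r, Hom.hF h r = f
      · simp [hf, hf.choose_spec]
      · have : ¬ ∃ r, Hom.hF h r = Hom.jc h f := (Hom.jc_range h f).not.2 hf
        simp [hf, this, Hom.jc_jc]
    · have hf : ∃ r', Hom.hF h r' = Hom.hF h r := ⟨r, rfl⟩
      have := Hom.inj h hf.choose_spec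
      simp [this]
  i_ne := by
    rintro (⟨f, hfx⟩ | ⟨r, hr⟩)
    · by_cases hf : ∃ r, Hom.hF h r = f
      · simp [hf]
      · have : Hom.jc h f ≠ f := (Hom.jc_fix h f).not.2 hf
        simp [hf, this]
    · simp
  s_inj := Sum.inl_injective

theorem fibre_i_inr (h : σ ⟶ ρ) (x : ρ.V) (r : {r : ρ.F // ρ.bd r = x}) :
    (fibre h x).i (Sum.inr r : {f : σ.F // Hom.hV h (σ.bd f) = x} ⊕ _) =
      Sum.inl ⟨Hom.hF h r.1, by rw [Hom.bd_hF, r.2]⟩ := rfl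

theorem fibre_i_not (h : σ ⟶ ρ) (x : ρ.V) (f : {f : σ.F // Hom.hV h (σ.bd f) = x})
    (hf : f.1 ∉ Set.range (Hom.hF h)) :
    (fibre h x).i (Sum.inl f : _ ⊕ {r : ρ.F // ρ.bd r = x}) =
      Sum.inl ⟨Hom.jc h f.1, by rw [Hom.bd_jc', f.2]⟩ := dif_neg hf

/-- The fibre with its ports, as an effective graph with the same interface as `x`. -/
def fibreShell (h : σ ⟶ ρ) (x : ρ.V) : Shell (ρ.toJK.Fl x) where
  G := fibre h x
  eff := by
    constructor
    · obtain ⟨v, hv⟩ := Hom.surj h x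
      exact ⟨⟨v, hv⟩⟩
    · rintro (f | r)
      · exact Or.inl ⟨f, rfl⟩
      · exact Or.inr ⟨_, rfl⟩
  port := Equiv.ofBijective (fun r => ⟨Sum.inr r, by simp⟩)
    ⟨fun a b e => Sum.inr_injective (congrArg Subtype.val e), by
      rintro ⟨f | r, hr⟩
      · exact absurd ⟨f, rfl⟩ hr
      · exact ⟨r, rfl⟩⟩

/-- A compression commutes with the involutions. -/
theorem compression_j (h : σ ⟶ ρ) (hh : compressions h) (r : ρ.F) :
    Hom.hF h (ρ.j r) = σ.j (Hom.hF h r) := by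
  by_cases hr : σ.j (Hom.hF h r) = Hom.hF h r
  · obtain ⟨t, ht, e⟩ := hh.2.2 hr
    have := Hom.inj h e
    subst this
    exact (congrArg (Hom.hF h) ht).trans hr.symm
  · exact Hom.edge h r hr

/-- A compression contracts actual edges only. -/
theorem compression_jc (h : σ ⟶ ρ) (hh : compressions h) (f : σ.F)
    (hf : f ∉ Set.range (Hom.hF h)) : σ.j f ≠ f ∧ Hom.jc h f = σ.j f := by
  have h1 : σ.j f ≠ f := fun e => by
    obtain ⟨t, -, ht⟩ := hh.2.2 (show f ∈ σ.tails from e)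
    exact hf ⟨t, ht⟩
  exact ⟨h1, Hom.jc_edge h f hf h1⟩

/-- The etale map from the fibre of a compression. -/
def fibreMap (h : σ ⟶ ρ) (hh : compressions h) (x : ρ.V) : fibre h x ⟶ σ.toJK where
  a := Sum.elim (fun f => Sum.inl f.1)
    (fun r => σ.toJK.i (Sum.inl (Hom.hF h r.1) : σ.F ⊕ σ.tails))
  h := Subtype.val
  v := Subtype.val
  a_i := by
    rintro (f | r)
    · by_cases hf : f.1 ∈ Set.range (Hom.hF h)
      · obtain ⟨f, hfx⟩ := f
        obtain ⟨r, rfl⟩ := hf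
        have hr : ρ.bd r = x := by rw [← Hom.bd_hF h]; exact hfx
        have e := (fibre h x).i_i (Sum.inr ⟨r, hr⟩ : {f : σ.F // Hom.hV h (σ.bd f) = x} ⊕ _)
        rw [fibre_i_inr] at e
        rw [e]
        rfl
      · obtain ⟨h1, h2⟩ := compression_jc h hh f.1 hf
        rw [fibre_i_not h x f hf]
        refine Eq.trans ?_ (toJK_i_edge σ f.1 h1).symm
        exact congrArg Sum.inl h2
    · exact (σ.toJK.i_i _).symm
  a_s := fun _ => rfl
  v_p := fun _ => rfl
  pull := fun w f hf => ⟨⟨f, (congrArg (Hom.hV h) hf).trans w.2⟩, ⟨Subtype.ext hf, rfl⟩,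
    fun f' hf' => Subtype.ext hf'.2⟩

/-- The fibre of a compression, as a graph decorated by `σ`. -/
def fibrePiece (h : σ ⟶ ρ) (hh : compressions h) (x : ρ.V) :
    Piece (y.obj σ.toJK) (ρ.toJK.Fl x) where
  toShell := fibreShell h x
  dec := y.map (fibreMap h hh x)

/-- The map on arcs corresponding to a compression. -/
def comprArc (h : σ ⟶ ρ) (hh : compressions h) : ρ.F ⊕ ρ.tails → σ.F ⊕ σ.tails :=
  Sum.map (Hom.hF h) (fun t => ⟨Hom.hF h t.1, hh.1 t.2⟩)

theorem comprArc_i (h : σ ⟶ ρ) (hh : compressions h) (a : ρ.toJK.A) :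
    comprArc h hh (ρ.toJK.i a) = σ.toJK.i (comprArc h hh a) := by
  rcases a with f | t
  · by_cases hf : ρ.j f = f
    · rw [toJK_i_tail ρ f hf]
      exact (toJK_i_tail σ _ (hh.1 hf)).symm
    · rw [toJK_i_edge ρ f hf]
      have h1 : σ.j (Hom.hF h f) ≠ Hom.hF h f := fun e => hf (Hom.inj h (by
        rw [compression_j h hh, e]))
      refine Eq.trans ?_ (toJK_i_edge σ _ h1).symm
      exact congrArg Sum.inl (compression_j h hh f)
  · rfl

/-- The Kleisli morphism corresponding to a compression `h : σ ⟶ ρ`: each vertex of `ρ` is refined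
into the graph contracted to it. -/
def comprMap (h : σ ⟶ ρ) (hh : compressions h) : y.obj ρ.toJK ⟶ bar (y.obj σ.toJK) :=
  mkDec (comprArc h hh) (comprArc_i h hh) (fun x => cls (fibrePiece h hh x)) (by
    rintro x ⟨r, rfl⟩
    exact (comprArc_i h hh (Sum.inl r : ρ.F ⊕ ρ.tails)).symm)

theorem comprMap_at (h : σ ⟶ ρ) (hh : compressions h) (x : ρ.V) :
    at' (comprMap h hh) x = cls (fibrePiece h hh x) := mkDec_at _ _ _ _ _

theorem toJK_not_mem_range (τ : BMGraph) (t : τ.tails) :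
    (Sum.inr t : τ.F ⊕ τ.tails) ∉ Set.range τ.toJK.s := by simp

theorem isIso_of_ports {X Y : JKGraph} (f : X ⟶ Y) (hv : Function.Bijective (JKGraph.Hom.v f))
    (h1 : ∀ a, a ∉ Set.range X.s → JKGraph.Hom.a f a ∉ Set.range Y.s)
    (h2 : ∀ a b, a ∉ Set.range X.s → b ∉ Set.range X.s → JKGraph.Hom.a f a = JKGraph.Hom.a f b →
      a = b)
    (h3 : ∀ b, b ∉ Set.range Y.s → ∃ a, JKGraph.Hom.a f a = b) : IsIso f := by
  have hi := h_injective f hv.1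
  have hs := h_surjective f hv.2
  have key : ∀ a, a ∈ Set.range X.s → JKGraph.Hom.a f a ∈ Set.range Y.s := by
    rintro _ ⟨t, rfl⟩
    exact ⟨_, (JKGraph.Hom.a_s f t).symm⟩
  refine isIso_of_bijective f ⟨fun a b e => ?_, fun b => ?_⟩ ⟨hi, hs⟩ hv
  · by_cases ha : a ∈ Set.range X.s
    · by_cases hb : b ∈ Set.range X.s
      · obtain ⟨t, rfl⟩ := ha
        obtain ⟨u, rfl⟩ := hb
        rw [JKGraph.Hom.a_s, JKGraph.Hom.a_s] at e
        rw [hi (Y.s_inj e)]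
      · exact absurd (e ▸ key a ha) (h1 b hb)
    · by_cases hb : b ∈ Set.range X.s
      · exact absurd (e ▸ key b hb) (h1 a ha)
      · exact h2 a b ha hb e
  · by_cases hb : b ∈ Set.range Y.s
    · obtain ⟨t, rfl⟩ := hb
      obtain ⟨u, rfl⟩ := hs t
      exact ⟨_, JKGraph.Hom.a_s f u⟩
    · exact h3 b hb

theorem rel_of_bijective {F : Species} {n : Type} [Finite n] {P Q : Piece F n} (f : P.G ⟶ Q.G)
    (hv : Function.Bijective (JKGraph.Hom.v f))
    (hp : ∀ k, JKGraph.Hom.a f (P.port k).1 = (Q.port k).1)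
    (hd : y.map f ≫ Q.dec = P.dec) : Rel P Q := by
  have hP : ∀ a (h : a ∉ Set.range P.G.s), a = (P.port (P.port.symm ⟨a, h⟩)).1 := by
    intro a h
    simp
  have : IsIso f := by
    refine isIso_of_ports f hv ?_ ?_ ?_
    · intro a ha
      rw [hP a ha, hp]
      exact (Q.port _).2
    · intro a b ha hb e
      rw [hP a ha, hP b hb, hp, hp] at e
      have := Q.port.injective (Subtype.ext e)
      rw [hP a ha, hP b hb, this]
    · intro b hb
      refine ⟨(P.port (Q.port.symm ⟨b, hb⟩)).1, ?_⟩
      rw [hp]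
      simp
  exact ⟨asIso f, hp, hd⟩

theorem comprMap_generic (h : σ ⟶ ρ) (hh : compressions h) : IsGenericMap (comprMap h hh) := by
  by_cases hV : Nonempty ρ.V
  · refine isGenericMap_of_rep ⟨hV, ρ.toJK_noIsolatedEdges⟩ _ (fibrePiece h hh)
      (fun x => (comprMap_at h hh x).symm) ?_
    let sh := fun x => (fibrePiece h hh x).toShell
    have hport : ∀ a : (glue ρ.toJK sh).A, a ∉ Set.range (glue ρ.toJK sh).s →
        ∃ t : ρ.tails, a = Sum.inl (Sum.inr t) := by
      intro a ha
      have e : a = (gluePort ρ.toJK sh ((gluePort ρ.toJK sh).symm ⟨a, ha⟩)).1 := by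
        rw [Equiv.apply_symm_apply]
      rcases hq : (gluePort ρ.toJK sh).symm ⟨a, ha⟩ with ⟨b, hb⟩
      rw [hq] at e
      rcases b with f | t
      · exact absurd ⟨f, rfl⟩ hb
      · exact ⟨t, e⟩
    have hval : ∀ t : ρ.tails, JKGraph.Hom.a (colimMapOf (comprMap h hh) (fibrePiece h hh)
        (fun x => (comprMap_at h hh x).symm)) (Sum.inl (Sum.inr t)) =
        (Sum.inr ⟨Hom.hF h t.1, hh.1 t.2⟩ : σ.F ⊕ σ.tails) := fun t => rfl
    refine isIso_of_ports _ ?_ ?_ ?_ ?_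
    · have hval' : ∀ (x : ρ.V) (v : {v : σ.V // Hom.hV h v = x}),
          JKGraph.Hom.v (colimMapOf (comprMap h hh) (fibrePiece h hh)
            (fun x => (comprMap_at h hh x).symm))
            (⟨x, v⟩ : Σ x : ρ.V, {v : σ.V // Hom.hV h v = x}) = v.1 := fun x v => rfl
      constructor
      · rintro ⟨x, v, rfl⟩ ⟨x', v', rfl⟩ e
        have e2 : v = v' := e
        subst e2
        rfl
      · intro v
        exact ⟨(⟨Hom.hV h v, v, rfl⟩ : Σ x : ρ.V, {v : σ.V // Hom.hV h v = x}), rfl⟩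
    · intro a ha
      obtain ⟨t, rfl⟩ := hport a ha
      rw [hval]
      exact toJK_not_mem_range σ _
    · intro a b ha hb e
      obtain ⟨t, rfl⟩ := hport a ha
      obtain ⟨t', rfl⟩ := hport b hb
      rw [hval, hval] at e
      have e2 := Hom.inj h (congrArg Subtype.val (Sum.inr_injective e))
      rw [Subtype.ext e2]
    · rintro (f | t) hb
      · exact absurd ⟨f, rfl⟩ hb
      · obtain ⟨u, hu, e⟩ := hh.2.2 t.2
        refine ⟨_, (hval ⟨u, hu⟩).trans (congrArg Sum.inr (Subtype.ext e))⟩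
  · have hE : IsEmpty ρ.V := not_nonempty_iff.1 hV
    have hE' : IsEmpty σ.V := ⟨fun v => hE.false (Hom.hV h v)⟩
    have : IsEmpty ρ.toJK.V := hE
    have : IsEmpty σ.toJK.V := hE'
    exact isGenericMap_of_empty _ ρ.toJK_noIsolatedEdges σ.toJK_noIsolatedEdges

theorem comprMap_id (τ : BMGraph) :
    comprMap (𝟙 τ) (compressions.id_mem τ) = etaApp (y.obj τ.toJK) := by
  refine dec_ext ?_ fun x => ?_
  · rintro (f | t) <;> rfl
  · rw [comprMap_at]
    refine Eq.symm (cls_eq.2 ?_)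
    let e : τ.toJK.Fl x ≃ (fibre (𝟙 τ) x).Fl ⟨x, rfl⟩ :=
      ⟨fun k => ⟨k, Subtype.ext k.2⟩, fun k => k.1, fun _ => rfl, fun _ => rfl⟩
    refine rel_of_bijective (P := ⟨corShell (τ.toJK.Fl x), corDec (F := y.obj τ.toJK)
      ⟨τ.toJK.star x⟩⟩) (Q := fibrePiece (𝟙 τ) (compressions.id_mem τ) x)
      (JKGraph.mkCor (X := fibre (𝟙 τ) x) ⟨x, rfl⟩ e) ?_ ?_ ?_
    · exact ⟨fun _ _ _ => rfl, fun v => ⟨(), Subtype.ext v.2.symm⟩⟩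
    · intro k
      exact (fibre (𝟙 τ) x).i_i (Sum.inr k)
    · refine cor_dec_ext (Eq.trans ?_ (corDec_id _).symm)
      exact ULift.ext _ _ (JKGraph.cor_ext (fun _ => rfl) rfl)

theorem fibre_i_hF (h : σ ⟶ ρ) (x : ρ.V) (r : ρ.F) (hr : ρ.bd r = x)
    (hp : Hom.hV h (σ.bd (Hom.hF h r)) = x) :
    (fibre h x).i (Sum.inl ⟨Hom.hF h r, hp⟩ :
      {f : σ.F // Hom.hV h (σ.bd f) = x} ⊕ {r : ρ.F // ρ.bd r = x}) =
      (Sum.inr ⟨r, hr⟩ : {f : σ.F // Hom.hV h (σ.bd f) = x} ⊕ {r : ρ.F // ρ.bd r = x}) :=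
  (fibre h x).i_i (Sum.inr ⟨r, hr⟩ : {f : σ.F // Hom.hV h (σ.bd f) = x} ⊕ {r : ρ.F // ρ.bd r = x})

/-- The inclusion of half-edges of fibres for a composite. -/
def fibreFl (h : τ ⟶ σ) (k : σ ⟶ ρ) (x : ρ.V) (v : σ.V) (hv : Hom.hV k v = x)
    (f : {f : τ.F // Hom.hV h (τ.bd f) = v}) : {f : τ.F // Hom.hV (h ≫ k) (τ.bd f) = x} :=
  ⟨f.1, (congrArg (Hom.hV k) f.2).trans hv⟩

/-- The inclusion of arcs of fibres for a composite. -/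
def fibreArc (h : τ ⟶ σ) (k : σ ⟶ ρ) (x : ρ.V) (v : σ.V) (hv : Hom.hV k v = x) :
    {f : τ.F // Hom.hV h (τ.bd f) = v} ⊕ {r : σ.F // σ.bd r = v} →
    {f : τ.F // Hom.hV (h ≫ k) (τ.bd f) = x} ⊕ {r : ρ.F // ρ.bd r = x} :=
  Sum.elim (fun f => Sum.inl (fibreFl h k x v hv f))
    (fun r => (fibre (h ≫ k) x).i (Sum.inl (fibreFl h k x v hv
      ⟨Hom.hF h r.1, (Hom.bd_hF h r.1).trans r.2⟩) :
      {f : τ.F // Hom.hV (h ≫ k) (τ.bd f) = x} ⊕ {r : ρ.F // ρ.bd r = x}))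

/-- The inclusion of fibres for a composite. -/
def fibreIncl (h : τ ⟶ σ) (k : σ ⟶ ρ) (x : ρ.V) (v : σ.V) (hv : Hom.hV k v = x) :
    fibre h v ⟶ fibre (h ≫ k) x where
  a := fibreArc h k x v hv
  h := fibreFl h k x v hv
  v := fun w => ⟨w.1, (congrArg (Hom.hV k) w.2).trans hv⟩
  a_i := by
    rintro (⟨f, hf⟩ | r)
    · by_cases hr : f ∈ Set.range (Hom.hF h)
      · obtain ⟨r, rfl⟩ := hr
        have hr : σ.bd r = v := by rw [← Hom.bd_hF h]; exact hf
        exact congrArg (fibreArc h k x v hv) (fibre_i_hF h v r hr hf)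
      · refine (congrArg (fibreArc h k x v hv) (fibre_i_not h v ⟨f, hf⟩ hr)).trans ?_
        have hr' : f ∉ Set.range (Hom.hF (h ≫ k)) := by
          rintro ⟨t, rfl⟩
          exact hr ⟨_, rfl⟩
        refine Eq.trans ?_ (fibre_i_not (h ≫ k) x ⟨f, (congrArg (Hom.hV k) hf).trans hv⟩ hr').symm
        exact congrArg Sum.inl (Subtype.ext (Hom.compJc_not h k f hr).symm)
    · exact ((fibre (h ≫ k) x).i_i _).symm
  a_s := fun _ => rfl
  v_p := fun _ => rfl
  pull := by
    rintro ⟨w, hw⟩ ⟨f, hf⟩ e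
    have e1 : τ.bd f = w := congrArg Subtype.val e
    subst e1
    exact ⟨(⟨f, hw⟩ : {f : τ.F // Hom.hV h (τ.bd f) = v}), ⟨rfl, rfl⟩,
      fun f' hf' => Subtype.ext (congrArg (fun t => t.1) hf'.2 : f'.1 = f)⟩

theorem comprMap_comp (h : τ ⟶ σ) (hh : compressions h) (k : σ ⟶ ρ) (hk : compressions k) :
    comprMap (h ≫ k) (compressions.comp_mem h k hh hk) =
      comprMap k hk ≫ barMap (comprMap h hh) ≫ muApp (y.obj τ.toJK) := by
  refine dec_ext ?_ fun x => ?_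
  · rintro (f | t) <;> rfl
  · rw [comprMap_at]
    let Q : Piece (bar (y.obj τ.toJK)) (ρ.toJK.Fl x) :=
      Piece.map (comprMap h hh) (fibrePiece k hk x)
    let P : ∀ v : (fibre k x).V, Piece (y.obj τ.toJK) ((fibre k x).Fl v) := fun v =>
      relabel (JKGraph.flMap (fibreMap k hk x) v) (fibrePiece h hh v.1)
    have hP : ∀ v, cls (P v) = at' Q.dec v := fun v => by
      refine Eq.trans ?_ (at_map (fibreMap k hk x) (comprMap h hh) v).symm
      exact congrArg ((bar (y.obj τ.toJK)).act (JKGraph.flMap (fibreMap k hk x) v))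
        (comprMap_at h hh v.1).symm
    have e1 : at' (comprMap k hk ≫ barMap (comprMap h hh) ≫ muApp (y.obj τ.toJK)) x =
        Species.Hom.o (muApp (y.obj τ.toJK)) (cls Q) :=
      congrArg (fun t => Species.Hom.o (muApp (y.obj τ.toJK))
        (Species.Hom.o (barMap (comprMap h hh)) t)) (comprMap_at k hk x)
    refine Eq.trans ?_ (e1.trans (muApp_cls Q P hP)).symm
    refine Eq.symm (cls_eq.2 ?_)
    let W := fibre (h ≫ k) x
    let sh := fun v => (P v).toShell
    let cA : (fibre k x).A → W.A := Sum.elim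
      (fun f => Sum.inl ⟨Hom.hF h f.1, by rw [comp_hV, Hom.bd_hF, f.2]⟩) Sum.inr
    have cA_i : ∀ a, cA ((fibre k x).i a) = W.i (cA a) := by
      rintro (f | r)
      · by_cases hr : f.1 ∈ Set.range (Hom.hF k)
        · obtain ⟨f, hf⟩ := f
          obtain ⟨r, rfl⟩ := hr
          have hr : ρ.bd r = x := by rw [← Hom.bd_hF k]; exact hf
          exact (congrArg cA (fibre_i_hF k x r hr hf)).trans
            (fibre_i_hF (h ≫ k) x r hr _).symm
        · refine (congrArg cA (fibre_i_not k x f hr)).trans ?_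
          have hr' : Hom.hF h f.1 ∉ Set.range (Hom.hF (h ≫ k)) := by
            rintro ⟨t, ht⟩
            exact hr ⟨t, Hom.inj h ht⟩
          refine Eq.trans ?_ (fibre_i_not (h ≫ k) x ⟨Hom.hF h f.1, _⟩ hr').symm
          exact congrArg Sum.inl (Subtype.ext (Hom.compJc_hF h k f.1).symm)
      · rfl
    let φ : y.obj (glue (fibre k x) sh) ⟶ y.obj W := glueDesc (K := y.obj W) (fibre k x) sh cA cA_i
      (fun v => y.map (fibreIncl h k x v.1 v.2))
      (by
        rintro v ⟨r, rfl⟩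
        exact (cA_i (Sum.inl r : {f : σ.F // Hom.hV k (σ.bd f) = x} ⊕
          {r : ρ.F // ρ.bd r = x})).symm)
    have hφ : ∀ v, y.map (glueι (fibre k x) sh v) ≫ φ = y.map (fibreIncl h k x v.1 v.2) :=
      fun v => glueι_desc (fibre k x) sh _ _ _ _ v
    have hval : ∀ (v : {v : σ.V // Hom.hV k v = x}) (w : {w : τ.V // Hom.hV h w = v.1}),
      (JKGraph.Hom.v (yPre φ) (⟨v, w⟩ : Σ v : {v : σ.V // Hom.hV k v = x},
        {w : τ.V // Hom.hV h w = v.1})).1 = w.1 := fun v w => rfl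
    refine rel_of_bijective (Q := fibrePiece (h ≫ k) (compressions.comp_mem h k hh hk) x)
      (yPre φ) ?_ (fun _ => rfl) ?_
    · constructor
      · rintro ⟨⟨v, hv⟩, w, hw⟩ ⟨⟨v', hv'⟩, w', hw'⟩ e
        have e2 : w = w' := congrArg Subtype.val e
        subst e2
        have e3 : v = v' := hw.symm.trans hw'
        subst e3
        rfl
      · rintro ⟨w, hw⟩
        exact ⟨(⟨⟨Hom.hV h w, hw⟩, w, rfl⟩ : Σ v : {v : σ.V // Hom.hV k v = x},
          {w : τ.V // Hom.hV h w = v.1}), Subtype.ext (hval ⟨Hom.hV h w, hw⟩ ⟨w, rfl⟩)⟩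
    · refine Eq.trans (congrArg (· ≫ y.map (fibreMap (h ≫ k)
        (compressions.comp_mem h k hh hk) x)) (y_yPre φ)) ?_
      refine glue_ext (fibre k x) sh ?_ fun v => ?_
      · rintro (f | r)
        · rfl
        · exact (comprArc_i h hh (Sum.inl (Hom.hF k r.1) : σ.F ⊕ σ.tails)).symm
      · refine (chase (hφ v) ?_).trans (substPiece_ι Q.toShell _ _ P _ v).symm
        refine (y.map_comp _ _).symm.trans ?_
        refine congrArg y.map (?_ : _ = fibreMap h hh v.1)
        refine JKGraph.hom_ext ?_ (fun _ => rfl) (fun _ => rfl)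
        rintro (f | r)
        · rfl
        · exact JKGraph.Hom.a_i (fibreMap (h ≫ k) (compressions.comp_mem h k hh hk) x)
            (Sum.inl (fibreFl h k x v.1 v.2 ⟨Hom.hF h r.1, (Hom.bd_hF h r.1).trans r.2⟩) :
              {f : τ.F // Hom.hV (h ≫ k) (τ.bd f) = x} ⊕ {r : ρ.F // ρ.bd r = x})

/-- Compressions to generic morphisms, read backwards. -/
def Φ₂ : WideSubcategory compressions ⥤ (WideSubcategory KGr.generics)ᵒᵖ where
  obj τ := Opposite.op ⟨τ.obj.toKGr⟩
  map {σ ρ} h := Quiver.Hom.op ⟨KGr.ofMap (X := ρ.obj.toKGr) (Y := σ.obj.toKGr)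
    (comprMap h.hom h.property), comprMap_generic h.hom h.property⟩
  map_id τ := by
    apply Quiver.Hom.unop_inj
    apply WideSubcategory.hom_ext
    exact KGr.ext (comprMap_id τ.obj)
  map_comp {τ σ ρ} h k := by
    apply Quiver.Hom.unop_inj
    apply WideSubcategory.hom_ext
    exact KGr.ext (comprMap_comp h.hom h.property k.hom k.property)

end Phi2

end BMGraph

end BM

end

noncomputable section

namespace JK

open JKGraph Piece

/-! ### Etale maps and decorations of graphs without isolated edges -/

section NoIsolated

variable {X Y Z : JKGraph}

/-! In a graph without isolated edges every arc is a flag or the opposite of a flag. So etale maps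
are determined by flags and vertices, and isomorphisms of decorated pieces can be built from
bijections of flags and of vertices (`rel_of_flags`).

Graftings. A reduced cover is an etale map bijective on vertices (`isReducedCover_iff`), hence, by
the pullback condition, bijective on flags. Compatibility with `i` says that edges go to edges,
while tails may be joined. Inverting the map on flags gives a grafting, whose involution `jc` is
trivial because no flag is contracted. The unit of the monad is injective on operations, so an etale
map can be recovered from its free Kleisli morphism. Matching the two flags of each inner edge turns
a graph into a Borisov-Manin graph (`ofJK`). An isomorphism of graphs is both a reduced cover and
generic, which makes `Φ₁` and `Φ₂` essentially surjective at the same time.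

Compressions. A compression `h` from `σ` to `ρ` keeps all tails, so it contracts actual edges only
and `jc` is forced. The map `hF` is visible on arcs, and `hV` can be read off from the vertices of
the fibres; hence `Φ₂` is faithful. Conversely, a generic morphism presents `σ` as glued from pieces
`P x`, one for each vertex `x` of `ρ`. Let `hV` send the vertices of `P x` to `x`, and let `hF` send
a flag of `ρ` at `x` to the flag of `P x` opposite to the corresponding port. The remaining flags
lie on inner edges of the pieces; these are the edges to contract, and the fibre over `x` is then
isomorphic to `P x` (`exists_compression`).

Commutation laws. Given a compression `h` and a grafting `k`, the graph `σ` is `τ` with its tails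
joined as `ρ` prescribes (`exists_grafting_compression`). The square commutes because `g` identifies
the fibre of `h` over `x` with the fibre of `c` over the image of `x`. For the pushout property,
composing with a free morphism in front is mere restriction of decorations, and free morphisms on
covers are epimorphisms. Hence only existence of the induced morphism matters. As `g` is bijective
on vertices, the operations descend once the colours do; the colours have to match along the new
edges of `σ` only. A new edge joins tails of `τ`, which come from flags of `ρ` because `h` is a
compression, and there the morphism out of `ρ` supplies the matching (`isPushout_square`). -/

theorem JKGraph.eq_flag_or_opposite (hX : X.NoIsolatedEdges) (a : X.A) :
    ∃ t, a = X.s t ∨ a = X.i (X.s t) := by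
  rcases hX a with ⟨t, rfl⟩ | ⟨t, ht⟩
  · exact ⟨t, Or.inl rfl⟩
  · exact ⟨t, Or.inr (by rw [ht, X.i_i])⟩

theorem JKGraph.hom_ext_of_noIsolatedEdges (hX : X.NoIsolatedEdges) {f g : X ⟶ Y}
    (hh : ∀ x, JKGraph.Hom.h f x = JKGraph.Hom.h g x)
    (hv : ∀ x, JKGraph.Hom.v f x = JKGraph.Hom.v g x) : f = g := by
  refine JKGraph.hom_ext (fun a => ?_) hh hv
  obtain ⟨t, rfl | rfl⟩ := JKGraph.eq_flag_or_opposite hX a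
  · rw [JKGraph.Hom.a_s, JKGraph.Hom.a_s, hh]
  · rw [JKGraph.Hom.a_i, JKGraph.Hom.a_i, JKGraph.Hom.a_s, JKGraph.Hom.a_s, hh]

/-- Decorations are determined by their pullback along an etale map that covers. -/
theorem dec_ext_of_cover {F : Species} (f : X ⟶ Y) (hf : IsCover f) {d d' : y.obj Y ⟶ F}
    (h : y.map f ≫ d = y.map f ≫ d') : d = d' := by
  refine dec_ext (fun b => ?_) fun w => ?_
  · obtain ⟨a, rfl⟩ := hf.1 b
    exact congrArg (fun t => Species.Hom.c t a) h
  · obtain ⟨x, rfl⟩ := hf.2 w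
    have h1 := congrArg (fun t => at' t x) h
    simp only [at_map] at h1
    have h2 := congrArg (F.act (flMap f x).symm) h1
    rwa [F.act_trans, F.act_trans, Equiv.symm_trans_self, F.act_refl, F.act_refl] at h2

/-- A decoration descends along an etale map bijective on vertices if its colours do. -/
theorem exists_dec_of_bijective {F : Species} (f : X ⟶ Y)
    (hv : Function.Bijective (JKGraph.Hom.v f)) (d : y.obj X ⟶ F) (c : Y.A → F.Col)
    (c_i : ∀ b, c (Y.i b) = F.inv (c b))
    (hc : ∀ a, c (JKGraph.Hom.a f a) = Species.Hom.c d a) :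
    ∃ d' : y.obj Y ⟶ F, y.map f ≫ d' = d := by
  -- Each vertex of `Y` has one preimage, whose operation is transported along the bijection of
  -- flags. `piCongrLeft` does this for the whole dependent family, and `ho` computes it at images.
  let e := Equiv.ofBijective _ hv
  let o : ∀ w, F.Op (Y.Fl w) := e.piCongrLeft (fun w => F.Op (Y.Fl w))
    (fun x => F.act (flMap f x).symm (at' d x))
  have ho : ∀ x, o (JKGraph.Hom.v f x) = F.act (flMap f x).symm (at' d x) := fun x =>
    e.piCongrLeft_apply_apply (fun w => F.Op (Y.Fl w)) _ x
  refine ⟨mkDec c c_i o ?_, dec_ext hc fun x => ?_⟩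
  · intro w k
    obtain ⟨x, rfl⟩ := hv.2 w
    obtain ⟨k, rfl⟩ := (flMap f x).surjective k
    rw [ho, F.col_act, Equiv.symm_apply_apply, col_at, ← hc, JKGraph.Hom.a_i, JKGraph.Hom.a_s]
    rfl
  · rw [at_map, mkDec_at, ho, F.act_trans, Equiv.self_trans_symm, F.act_refl]

theorem Shell.port_or_inner {n : Type} [Finite n] (S : Shell n) (t : S.G.H) :
    (∃ k, S.G.i (S.G.s t) = (S.port k).1) ∨ ∃ u, S.G.i (S.G.s t) = S.G.s u := by
  by_cases h : S.G.i (S.G.s t) ∈ Set.range S.G.s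
  · obtain ⟨u, hu⟩ := h
    exact Or.inr ⟨u, hu.symm⟩
  · exact Or.inl ⟨S.port.symm ⟨_, h⟩, by simp⟩

/-- Two pieces decorated by a graph are isomorphic as soon as their vertices and flags correspond,
compatibly with incidence, inner edges, ports and decorations. -/
theorem rel_of_flags {n : Type} [Finite n] {P Q : Piece (y.obj Y) n}
    (eh : P.G.H → Q.G.H) (ev : P.G.V → Q.G.V) (heh : Function.Bijective eh)
    (hev : Function.Bijective ev) (hp : ∀ t, ev (P.G.p t) = Q.G.p (eh t))
    (hport : ∀ t k, P.G.i (P.G.s t) = (P.port k).1 → Q.G.i (Q.G.s (eh t)) = (Q.port k).1)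
    (hin : ∀ t u, P.G.i (P.G.s t) = P.G.s u → Q.G.i (Q.G.s (eh t)) = Q.G.s (eh u))
    (p : P.G ⟶ Y) (q : Q.G ⟶ Y) (hP : P.dec = y.map p) (hQ : Q.dec = y.map q)
    (hh : ∀ t, JKGraph.Hom.h q (eh t) = JKGraph.Hom.h p t)
    (hv : ∀ x, JKGraph.Hom.v q (ev x) = JKGraph.Hom.v p x) : Rel P Q := by
  classical
  -- The map on arcs is forced: flags follow `eh`, and the other arcs are ports, which have to keep
  -- their labels.
  let a : P.G.A → Q.G.A := fun b => if hb : b ∈ Set.range P.G.s then Q.G.s (eh hb.choose)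
    else (Q.port (P.port.symm ⟨b, hb⟩)).1
  have a_s : ∀ t, a (P.G.s t) = Q.G.s (eh t) := fun t => by
    have hb : P.G.s t ∈ Set.range P.G.s := ⟨t, rfl⟩
    change dite _ _ _ = _
    rw [dif_pos hb, P.G.s_inj hb.choose_spec]
  have a_port : ∀ k, a (P.port k).1 = (Q.port k).1 := fun k => by
    change dite _ _ _ = _
    rw [dif_neg (P.port k).2]
    simp
  -- The opposite of a flag is either a port or another flag, and `hport` and `hin` are precisely
  -- the two cases of equivariance.
  have a_is : ∀ t, a (P.G.i (P.G.s t)) = Q.G.i (Q.G.s (eh t)) := fun t => by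
    rcases P.toShell.port_or_inner t with ⟨k, hk⟩ | ⟨u, hu⟩
    · rw [hport t k hk, hk, a_port]
    · rw [hin t u hu, hu, a_s]
  let f : P.G ⟶ Q.G :=
    { a := a
      h := eh
      v := ev
      a_i := fun b => by
        obtain ⟨t, rfl | rfl⟩ := JKGraph.eq_flag_or_opposite P.eff.2 b
        · rw [a_is, a_s]
        · rw [P.G.i_i, a_is, a_s, Q.G.i_i]
      a_s := a_s
      v_p := hp
      pull := fun w z hz => by
        obtain ⟨t, rfl⟩ := heh.2 z
        exact ⟨t, ⟨hev.1 ((hp t).trans hz), rfl⟩, fun t' ht' => heh.1 ht'.2⟩ }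
  refine BM.BMGraph.rel_of_bijective f hev a_port ?_
  -- Both decorations come from etale maps to `Y`, so it is enough to compare them on flags and
  -- vertices.
  rw [hP, hQ, ← y.map_comp]
  exact congrArg y.map (JKGraph.hom_ext_of_noIsolatedEdges P.eff.2 hh hv)

end NoIsolated

/-! ### Free morphisms -/

/-- An automorphism of a corolla that fixes every port also fixes the flags opposite to them, hence
is the identity. So isomorphic decorated corollas with the same labels carry the same operation. -/
theorem etaApp_injective {F : Species} {n : Type} [Finite n] {x x' : F.Op n}
    (h : Species.Hom.o (etaApp F) x = Species.Hom.o (etaApp F) x') : x = x' := by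
  obtain ⟨θ, h1, h2⟩ := cls_eq.1 (show cls ⟨corShell n, corDec x⟩ = cls ⟨corShell n, corDec x'⟩ from h)
  have hθ : θ.hom = 𝟙 (corolla n) := by
    refine cor_ext (q := θ.hom) (fun k => ?_) rfl
    have h3 := (hom_a_inl (X := corolla n) θ.hom k).symm.trans (h1 k)
    exact Sum.inl_injective h3
  have h4 : y.map θ.hom = 𝟙 (y.obj (corolla n)) := (congrArg y.map hθ).trans (y.map_id _)
  have h3 : corDec x' = corDec x :=
    ((congrArg (· ≫ corDec x') h4).trans (Category.id_comp _)).symm.trans h2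
  rw [← corDec_id x, ← h3, corDec_id]

/-- Since the unit is the identity on colours and injective on operations, it can be cancelled; full
faithfulness of the embedding in species does the rest. -/
theorem map_etaApp_injective {X Y : JKGraph} {k l : X ⟶ Y}
    (h : y.map k ≫ etaApp (y.obj Y) = y.map l ≫ etaApp (y.obj Y)) : k = l := by
  refine y_inj (Species.hom_ext (fun a => ?_) fun n _ x => ?_)
  · exact congrArg (fun t : y.obj X ⟶ bar (y.obj Y) => Species.Hom.c t a) h
  · exact etaApp_injective (congrArg (fun t : y.obj X ⟶ bar (y.obj Y) => Species.Hom.o t x) h)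

namespace KGr

variable {X Y Z : KGr}

theorem toMap_free (k : X.1 ⟶ Y.1) :
    toMap (free k : X ⟶ Y) = y.map k ≫ etaApp (y.obj Y.1) := rfl

theorem free_injective {k l : X.1 ⟶ Y.1} (h : (free k : X ⟶ Y) = free l) : k = l :=
  map_etaApp_injective (congrArg toMap h)

/-- By naturality of the unit and the left unit law, composing with a free morphism in front is
restriction of a decoration along the etale map; no substitution is left. -/
theorem toMap_free_comp (k : X.1 ⟶ Y.1) (f : Y ⟶ Z) :
    toMap ((free k : X ⟶ Y) ≫ f) = y.map k ≫ toMap f := by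
  rw [toMap_comp, toMap_free, Category.assoc, ← Category.assoc (etaApp _), ← eta_nat,
    Category.assoc, mu_left_unit]
  exact congrArg (y.map k ≫ ·) (Category.comp_id _)

/-- By the right unit law, composing with a free morphism behind leaves the pieces as they are and
only changes their decorations. -/
theorem toMap_comp_free (f : X ⟶ Y) (k : Y.1 ⟶ Z.1) :
    toMap (f ≫ (free k : Y ⟶ Z)) = toMap f ≫ barMap (y.map k) := by
  rw [toMap_comp, toMap_free]
  have h1 : barMap (y.map k ≫ etaApp (y.obj Z.1)) =
    barMap (y.map k) ≫ barMap (etaApp (y.obj Z.1)) := barFunctor.map_comp _ _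
  rw [h1, Category.assoc, mu_right_unit]
  exact congrArg (toMap f ≫ ·) (Category.comp_id _)

/-- The isomorphism in the restricted Kleisli category given by an isomorphism of graphs. -/
def freeIso (e : X.1 ≅ Y.1) : X ≅ Y where
  hom := free e.hom
  inv := free e.inv
  hom_inv_id := by rw [← free_comp, e.hom_inv_id, free_id]
  inv_hom_id := by rw [← free_comp, e.inv_hom_id, free_id]

theorem reducedCovers_free_iso (e : X.1 ≅ Y.1) : reducedCovers (free e.hom : X ⟶ Y) :=
  ⟨e.hom, (isReducedCover_iff _ X.2 Y.2).2 (bijective_of_isIso e.hom).2.2, rfl⟩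

/-- Substituting corollas into `X` gives back `X` by the right unit law, now decorated by `e`; and
`e` itself identifies this with `Y` decorated by the identity. The criterion `isGenericMap_iff` is
for effective graphs, so the graph without vertices is treated apart. -/
theorem generics_free_iso (e : X.1 ≅ Y.1) : generics (free e.hom : X ⟶ Y) := by
  by_cases hV : Nonempty X.1.V
  · have eX : X.1.Effective := ⟨hV, X.2⟩
    have eY : Y.1.Effective := ⟨hV.map (JKGraph.Hom.v e.hom), Y.2⟩
    have hport : ∀ a, a ∈ Set.range X.1.s ↔ JKGraph.Hom.a e.hom a ∈ Set.range Y.1.s := by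
      intro a
      constructor
      · rintro ⟨t, rfl⟩
        exact ⟨_, (JKGraph.Hom.a_s e.hom t).symm⟩
      · rintro ⟨t, ht⟩
        have := congrArg (JKGraph.Hom.a e.inv) ht
        rw [← JKGraph.comp_a, e.hom_inv_id, JKGraph.Hom.a_s] at this
        exact ⟨_, this⟩
    let e' : X.1.Port ≃ Y.1.Port :=
      (Equiv.ofBijective _ (bijective_of_isIso e.hom).1).subtypeEquiv fun a => (hport a).not
    refine (isGenericMap_iff eX eY _).2 ⟨e', ?_⟩
    have h1 : cls (selfPiece eX (Equiv.refl _) (y.map e.hom ≫ etaApp (y.obj Y.1))) =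
        Species.Hom.o (barMap (etaApp (y.obj Y.1)))
          (cls (selfPiece eX (Equiv.refl _) (y.map e.hom))) := rfl
    refine (congrArg (Species.Hom.o (muApp (y.obj Y.1))) h1).trans ?_
    refine (congrArg (fun t => Species.Hom.o t (cls (selfPiece eX (Equiv.refl _) (y.map e.hom))))
      (mu_right_unit (y.obj Y.1))).trans ?_
    exact cls_eq.2 ⟨e, fun _ => rfl, Category.comp_id _⟩
  · have : IsEmpty X.1.V := not_nonempty_iff.1 hV
    have : IsEmpty Y.1.V := ⟨fun v => this.false (JKGraph.Hom.v e.inv v)⟩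
    exact isGenericMap_of_empty _ X.2 Y.2

/-- A commutative square whose horizontal sides are free on covers is a pushout as soon as
compatible colours descend along the lower side. -/
theorem isPushout_of_cover {W : KGr} (k : X.1 ⟶ Y.1) (hk : IsCover k) (f : X ⟶ Z) (f' : Y ⟶ W)
    (g : Z.1 ⟶ W.1) (hg : IsReducedCover g) (comm : (free k : X ⟶ Y) ≫ f' = f ≫ free g)
    (desc : ∀ (T : KGr) (α : Y ⟶ T) (β : Z ⟶ T), (free k : X ⟶ Y) ≫ α = f ≫ β →
      ∃ c : W.1.A → T.1.A, (∀ b, c (W.1.i b) = T.1.i (c b)) ∧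
        ∀ a, c (JKGraph.Hom.a g a) = Species.Hom.c (toMap β) a) :
    IsPushout (free k : X ⟶ Y) f f' (free g) := by
  -- Free morphisms on covers are epimorphisms: composing with them is restriction, and a decoration
  -- is determined by its restriction along a cover.
  have epi : ∀ {A B T : KGr} (l : A.1 ⟶ B.1), IsCover l → ∀ u v : B ⟶ T,
      (free l : A ⟶ B) ≫ u = free l ≫ v → u = v := fun l hl u v h => by
    have h1 := congrArg toMap h
    rw [toMap_free_comp, toMap_free_comp] at h1
    exact KGr.ext (dec_ext_of_cover l hl h1)
  have key : ∀ (T : KGr) (α : Y ⟶ T) (β : Z ⟶ T), (free k : X ⟶ Y) ≫ α = f ≫ β →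
      ∃ γ : W ⟶ T, f' ≫ γ = α ∧ (free g : Z ⟶ W) ≫ γ = β := by
    intro T α β h
    obtain ⟨c, c_i, hc⟩ := desc T α β h
    obtain ⟨d, hd⟩ := exists_dec_of_bijective g ((isReducedCover_iff g Z.2 W.2).1 hg) (toMap β)
      c c_i hc
    have hγ : (free g : Z ⟶ W) ≫ (ofMap d : W ⟶ T) = β :=
      KGr.ext ((toMap_free_comp g (ofMap d : W ⟶ T)).trans hd)
    -- The triangle with `α` may be checked after composing with the epimorphism `free k`, where it
    -- reduces to the triangle with `β`.
    refine ⟨ofMap d, epi k hk _ _ ?_, hγ⟩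
    rw [← Category.assoc, comm, Category.assoc, hγ, h]
  refine ⟨⟨comm⟩, ⟨Limits.PushoutCocone.IsColimit.mk comm
    (fun s => (key _ s.inl s.inr s.condition).choose)
    (fun s => (key _ s.inl s.inr s.condition).choose_spec.1)
    (fun s => (key _ s.inl s.inr s.condition).choose_spec.2) fun s m _ h2 => ?_⟩⟩
  exact epi g hg.1 _ _ (h2.trans (key _ s.inl s.inr s.condition).choose_spec.2.symm)

end KGr

end JK

namespace BM

open JK JK.Piece

namespace BMGraph

/-! ### Opposite flags, and the involution of a grafting -/

variable {τ σ ρ ω : BMGraph}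

/-- The opposite of a tail is its copy, never a flag. Equations between arcs, as supplied by etale
maps, are converted in this way into equations for `j`. -/
theorem toJK_i_eq_inl {f g : τ.F}
    (h : τ.toJK.i (Sum.inl f : τ.F ⊕ τ.tails) = (Sum.inl g : τ.F ⊕ τ.tails)) :
    τ.j f ≠ f ∧ τ.j f = g := by
  have hf : τ.j f ≠ f := fun e => by
    rw [toJK_i_tail τ f e] at h
    cases h
  rw [toJK_i_edge τ f hf] at h
  exact ⟨hf, Sum.inl_injective h⟩

theorem grafting_jc (h : τ ⟶ σ) (hh : graftings h) (f : τ.F) : Hom.jc h f = f :=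
  (Hom.jc_fix h f).2 (hh.2.2 f)

/-! ### Graftings and reduced covers -/

open Classical in
/-- The other flag of the edge to which a flag belongs, or the flag itself if there is none. -/
def matchingFlag (X : JKGraph) (f : X.H) : X.H :=
  if hf : ∃ g, X.s g = X.i (X.s f) then hf.choose else f

theorem matchingFlag_eq (X : JKGraph) {f g : X.H} (h : X.s g = X.i (X.s f)) :
    matchingFlag X f = g := by
  have hf : ∃ g, X.s g = X.i (X.s f) := ⟨g, h⟩
  rw [matchingFlag, dif_pos hf]
  exact X.s_inj (hf.choose_spec.trans h.symm)

/-- The Borisov-Manin graph of a graph without isolated edges: inner edges become edges, the other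
flags become tails. -/
def ofJK (X : JKGraph) : BMGraph where
  V := X.V
  F := X.H
  finV := X.finV
  finF := X.finH
  bd := X.p
  j := matchingFlag X
  j_j := fun f => by
    by_cases hf : ∃ g, X.s g = X.i (X.s f)
    · obtain ⟨g, hg⟩ := hf
      rw [matchingFlag_eq X hg, matchingFlag_eq X (g := f) (by rw [hg, X.i_i])]
    · have h1 : matchingFlag X f = f := dif_neg hf
      rw [h1, h1]

theorem ofJK_j (X : JKGraph) {f g : X.H} (h : X.s g = X.i (X.s f)) : (ofJK X).j f = g :=
  matchingFlag_eq X h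

theorem ofJK_j_port (X : JKGraph) {f : X.H} (h : X.i (X.s f) ∉ Set.range X.s) :
    (ofJK X).j f = f := dif_neg h

/-- The graph of the Borisov-Manin graph of `X` maps to `X`. -/
def ofJKMap (X : JKGraph) : (ofJK X).toJK ⟶ X where
  a := Sum.elim X.s (fun t => X.i (X.s t.1))
  h := id
  v := id
  a_i := by
    rintro (f | t)
    · by_cases hf : X.i (X.s f) ∈ Set.range X.s
      · obtain ⟨g, hg⟩ := hf
        have h1 := ofJK_j X hg
        have h2 : (ofJK X).j f ≠ f := fun e =>
          X.i_ne (X.s f) (by rw [← hg, ← h1, e])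
        rw [toJK_i_edge (ofJK X) f h2, h1]
        exact hg
      · rw [toJK_i_tail (ofJK X) f (ofJK_j_port X hf)]
        rfl
    · exact (X.i_i _).symm
  a_s := fun _ => rfl
  v_p := fun _ => rfl
  pull := fun w z hz => ⟨z, ⟨hz, rfl⟩, fun _ ht => ht.2⟩

/-- On flags and vertices the map is the identity, and it is surjective on arcs because there are no
isolated edges. It remains to see that opposites of tails are neither flags nor identified with each
other. -/
theorem isIso_ofJKMap (X : JKGraph) (hX : X.NoIsolatedEdges) : IsIso (ofJKMap X) := by
  have hs : Function.Surjective (JKGraph.Hom.v (ofJKMap X)) := Function.surjective_id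
  refine isIso_of_bijective _ ⟨?_, a_surjective _ hX hs⟩ Function.bijective_id
    Function.bijective_id
  -- A flag opposite to the tail `t` would be matched with `t`, hence equal to `t`, and its arc
  -- would be a fixpoint of `i`.
  have htail : ∀ (f : X.H) (t : (ofJK X).tails), X.s f ≠ X.i (X.s t.1) := fun f t e =>
    X.i_ne (X.s t.1) (by rw [← e, ← (ofJK_j X e).symm.trans t.2])
  rintro (f | t) (g | u) e
  · exact congrArg Sum.inl (X.s_inj e)
  · exact absurd e (htail f u)
  · exact absurd (Eq.symm e) (htail g t)
  · have h1 := congrArg X.i (show X.i (X.s t.1) = X.i (X.s u.1) from e)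
    rw [X.i_i, X.i_i] at h1
    exact congrArg Sum.inr (Subtype.ext (X.s_inj h1))

/-- Every graph without isolated edges comes from a Borisov-Manin graph. -/
def ofJKIso (X : KGr) : (ofJK X.1).toJK ≅ X.1 :=
  haveI := isIso_ofJKMap X.1 X.2
  asIso (ofJKMap X.1)

/-- The etale map retains `hV` and the inverse of `hF`; the involution carries no information, being
the identity for a grafting. -/
theorem graftMap_injective {h k : τ ⟶ σ} (hh : graftings h) (hk : graftings k)
    (e : graftMap h hh = graftMap k hk) : h = k := by
  refine Hom.ext (funext fun f => ?_)
    (congrArg JKGraph.Hom.v e) (funext fun f => ?_)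
  · have h1 := congrArg (fun t => JKGraph.Hom.h t (Hom.hF h f)) e
    have h2 : graftEquiv h hh (Hom.hF h f) = graftEquiv k hk (Hom.hF h f) := h1
    rw [graftEquiv_hF] at h2
    rw [h2, hF_graftEquiv, ← h2]
  · exact (grafting_jc h hh f).trans (grafting_jc k hk f).symm

/-- The grafting given by a reduced cover. -/
def graftingOf (k : τ.toJK ⟶ σ.toJK) (hk : Function.Bijective (JKGraph.Hom.v k)) : τ ⟶ σ :=
  have hb : Function.Bijective (JKGraph.Hom.h k) := ⟨h_injective k hk.1, h_surjective k hk.2⟩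
  let e : τ.F ≃ σ.F := Equiv.ofBijective (JKGraph.Hom.h k) hb
  -- No flag lies outside the range, so all conditions on contracted flags are void.
  have he : ∀ f, f ∈ Set.range e.symm := e.symm.surjective
  { hF := e.symm
    hV := JKGraph.Hom.v k
    jc := id
    jc_jc := fun _ => rfl
    jc_fix := fun f => ⟨fun _ => he f, fun _ => rfl⟩
    inj := e.symm.injective
    surj := hk.2
    j_range := fun f => ⟨fun _ => he f, fun _ => he _⟩
    jc_edge := fun f hf => absurd (he f) hf
    bd_hF := fun f => by
      have h1 : JKGraph.Hom.h k (e.symm f) = f := e.apply_symm_apply f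
      exact (JKGraph.Hom.v_p k (e.symm f)).trans (congrArg σ.bd h1)
    bd_jc := fun _ _ => rfl
    -- The two flags of an edge are opposite arcs; since `k` commutes with `i`, so are their images,
    -- which therefore form an edge of `σ`.
    edge := fun f hf => by
      obtain ⟨f, rfl⟩ := e.surjective f
      rw [e.symm_apply_apply] at hf ⊢
      rw [e.symm_apply_eq]
      have h1 := JKGraph.Hom.a_i k (Sum.inl f : τ.F ⊕ τ.tails)
      rw [toJK_i_edge τ f hf] at h1
      have h2 := (JKGraph.Hom.a_s k (τ.j f)).symm.trans (h1.trans
        (congrArg σ.toJK.i (JKGraph.Hom.a_s k f)))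
      exact (toJK_i_eq_inl h2.symm).2 }

theorem graftingOf_mem (k : τ.toJK ⟶ σ.toJK) (hk : Function.Bijective (JKGraph.Hom.v k)) :
    graftings (graftingOf k hk) := ⟨hk, (Equiv.ofBijective (JKGraph.Hom.h k)
      ⟨h_injective k hk.1, h_surjective k hk.2⟩).symm.bijective⟩

theorem graftMap_graftingOf (k : τ.toJK ⟶ σ.toJK) (hk : Function.Bijective (JKGraph.Hom.v k)) :
    graftMap (graftingOf k hk) (graftingOf_mem k hk) = k := by
  refine toJK_hom_ext (fun f => ?_) fun _ => rfl
  refine (graftingOf k hk).inj ((hF_graftEquiv _ (graftingOf_mem k hk) f).trans ?_)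
  exact ((Equiv.ofBijective (JKGraph.Hom.h k)
      ⟨h_injective k hk.1, h_surjective k hk.2⟩).symm_apply_apply f).symm

/-- Faithfulness combines injectivity of free morphisms with the recovery of a grafting from its
etale map; fullness is the inversion on flags carried out in `graftingOf`; and `ofJK` supplies the
preimages of objects, the comparison isomorphism being a reduced cover in both directions. -/
theorem Φ₁_isEquivalence : Φ₁.IsEquivalence where
  faithful := ⟨fun {τ σ} h k e => by
    apply WideSubcategory.hom_ext
    exact graftMap_injective h.property k.property
      (KGr.free_injective (X := τ.obj.toKGr) (Y := σ.obj.toKGr) (congrArg (fun t => t.hom) e))⟩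
  full := ⟨fun {τ σ} f => by
    obtain ⟨f, k, hk, rfl⟩ := f
    have hv := (isReducedCover_iff k τ.obj.toJK_noIsolatedEdges σ.obj.toJK_noIsolatedEdges).1 hk
    refine ⟨⟨graftingOf k hv, graftingOf_mem k hv⟩, WideSubcategory.hom_ext _ ?_⟩
    exact congrArg (KGr.free (X := τ.obj.toKGr) (Y := σ.obj.toKGr)) (graftMap_graftingOf k hv)⟩
  essSurj := ⟨fun X => ⟨⟨ofJK X.obj.1⟩, ⟨WideSubcategory.isoMk
    (X := ⟨(ofJK X.obj.1).toKGr⟩) (Y := X)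
    (KGr.freeIso (X := (ofJK X.obj.1).toKGr) (Y := X.obj) (ofJKIso X.obj))
    (KGr.reducedCovers_free_iso (X := (ofJK X.obj.1).toKGr) (Y := X.obj) (ofJKIso X.obj))
    (KGr.reducedCovers_free_iso (X := X.obj) (Y := (ofJK X.obj.1).toKGr) (ofJKIso X.obj).symm)⟩⟩⟩

/-! ### Compressions and generic morphisms -/

/-- `hF` is the value on arcs, and `jc` follows from it, since a compression contracts actual edges
only. For `hV`, the Kleisli morphism knows the fibres only up to isomorphism, but up to isomorphism
over `σ`, so it knows which vertices of `σ` belong to each. -/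
theorem comprMap_injective {h k : σ ⟶ ρ} (hh : compressions h) (hk : compressions k)
    (e : comprMap h hh = comprMap k hk) : h = k := by
  have hF : Hom.hF h = Hom.hF k := funext fun f => Sum.inl_injective
    (congrArg (fun t : y.obj ρ.toJK ⟶ bar (y.obj σ.toJK) =>
      Species.Hom.c t (Sum.inl f : ρ.F ⊕ ρ.tails)) e)
  refine Hom.ext hF (funext fun v => ?_) (funext fun f => ?_)
  · have h1 : cls (fibrePiece h hh (Hom.hV h v)) = cls (fibrePiece k hk (Hom.hV h v)) := by
      rw [← comprMap_at, ← comprMap_at, e]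
    obtain ⟨θ, -, h2⟩ := cls_eq.1 h1
    have h3 : θ.hom ≫ fibreMap k hk (Hom.hV h v) = fibreMap h hh (Hom.hV h v) :=
      y_inj ((y.map_comp _ _).trans h2)
    -- The vertex `v` lies in the fibre of `h`; the isomorphism takes it to a vertex of the fibre of
    -- `k` with the same image in `σ`, which must be `v` again.
    let w : {w : σ.V // Hom.hV k w = Hom.hV h v} :=
      JKGraph.Hom.v θ.hom (⟨v, rfl⟩ : {w : σ.V // Hom.hV h w = Hom.hV h v})
    have h4 : w.1 = v := congrArg (fun t : fibre h (Hom.hV h v) ⟶ σ.toJK => JKGraph.Hom.v t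
      (⟨v, rfl⟩ : {w : σ.V // Hom.hV h w = Hom.hV h v})) h3
    have h5 := w.2
    rw [h4] at h5
    exact h5.symm
  · by_cases hf : f ∈ Set.range (Hom.hF h)
    · exact ((Hom.jc_fix h f).2 hf).trans ((Hom.jc_fix k f).2 (hF ▸ hf)).symm
    · exact (compression_jc h hh f hf).2.trans (compression_jc k hk f (hF ▸ hf)).2.symm

/-- Every generic morphism, given by representatives of its values, comes from a compression. -/
theorem exists_compression (d : y.obj ρ.toJK ⟶ bar (y.obj σ.toJK))
    (P : ∀ x, Piece (y.obj σ.toJK) (ρ.toJK.Fl x)) (hP : ∀ x, cls (P x) = at' d x)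
    (hd : IsIso (colimMapOf d P hP)) :
    ∃ (h : σ ⟶ ρ) (hh : compressions h), comprMap h hh = d := by
  classical
  let sh := fun x => (P x).toShell
  let f := colimMapOf d P hP
  let ι := fun x => glueι ρ.toJK sh x
  -- On each piece the isomorphism `f` from the glued graph to `σ` is the decoration of the piece.
  have hι : ∀ x, ι x ≫ f = yPre (P x).dec := fun x => by
    refine y_inj ((y.map_comp _ _).trans ?_)
    refine (congrArg (y.map (ι x) ≫ ·) (y_yPre _)).trans (Eq.trans ?_ (y_yPre _).symm)
    exact glueι_desc ρ.toJK sh _ _ _ _ x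
  obtain ⟨ba, bh, bv⟩ := bijective_of_isIso f
  let fh : ∀ x, (P x).G.H → σ.F := fun x t =>
    JKGraph.Hom.h f (⟨x, t⟩ : Σ x, (P x).G.H)
  let fv : ∀ x, (P x).G.V → σ.V := fun x v =>
    JKGraph.Hom.v f (⟨x, v⟩ : Σ x, (P x).G.V)
  have fh_bd : ∀ x t, σ.bd (fh x t) = fv x ((P x).G.p t) := fun x t =>
    (JKGraph.Hom.v_p f (⟨x, t⟩ : Σ x, (P x).G.H)).symm
  have fh_a : ∀ x t, JKGraph.Hom.a f (glueArc ρ.toJK sh x ((P x).G.s t)) =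
      (Sum.inl (fh x t) : σ.F ⊕ σ.tails) := fun x t =>
    JKGraph.Hom.a_s f (⟨x, t⟩ : Σ x, (P x).G.H)
  have fh_inner : ∀ x t u, (P x).G.i ((P x).G.s t) = (P x).G.s u →
      σ.j (fh x t) ≠ fh x t ∧ σ.j (fh x t) = fh x u := fun x t u e => by
    refine toJK_i_eq_inl ?_
    have h1 := JKGraph.Hom.a_i (ι x ≫ f) ((P x).G.s t)
    rw [e] at h1
    exact (congrArg σ.toJK.i (fh_a x t)).symm.trans (h1.symm.trans (fh_a x u))
  -- A flag `r` of `ρ` labels a port of the piece at its vertex. The arc opposite to this port is a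
  -- flag `tf r` of the piece, and its image in `σ` is the value of `hF`.
  have hex : ∀ r : ρ.F, ∃ t, (P (ρ.bd r)).G.s t =
      (P (ρ.bd r)).G.i ((P (ρ.bd r)).port ⟨r, rfl⟩).1 := fun r => (sh (ρ.bd r)).iport_mem ⟨r, rfl⟩
  choose tf htf using hex
  let hF : ρ.F → σ.F := fun r => fh (ρ.bd r) (tf r)
  -- Gluing identifies the flag `tf r` with the arc `r` of `ρ`, so `hF` is also what `d` does on
  -- colours.
  have dc : ∀ r, Species.Hom.c d (Sum.inl r : ρ.F ⊕ ρ.tails) =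
      (Sum.inl (hF r) : σ.F ⊕ σ.tails) := fun r => by
    refine Eq.trans ?_ (fh_a (ρ.bd r) (tf r))
    rw [htf r, glueArc_iport sh (ρ.bd r) ⟨r, rfl⟩]
    rfl
  have d_inj : ∀ a b : ρ.toJK.A, Species.Hom.c d a = Species.Hom.c d b → a = b := fun a b e =>
    Sum.inl_injective (ba.1 (a₁ := (Sum.inl a : ρ.toJK.A ⊕ _)) (a₂ := (Sum.inl b : ρ.toJK.A ⊕ _)) e)
  have hF_inj : Function.Injective hF := fun r r' e =>
    Sum.inl_injective (d_inj (Sum.inl r : ρ.F ⊕ ρ.tails) (Sum.inl r' : ρ.F ⊕ ρ.tails)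
      ((dc r).trans ((congrArg Sum.inl e).trans (dc r').symm)))
  have port_hF : ∀ x t (k : ρ.toJK.Fl x), (P x).G.i ((P x).G.s t) = ((P x).port k).1 →
      fh x t = hF k.1 := by
    rintro x t ⟨k, rfl⟩ e
    refine congrArg (fh (ρ.bd k)) ((P (ρ.bd k)).G.s_inj ?_)
    rw [htf, ← e, (P (ρ.bd k)).G.i_i]
  -- Arcs of `ρ` and inner arcs of the pieces are different summands of the arcs of the glued graph,
  -- and `f` is injective.
  have inner_hF : ∀ x t u, (P x).G.i ((P x).G.s t) = (P x).G.s u → fh x t ∉ Set.range hF := by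
    rintro x t u e ⟨r, hr⟩
    have h1 : JKGraph.Hom.a f (Sum.inl (Sum.inl r : ρ.F ⊕ ρ.tails) : ρ.toJK.A ⊕ _) =
        JKGraph.Hom.a f (glueArc ρ.toJK sh x ((P x).G.s t)) :=
      (dc r).trans ((congrArg Sum.inl hr).trans (fh_a x t).symm)
    have h2 := ba.1 h1
    have h3 : glueArc ρ.toJK sh x ((P x).G.s t) = _ := glueArc_inner sh x ⟨_, ⟨t, rfl⟩, ⟨u, e.symm⟩⟩
    cases h2.trans h3
  -- Ports of `ρ` stay ports in the glued graph, and the isomorphism `f` sends no port to a flag.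
  have d_port : ∀ t : ρ.tails, Species.Hom.c d (Sum.inr t : ρ.F ⊕ ρ.tails) ∉
      Set.range σ.toJK.s := by
    rintro t ⟨w, hw⟩
    obtain ⟨u, rfl⟩ := bh.2 w
    have h1 : (glue ρ.toJK sh).s u = (Sum.inl (Sum.inr t : ρ.F ⊕ ρ.tails) : ρ.toJK.A ⊕ _) :=
      ba.1 ((JKGraph.Hom.a_s f u).trans hw)
    exact toJK_not_mem_range ρ t ((glue_range_s ρ.toJK sh _).1 ⟨u, h1⟩)
  have d_i : ∀ r, Species.Hom.c d (ρ.toJK.i (Sum.inl r : ρ.F ⊕ ρ.tails)) =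
      σ.toJK.i (Sum.inl (hF r) : σ.F ⊕ σ.tails) := fun r =>
    (Species.Hom.c_inv d (Sum.inl r : ρ.F ⊕ ρ.tails)).trans (congrArg σ.toJK.i (dc r))
  -- For a tail `r`, the opposite of `hF r` is the image of a port, hence not a flag, so `hF r` is a
  -- tail. This gives commutation with `j` on tails as well as on edges, which makes `h` a
  -- compression.
  have hF_j : ∀ r, hF (ρ.j r) = σ.j (hF r) := fun r => by
    have h1 := d_i r
    by_cases hr : ρ.j r = r
    · rw [toJK_i_tail ρ r hr] at h1
      rw [hr]
      by_contra hne
      rw [toJK_i_edge σ _ (Ne.symm hne)] at h1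
      exact d_port _ ⟨_, h1.symm⟩
    · rw [toJK_i_edge ρ r hr, dc] at h1
      exact (toJK_i_eq_inl h1.symm).2.symm
  have cases : ∀ w : σ.F, w ∈ Set.range hF ∨ ∃ x t u, w = fh x t ∧
      (P x).G.i ((P x).G.s t) = (P x).G.s u := fun w => by
    obtain ⟨⟨x, t⟩, rfl⟩ := bh.2 w
    rcases (sh x).port_or_inner t with ⟨k, hk⟩ | ⟨u, hu⟩
    · exact Or.inl ⟨k.1, (port_hF x t k hk).symm⟩
    · exact Or.inr ⟨x, t, u, rfl, hu⟩
  let ev : (Σ x, (P x).G.V) ≃ σ.V := Equiv.ofBijective (JKGraph.Hom.v f) bv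
  -- A vertex of `σ` belongs to exactly one piece; `hV` is the vertex of `ρ` at which that piece
  -- sits.
  let hV : σ.V → ρ.V := fun w => (ev.symm w).1
  have hV_fv : ∀ x v, hV (fv x v) = x := fun x v =>
    congrArg Sigma.fst (ev.symm_apply_apply ⟨x, v⟩)
  have j_range : ∀ w, w ∈ Set.range hF → σ.j w ∈ Set.range hF := by
    rintro _ ⟨r, rfl⟩
    exact ⟨_, hF_j r⟩
  have j_range' : ∀ w, σ.j w ∈ Set.range hF ↔ w ∈ Set.range hF := fun w =>
    ⟨fun h => by simpa [σ.j_j] using j_range _ h, j_range w⟩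
  have j_ne : ∀ w, w ∉ Set.range hF → σ.j w ≠ w := fun w hw => by
    obtain ⟨x, t, u, rfl, e⟩ := (cases w).resolve_left hw
    exact (fh_inner x t u e).1
  -- The contracted flags keep their partners under `j`; on the range of `hF` the value is the
  -- identity, as the encoding of the contracting involution requires.
  let jc : σ.F → σ.F := fun w => if w ∈ Set.range hF then w else σ.j w
  have jc_pos : ∀ w, w ∈ Set.range hF → jc w = w := fun w hw => if_pos hw
  have jc_neg : ∀ w, w ∉ Set.range hF → jc w = σ.j w := fun w hw => if_neg hw
  let h : σ ⟶ ρ := Hom.mk hF hV jc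
    (fun w => by
      by_cases hw : w ∈ Set.range hF
      · rw [jc_pos w hw, jc_pos w hw]
      · rw [jc_neg w hw, jc_neg _ ((j_range' w).not.2 hw), σ.j_j])
    (fun w => by
      by_cases hw : w ∈ Set.range hF
      · exact ⟨fun _ => hw, jc_pos w⟩
      · exact ⟨fun e => absurd ((jc_neg w hw).symm.trans e) (j_ne w hw), jc_pos w⟩)
    hF_inj
    (fun x => by
      obtain ⟨v⟩ := (P x).eff.1
      exact ⟨fv x v, hV_fv x v⟩)
    j_range'
    (fun w hw _ => jc_neg w hw)
    (fun r => (congrArg hV (fh_bd _ _)).trans (hV_fv _ _))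
    (fun w hw => by
      rw [jc_neg w hw]
      obtain ⟨x, t, u, rfl, e⟩ := (cases w).resolve_left hw
      rw [(fh_inner x t u e).2, fh_bd, fh_bd, hV_fv, hV_fv])
    (fun r _ => hF_j r)
  have hh : compressions h := by
    refine ⟨fun r hr => (hF_j r).symm.trans (congrArg hF hr), hF_inj.injOn, fun w hw => ?_⟩
    obtain ⟨r, rfl⟩ : w ∈ Set.range hF := by
      by_contra hn
      exact j_ne w hn hw
    exact ⟨r, hF_inj ((hF_j r).trans hw), rfl⟩
  refine ⟨h, hh, dec_ext ?_ fun x => ?_⟩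
  · exact toJK_arc_ext (comprArc_i h hh) (Species.Hom.c_inv d) fun r => (dc r).symm
  · rw [comprMap_at, ← hP]
    refine Eq.symm (cls_eq.2 ?_)
    -- It remains to identify the given piece at `x` with the fibre of `h` over `x`: the isomorphism
    -- `f`, restricted to this piece, is a bijection onto the flags and the vertices lying over `x`.
    have hH : ∀ t, Hom.hV h (σ.bd (fh x t)) = x := fun t =>
      (congrArg hV (fh_bd x t)).trans (hV_fv x _)
    let eh : (P x).G.H → {w : σ.F // Hom.hV h (σ.bd w) = x} := fun t => ⟨fh x t, hH t⟩
    let ev' : (P x).G.V → {w : σ.V // Hom.hV h w = x} := fun v => ⟨fv x v, hV_fv x v⟩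
    refine rel_of_flags (P := P x) (Q := fibrePiece h hh x) eh ev' ?_ ?_ ?_ ?_ ?_
      (yPre (P x).dec) (fibreMap h hh x) (y_yPre _).symm rfl ?_ ?_
    · constructor
      · intro t t' e
        exact eq_of_heq (Sigma.mk.inj (bh.1 (congrArg Subtype.val e))).2
      · rintro ⟨w, hw⟩
        obtain ⟨⟨x', t⟩, rfl⟩ := bh.2 w
        -- A flag over `x` can only come from the piece at `x`, since `hV` reads off the index of
        -- the piece.
        obtain rfl : x' = x := ((congrArg hV (fh_bd x' t)).trans (hV_fv x' _)).symm.trans hw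
        exact ⟨t, rfl⟩
    · constructor
      · intro t t' e
        exact eq_of_heq (Sigma.mk.inj (bv.1 (congrArg Subtype.val e))).2
      · rintro ⟨w, hw⟩
        obtain ⟨⟨x', t⟩, rfl⟩ := bv.2 w
        obtain rfl : x' = x := (hV_fv x' _).symm.trans hw
        exact ⟨t, rfl⟩
    · exact fun t => Subtype.ext (fh_bd x t).symm
    · rintro t ⟨r, hr⟩ e
      have h1 : eh t = ⟨hF r, (Hom.bd_hF h r).trans hr⟩ := Subtype.ext (port_hF x t ⟨r, hr⟩ e)
      refine (congrArg (fun w => (fibre h x).i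
        (Sum.inl w : {w : σ.F // Hom.hV h (σ.bd w) = x} ⊕ {r : ρ.F // ρ.bd r = x})) h1).trans ?_
      exact fibre_i_hF h x r hr _
    -- Inner edges of the piece are off the range of `hF`, so in the fibre their flags are
    -- interchanged by `jc`, which is `j` there.
    · intro t u e
      refine (fibre_i_not h x (eh t) (inner_hF x t u e)).trans ?_
      exact congrArg Sum.inl (Subtype.ext
        ((jc_neg _ (inner_hF x t u e)).trans (fh_inner x t u e).2))
    · exact fun t => congrArg (fun q => JKGraph.Hom.h q t) (hι x)
    · exact fun v => congrArg (fun q => JKGraph.Hom.v q v) (hι x)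

/-- For objects the argument is that for `Φ₁`: the comparison isomorphism of `ofJK` is generic in
both directions. -/
theorem Φ₂_isEquivalence : Φ₂.IsEquivalence where
  faithful := ⟨fun {σ ρ} h k e => by
    apply WideSubcategory.hom_ext
    exact comprMap_injective h.property k.property
      (congrArg (fun t : Φ₂.obj σ ⟶ Φ₂.obj ρ =>
        KGr.toMap (X := ρ.obj.toKGr) (Y := σ.obj.toKGr) t.unop.hom) e)⟩
  full := ⟨fun {σ ρ} f => by
    -- Genericity is by definition invertibility of the colimit map formed with the representatives
    -- `rep`, so it is the hypothesis needed.
    obtain ⟨h, hh, e⟩ := exists_compression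
      (KGr.toMap (X := ρ.obj.toKGr) (Y := σ.obj.toKGr) f.unop.hom) _ (rep_spec _) f.unop.property
    refine ⟨⟨h, hh⟩, Quiver.Hom.unop_inj (WideSubcategory.hom_ext _ ?_)⟩
    exact KGr.ext e⟩
  essSurj := ⟨fun X => ⟨⟨ofJK X.unop.obj.1⟩, ⟨(WideSubcategory.isoMk
    (X := X.unop) (Y := ⟨(ofJK X.unop.obj.1).toKGr⟩)
    (KGr.freeIso (X := X.unop.obj) (Y := (ofJK X.unop.obj.1).toKGr) (ofJKIso X.unop.obj).symm)
    (KGr.generics_free_iso (X := X.unop.obj) (Y := (ofJK X.unop.obj.1).toKGr)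
      (ofJKIso X.unop.obj).symm)
    (KGr.generics_free_iso (X := (ofJK X.unop.obj.1).toKGr) (Y := X.unop.obj)
      (ofJKIso X.unop.obj))).op⟩⟩⟩

/-! ### The commutation laws -/

/-- A compression followed by a grafting is a grafting followed by a compression. -/
theorem exists_grafting_compression (h : τ ⟶ ω) (hh : compressions h) (k : ω ⟶ ρ)
    (hk : graftings k) : ∃ (σ : BMGraph) (g : τ ⟶ σ) (c : σ ⟶ ρ),
      graftings g ∧ compressions c ∧ g ≫ c = h ≫ k := by
  classical
  let m : τ ⟶ ρ := h ≫ k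
  -- Since `k` is surjective on flags, a flag outside the range of `m` is already contracted by the
  -- compression `h`, hence lies on an actual edge.
  have m_range : ∀ f, f ∉ Set.range (Hom.hF m) → τ.j f ≠ f := fun f hf =>
    (compression_jc h hh f (by
      rintro ⟨r, rfl⟩
      obtain ⟨t, rfl⟩ := hk.2.2 r
      exact hf ⟨t, rfl⟩)).1
  -- The flags that survive in `ρ` are paired as in `ρ`; the contracted ones keep their partners in
  -- `τ`. In this way the tails that `k` joins become edges of `σ`.
  let j : τ.F → τ.F := fun f =>
    if hf : ∃ r, Hom.hF m r = f then Hom.hF m (ρ.j hf.choose) else τ.j f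
  have j_m : ∀ r, j (Hom.hF m r) = Hom.hF m (ρ.j r) := fun r => by
    have hf : ∃ r', Hom.hF m r' = Hom.hF m r := ⟨r, rfl⟩
    refine (dif_pos hf).trans ?_
    rw [Hom.inj m hf.choose_spec]
  have j_not : ∀ f, f ∉ Set.range (Hom.hF m) → j f = τ.j f := fun f hf => dif_neg hf
  let σ : BMGraph :=
    { V := τ.V
      F := τ.F
      finV := τ.finV
      finF := τ.finF
      bd := τ.bd
      j := j
      j_j := fun f => by
        by_cases hf : f ∈ Set.range (Hom.hF m)
        · obtain ⟨r, rfl⟩ := hf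
          rw [j_m, j_m, ρ.j_j]
        · rw [j_not f hf, j_not _ ((Hom.j_range m f).not.2 hf), τ.j_j] }
  -- The edges of `τ` are kept, because `m` already sends surviving edges to edges of `ρ`; this is
  -- what `g` needs in order to be a morphism.
  have j_edge : ∀ f, τ.j f ≠ f → j f = τ.j f := fun f hj => by
    by_cases hf : f ∈ Set.range (Hom.hF m)
    · obtain ⟨r, rfl⟩ := hf
      rw [j_m, Hom.edge m r hj]
    · exact j_not f hf
  have j_range : ∀ f, j f ∈ Set.range (Hom.hF m) ↔ f ∈ Set.range (Hom.hF m) := fun f => by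
    by_cases hf : f ∈ Set.range (Hom.hF m)
    · obtain ⟨r, rfl⟩ := hf
      rw [j_m]
      exact ⟨fun _ => ⟨_, rfl⟩, fun _ => ⟨_, rfl⟩⟩
    · rw [j_not f hf]
      exact Hom.j_range m f
  let g : τ ⟶ σ := Hom.mk id id id (fun _ => rfl) (fun f => ⟨fun _ => ⟨f, rfl⟩, fun _ => rfl⟩)
    Function.injective_id Function.surjective_id
    (fun f => ⟨fun _ => ⟨f, rfl⟩, fun _ => ⟨_, rfl⟩⟩) (fun f hf => absurd ⟨f, rfl⟩ hf)
    (fun _ => rfl) (fun _ _ => rfl) j_edge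
  -- `c` has the same data as `m`; only the conditions that involve the new `j` need proof.
  let c : σ ⟶ ρ := Hom.mk (Hom.hF (τ := τ) m) (Hom.hV (τ := τ) m)
    (Hom.jc (τ := τ) m) (Hom.jc_jc m) (Hom.jc_fix m)
    (Hom.inj m) (Hom.surj m) j_range
    (fun f hf _ => (Hom.jc_edge m f hf (m_range f hf)).trans (j_not f hf).symm)
    (Hom.bd_hF m) (Hom.bd_jc m) (fun r _ => (j_m r).symm)
  refine ⟨σ, g, c, ⟨Function.bijective_id, Function.bijective_id⟩, ⟨fun r hr => ?_,
    (Hom.inj m).injOn, fun f hf => ?_⟩, Hom.ext rfl rfl (funext fun f => Hom.compJc_hF g c f)⟩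
  · exact (j_m r).trans (congrArg (Hom.hF m) hr)
  · obtain ⟨r, rfl⟩ : f ∈ Set.range (Hom.hF m) := by
      by_contra hn
      exact m_range f hn ((j_not f hn).symm.trans hf)
    exact ⟨r, Hom.inj m ((j_m r).symm.trans hf), rfl⟩

/-- This is the equation of composites on flags, with the bijections of `g` and `k` inverted: the
two ways around the square agree on the flags of `ω`. -/
theorem graftMap_comprArc {h : τ ⟶ ω} {k : ω ⟶ ρ} (hk : graftings k) {g : τ ⟶ σ}
    (hg : graftings g) {c : σ ⟶ ρ} (e : g ≫ c = h ≫ k) (t : ω.F) :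
    Hom.hF c (graftEquiv k hk t) = graftEquiv g hg (Hom.hF h t) := by
  have h1 : Hom.hF g (Hom.hF c (graftEquiv k hk t)) = Hom.hF h (Hom.hF k (graftEquiv k hk t)) :=
    congrFun (congrArg Hom.hF e) _
  rw [hF_graftEquiv] at h1
  rw [← h1, graftEquiv_hF]

/-- The square of a commutation law commutes. -/
theorem comprMap_square {h : τ ⟶ ω} (hh : compressions h) {k : ω ⟶ ρ} (hk : graftings k)
    {g : τ ⟶ σ} (hg : graftings g) {c : σ ⟶ ρ} (hc : compressions c) (e : g ≫ c = h ≫ k) :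
    y.map (graftMap k hk) ≫ comprMap c hc = comprMap h hh ≫ barMap (y.map (graftMap g hg)) := by
  refine dec_ext ?_ fun x => ?_
  · exact toJK_arc_ext (Species.Hom.c_inv (y.map (graftMap k hk) ≫ comprMap c hc))
      (Species.Hom.c_inv (comprMap h hh ≫ barMap (y.map (graftMap g hg))))
      fun t => congrArg Sum.inl (graftMap_comprArc hk hg e t)
  · let P : Piece (y.obj σ.toJK) (ω.toJK.Fl x) :=
      Piece.map (y.map (graftMap g hg)) (fibrePiece h hh x)
    let Q : Piece (y.obj σ.toJK) (ω.toJK.Fl x) :=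
      relabel (JKGraph.flMap (graftMap k hk) x) (fibrePiece c hc (Hom.hV k x))
    have hP : at' (comprMap h hh ≫ barMap (y.map (graftMap g hg))) x = cls P :=
      congrArg (Species.Hom.o (barMap (y.map (graftMap g hg)))) (comprMap_at h hh x)
    have hQ : at' (y.map (graftMap k hk) ≫ comprMap c hc) x = cls Q :=
      (at_map (graftMap k hk) (comprMap c hc) x).trans
        (congrArg ((bar (y.obj σ.toJK)).act (JKGraph.flMap (graftMap k hk) x))
          (comprMap_at c hc (Hom.hV k x)))
    rw [hP, hQ]
    refine Eq.symm (cls_eq.2 ?_)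
    have hV : ∀ v, Hom.hV c (Hom.hV g v) = Hom.hV k (Hom.hV h v) := fun v =>
      congrFun (congrArg Hom.hV e) v
    have bd_g : ∀ f, Hom.hV g (τ.bd f) = σ.bd (graftEquiv g hg f) := fun f =>
      JKGraph.Hom.v_p (graftMap g hg) f
    -- The value of one path at `x` is the fibre of `h` over `x`, that of the other is the fibre of
    -- `c` over the image of `x`; `g` matches their flags and vertices.
    let eh : {f : τ.F // Hom.hV h (τ.bd f) = x} → {f : σ.F // Hom.hV c (σ.bd f) = Hom.hV k x} :=
      fun f => ⟨graftEquiv g hg f.1, by rw [← bd_g, hV, f.2]⟩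
    let ev : {v : τ.V // Hom.hV h v = x} → {v : σ.V // Hom.hV c v = Hom.hV k x} :=
      fun v => ⟨Hom.hV g v.1, by rw [hV, v.2]⟩
    refine rel_of_flags (P := P) (Q := Q) eh ev ?_ ?_ ?_ ?_ ?_ (fibreMap h hh x ≫ graftMap g hg)
      (fibreMap c hc (Hom.hV k x)) (y.map_comp _ _).symm rfl (fun _ => rfl) (fun _ => rfl)
    · constructor
      · exact fun f f' e' => Subtype.ext ((graftEquiv g hg).injective (congrArg Subtype.val e'))
      · rintro ⟨f, hf⟩
        obtain ⟨f, rfl⟩ := (graftEquiv g hg).surjective f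
        rw [← bd_g, hV] at hf
        -- Injectivity of `k` on vertices ensures that nothing else lies over the image of `x`.
        exact ⟨⟨f, hk.1.1 hf⟩, rfl⟩
    · constructor
      · exact fun v v' e' => Subtype.ext (hg.1.1 (congrArg Subtype.val e'))
      · rintro ⟨v, hv⟩
        obtain ⟨v, rfl⟩ := hg.1.2 v
        rw [hV] at hv
        exact ⟨⟨v, hk.1.1 hv⟩, rfl⟩
    · exact fun f => Subtype.ext (bd_g f.1)
    · rintro f ⟨r, hr⟩ e'
      have h1 := congrArg (fibre h x).i e'
      -- In a fibre the flag opposite to the port labelled `r` is the image of `r`.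
      have h2 : f.1 = Hom.hF h r :=
        congrArg Subtype.val (Sum.inl_injective (((fibre h x).i_i _).symm.trans h1))
      have h3 := graftMap_comprArc hk hg e r
      rw [← h2] at h3
      have hr' : ρ.bd (graftEquiv k hk r) = Hom.hV k x :=
        (JKGraph.Hom.v_p (graftMap k hk) r).symm.trans (congrArg (Hom.hV k) hr)
      have h4 : eh f = ⟨Hom.hF c (graftEquiv k hk r), (Hom.bd_hF c _).trans hr'⟩ :=
        Subtype.ext h3.symm
      exact (congrArg (fun w => (fibre c (Hom.hV k x)).i (Sum.inl w :
        {f : σ.F // Hom.hV c (σ.bd f) = Hom.hV k x} ⊕ {r : ρ.F // ρ.bd r = Hom.hV k x})) h4).trans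
          (fibre_i_hF c _ _ hr' _)
    · intro f u e'
      have hf : f.1 ∉ Set.range (Hom.hF h) := by
        obtain ⟨f, hf⟩ := f
        rintro ⟨r, rfl⟩
        cases (fibre_i_hF h x r ((Hom.bd_hF h r).symm.trans hf) hf).symm.trans e'
      have hu : Hom.jc h f.1 = u.1 :=
        congrArg Subtype.val (Sum.inl_injective ((fibre_i_not h x f hf).symm.trans e'))
      -- A flag contracted by `h` is contracted by `c` after transport along `g`, as the two
      -- composites have the same range.
      have hgf : graftEquiv g hg f.1 ∉ Set.range (Hom.hF c) := by
        rintro ⟨r, hr⟩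
        refine hf ⟨Hom.hF k r, ?_⟩
        have h1 : Hom.hF g (Hom.hF c r) = Hom.hF h (Hom.hF k r) := congrFun (congrArg Hom.hF e) r
        rw [← h1, hr, hF_graftEquiv]
      refine (fibre_i_not c _ (eh f) hgf).trans (congrArg Sum.inl (Subtype.ext ?_))
      refine Hom.inj g ?_
      -- The involutions of the two composites agree. At this flag one is `jc` of `h`, and the other
      -- is `jc` of `c` transported along `g`, because the grafting `g` contracts nothing.
      have h1 : Hom.compJc g c f.1 = Hom.compJc h k f.1 := congrFun (congrArg Hom.jc e) f.1
      have h2 := Hom.compJc_hF g c (graftEquiv g hg f.1)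
      rw [hF_graftEquiv, h1, Hom.compJc_not h k f.1 hf, hu] at h2
      exact h2.symm.trans (hF_graftEquiv g hg u.1).symm

/-- The square of a commutation law is a pushout. -/
theorem isPushout_square {h : τ ⟶ ω} (hh : compressions h) {k : ω ⟶ ρ} (hk : graftings k)
    {g : τ ⟶ σ} (hg : graftings g) {c : σ ⟶ ρ} (hc : compressions c) (e : g ≫ c = h ≫ k) :
    IsPushout (KGr.free (X := ω.toKGr) (Y := ρ.toKGr) (graftMap k hk))
      (KGr.ofMap (X := ω.toKGr) (Y := τ.toKGr) (comprMap h hh))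
      (KGr.ofMap (X := ρ.toKGr) (Y := σ.toKGr) (comprMap c hc))
      (KGr.free (X := τ.toKGr) (Y := σ.toKGr) (graftMap g hg)) := by
  refine KGr.isPushout_of_cover (X := ω.toKGr) (Y := ρ.toKGr) (Z := τ.toKGr) (W := σ.toKGr)
    (graftMap k hk) (graftMap_reduced k hk).1 _ _ (graftMap g hg) (graftMap_reduced g hg) ?_ ?_
  · apply KGr.ext
    refine (KGr.toMap_free_comp (X := ω.toKGr) (Y := ρ.toKGr) (Z := σ.toKGr)
      (graftMap k hk) _).trans ((comprMap_square hh hk hg hc e).trans ?_)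
    exact (KGr.toMap_comp_free (X := ω.toKGr) (Y := τ.toKGr) (Z := σ.toKGr)
      (KGr.ofMap (comprMap h hh)) (graftMap g hg)).symm
  · intro T α β hαβ
    have hα := (KGr.toMap_free_comp (X := ω.toKGr) (Y := ρ.toKGr) (graftMap k hk) α).symm.trans
      (congrArg KGr.toMap hαβ)
    let b : τ.F ⊕ τ.tails → T.1.A := Species.Hom.c (KGr.toMap β)
    have b_i : ∀ a : τ.toJK.A, b (τ.toJK.i a) = T.1.i (b a) := Species.Hom.c_inv (KGr.toMap β)
    let a : ρ.F ⊕ ρ.tails → T.1.A := Species.Hom.c (KGr.toMap α)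
    have a_i : ∀ r : ρ.toJK.A, a (ρ.toJK.i r) = T.1.i (a r) := Species.Hom.c_inv (KGr.toMap α)
    -- On the flags of `ρ` the colours of `α` are those of `β` at the corresponding flags of `τ`, by
    -- commutativity over `ω`.
    have hab : ∀ r, a (Sum.inl r) = b (Sum.inl (Hom.hF h (Hom.hF k r))) := fun r => by
      have h1 := congrArg (fun d : y.obj ω.toJK ⟶ bar (y.obj T.1) =>
        Species.Hom.c d (Sum.inl (Hom.hF k r) : ω.F ⊕ ω.tails)) hα
      have h2 : a (Sum.inl (graftEquiv k hk (Hom.hF k r))) =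
        b (Sum.inl (Hom.hF h (Hom.hF k r))) := h1
      rwa [graftEquiv_hF] at h2
    have hgh : ∀ r, Hom.hF g (Hom.hF c r) = Hom.hF h (Hom.hF k r) := fun r =>
      congrFun (congrArg Hom.hF e) r
    -- The core of the descent: the colours of `β` at the two flags of an edge of `σ` are inverse to
    -- each other.
    have b_j : ∀ f, σ.j f ≠ f →
        b (Sum.inl (Hom.hF g (σ.j f))) = T.1.i (b (Sum.inl (Hom.hF g f))) := fun f hf => by
      by_cases hj : τ.j (Hom.hF g f) = Hom.hF g f
      -- A new edge: its flag is a tail of `τ`, so it comes from a tail of `ω` since `h` is a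
      -- compression, and then from a flag `r` of `ρ`. As `c` commutes with `j`, the edge is the
      -- image of an edge of `ρ`, along which the colours of `α` match.
      · obtain ⟨t, -, ht⟩ := hh.2.2 hj
        obtain ⟨r, rfl⟩ := hk.2.2 t
        obtain rfl : f = Hom.hF c r := Hom.inj g (ht.symm.trans (hgh r).symm)
        have hr : ρ.j r ≠ r := fun h1 => hf (by rw [← compression_j c hc, h1])
        have h1 := a_i (Sum.inl r : ρ.F ⊕ ρ.tails)
        rw [toJK_i_edge ρ r hr] at h1
        rw [← compression_j c hc, hgh, hgh, ← hab, ← hab]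
        exact h1
      · rw [Hom.edge g f hj]
        have h1 := b_i (Sum.inl (Hom.hF g f) : τ.F ⊕ τ.tails)
        rwa [toJK_i_edge τ _ hj] at h1
    -- The colours on flags are forced by the bijection of `g`, and those on copies of tails by
    -- equivariance.
    let γ : σ.F ⊕ σ.tails → T.1.A := Sum.elim (fun f => b (Sum.inl (Hom.hF g f)))
      (fun t => T.1.i (b (Sum.inl (Hom.hF g t.1))))
    have γ_i : ∀ u : σ.toJK.A, γ (σ.toJK.i u) = T.1.i (γ u) := by
      rintro (f | t)
      · by_cases hf : σ.j f = f
        · rw [toJK_i_tail σ f hf]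
          rfl
        · rw [toJK_i_edge σ f hf]
          exact b_j f hf
      · exact (T.1.i_i _).symm
    refine ⟨γ, γ_i, toJK_arc_ext (inv := T.1.i) (fun u => ?_) b_i fun f => ?_⟩
    · rw [JKGraph.Hom.a_i]
      exact γ_i _
    · exact congrArg (fun w => b (Sum.inl w)) (hF_graftEquiv g hg f)

end BMGraph

end BM

end

/-- The equivalences `Φ₁` (graftings are reduced covers) and `Φ₂` (compressions are generic
morphisms read backwards) exchange the two commutation laws: given a compression `h` followed by a
grafting `k`, there is a grafting `g` followed by a compression `c` with the same composite, and for
all such `g` and `c` the images of the four morphisms form a pushout square. -/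
theorem mainTheorem7 :
    BM.BMGraph.Φ₁.IsEquivalence ∧ BM.BMGraph.Φ₂.IsEquivalence ∧
    ∀ (τ ω ρ : BM.BMGraph) (h : τ ⟶ ω) (hh : BM.BMGraph.compressions h)
      (k : ω ⟶ ρ) (hk : BM.BMGraph.graftings k),
      (∃ (σ : BM.BMGraph) (g : τ ⟶ σ) (c : σ ⟶ ρ),
        BM.BMGraph.graftings g ∧ BM.BMGraph.compressions c ∧ g ≫ c = h ≫ k) ∧
      ∀ (σ : BM.BMGraph) (g : τ ⟶ σ) (hg : BM.BMGraph.graftings g)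
        (c : σ ⟶ ρ) (hc : BM.BMGraph.compressions c), g ≫ c = h ≫ k →
        IsPushout
          (BM.BMGraph.Φ₁.map (X := ⟨ω⟩) (Y := ⟨ρ⟩) ⟨k, hk⟩).hom
          (BM.BMGraph.Φ₂.map (X := ⟨τ⟩) (Y := ⟨ω⟩) ⟨h, hh⟩).unop.hom
          (BM.BMGraph.Φ₂.map (X := ⟨σ⟩) (Y := ⟨ρ⟩) ⟨c, hc⟩).unop.hom
          (BM.BMGraph.Φ₁.map (X := ⟨τ⟩) (Y := ⟨σ⟩) ⟨g, hg⟩).hom :=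
  ⟨BM.BMGraph.Φ₁_isEquivalence, BM.BMGraph.Φ₂_isEquivalence, fun _ _ _ h hh k hk =>
    ⟨BM.BMGraph.exists_grafting_compression h hh k hk, fun _ _ hg _ hc e =>
      BM.BMGraph.isPushout_square hh hk hg hc e⟩⟩
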